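/- Setting. Let $d\ge 1$, let $\mathsf Z$ be a Polish space with its Borel $\sigma$-field, $\mathrm Q$ a Markov kernel on $\mathsf Z$, and $\mathbf A:\mathsf Z\to\mathbb R^{d\times d}$, $\mathbf b:\mathsf Z\to\mathbb R^d$ measurable. Let $\bar{\mathbf A}\in\mathbb R^{d\times d}$, $\bar{\mathbf b}\in\mathbb R^d$, and write $\tilde{\mathbf A}(z)=\mathbf A(z)-\bar{\mathbf A}$, $\theta^\star=\bar{\mathbf A}^{-1}\bar{\mathbf b}$, $\varepsilon(z)=\tilde{\mathbf A}(z)\theta^\star-(\mathbf b(z)-\bar{\mathbf b})$. Norms are Euclidean and spectral norms; $\wedge,\vee$ denote minimum and maximum. Assume: (A1) $C_{\mathbf A}=\sup_z\|\mathbf A(z)\|\vee\sup_z\|\tilde{\mathbf A}(z)\|<\infty$, and $-\bar{\mathbf A}$ is Hurwitz (all its eigenvalues have negative real part); (A2) $\int\mathbf A\,d\pi=\bar{\mathbf A}$, $\int\mathbf b\,d\pi=\bar{\mathbf b}$, and $\|\varepsilon\|_\infty=\sup_z\|\varepsilon(z)\|<\infty$; (A3) $\pi$ is a probability measure invariant for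 $\mathrm Q$, and there is an integer $t_{\rm mix}\ge1$ such that $\sup_{z,z'}\tfrac12\|\mathrm Q^k(z,\cdot)-\mathrm Q^k(z',\cdot)\|_{\rm TV}\le(1/4)^{\lfloor k/t_{\rm mix}\rfloor}$ for all $k\ge1$, where $\|\mu\|_{\rm TV}=|\mu|(\mathsf Z)$. Constants. Let $Q$ be the unique symmetric positive definite solution of $\bar{\mathbf A}^\top Q+Q\bar{\mathbf A}=\mathrm I$, $\kappa_Q=\lambda_{\max}(Q)/\lambda_{\min}(Q)$, $a=\|Q\|^{-1}/2$, $\|x\|_Q=(x^\top Qx)^{1/2}$ with operator norm $\|\cdot\|_Q$, $\alpha_\infty=\tfrac12\|\bar{\mathbf A}\|_Q^{-2}\|Q\|^{-1}\wedge\|Q\|$, $m=\lceil 8\kappa_Q^{1/2}C_{\mathbf A}/a\rceil$, $$\alpha^{(M)}_\infty=\Big[\alpha_\infty\wedge\kappa_Q^{-1/2}C_{\mathbf A}^{-1}\wedge\frac{a}{6e\,\kappa_Q C_{\mathbf A}}\Big]m^{-1},\qquad C_\Gamma=4(\kappa_Q^{1/2}C_{\mathbf A}+a/6)^2\,m,\qquad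 \alpha^{(M)}_{q,\infty}=\alpha^{(M)}_\infty\wedge\frac{a}{12\,C_\Gamma\,q},$$ $$\alpha^{(b)}_\infty=\Big(\alpha^{(M)}_{2(1+\log d),\infty}\wedge\frac1{1+C_{\mathbf A}}\wedge\frac1{2a}\Big)t_{\rm mix}^{-1}.$$ Processes. Let $(Z_k)_{k\ge0}$ be a Markov chain with kernel $\mathrm Q$ and arbitrary initial law, and for $n\ge 1$ put $$J^{(0,\alpha)}_n=(\mathrm I-\alpha\bar{\mathbf A})J^{(0,\alpha)}_{n-1}-\alpha\,\varepsilon(Z_n),\qquad J^{(1,\alpha)}_n=(\mathrm I-\alpha\bar{\mathbf A})J^{(1,\alpha)}_{n-1}-\alpha\,\tilde{\mathbf A}(Z_n)J^{(0,\alpha)}_{n-1},$$ started at arbitrary deterministic vectors (for instance $J_0^{(0,\alpha)}=J_0^{(1,\alpha)}=0$). Put $Y_t=(Z_{t+1},J^{(0,\alpha)}_t,J^{(1,\alpha)}_t)$ and $V_t=(J^{(0,\alpha)}_t,Z_{t+1})$. Let $\mathrm Q_{J^{(1)}}$ be the kernel on $\mathsf Z\times\mathbb R^d\times\mathbb R^d$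 that moves $(z,j_0,j_1)$ to $\big(z',(\mathrm I-\alpha\bar{\mathbf A})j_0-\alpha\varepsilon(z),(\mathrm I-\alpha\bar{\mathbf A})j_1-\alpha\tilde{\mathbf A}(z)j_0\big)$ with $z'\sim\mathrm Q(z,\cdot)$, and $\mathrm Q_J$ the kernel on $\mathbb R^d\times\mathsf Z$ that moves $(j,z)$ to $\big((\mathrm I-\alpha\bar{\mathbf A})j-\alpha\varepsilon(z),z'\big)$ with $z'\sim\mathrm Q(z,\cdot)$. For a cost function $c\ge 0$ put $\mathbf W_c(\mu,\nu)=\inf_\Gamma\int c\,d\Gamma$ over couplings $\Gamma$ of $\mu,\nu$, and let $$c\big((z,j_0,j_1),(\tilde z,\tilde j_0,\tilde j_1)\big)=\|j_0-\tilde j_0\|+\|j_1-\tilde j_1\|+\big(\|j_0\|+\|\tilde j_0\|+\|j_1\|+\|\tilde j_1\|+\sqrt{\alpha a}\,\|\varepsilon\|_\infty\big)\mathbf 1\{z\ne\tilde z\},$$ $$c_J\big((j,z),(\tilde j,\tilde z)\big)=\|j-\tilde j\|+\big(\|j\|+\|\tilde j\|+\sqrt{\alpha a}\,\|\varepsilon\|_\infty\big)\mathbf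 1\{z\ne\tilde z\}.$$ Statement. There is a function $C$ of three real variables such that in every such setting and for every $\alpha\in(0,\alpha^{(b)}_\infty)$: 1. $(Y_t)_{t\ge0}$ is a Markov chain with kernel $\mathrm Q_{J^{(1)}}$, and $\mathrm Q_{J^{(1)}}$ has a unique stationary distribution $\Pi_{J^{(1)},\alpha}$; 2. $(V_t)_{t\ge0}$ is a Markov chain with kernel $\mathrm Q_J$, and $\mathrm Q_J$ has a unique stationary distribution $\Pi_{J,\alpha}$; 3. for all $n\ge1$ and all $y,\tilde y\in\mathsf Z\times\mathbb R^d\times\mathbb R^d$, $$\mathbf W_c(\delta_y\mathrm Q_{J^{(1)}}^n,\delta_{\tilde y}\mathrm Q_{J^{(1)}}^n)\le C(\kappa_Q,a,C_{\mathbf A})\,t_{\rm mix}^{3/2}\,e^{-\alpha an/12}\sqrt{\log(1/(\alpha a))}\;c(y,\tilde y),$$ and, for all $v,\tilde v\in\mathbb R^d\times\mathsf Z$, the same bound holds with $\mathrm Q_J$, $c_J$, $v,\tilde v$ in place of $\mathrm Q_{J^{(1)}}$, $c$, $y,\tilde y$. -/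

import Mathlib

open MeasureTheory ProbabilityTheory
open scoped ENNReal

noncomputable section

namespace MarkovLSA

/-! ### Markov chains, Dobrushin coefficients, Wasserstein costs -/

section General

variable {S : Type*} [MeasurableSpace S]

theorem isMarkovKernel_pow (κ : Kernel S S) [IsMarkovKernel κ] (n : ℕ) :
    IsMarkovKernel (κ ^ n) := by
  induction n with
  | zero =>
    rw [pow_zero]
    exact (inferInstance : IsMarkovKernel (Kernel.id : Kernel S S))
  | succ k ih =>
    rw [pow_succ]
    exact (inferInstance : IsMarkovKernel ((κ ^ k) ∘ₖ κ))

/-- The total variation norm `|μ - ν|(S)` of the difference of two finite measures. -/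
def tvNorm (μ ν : Measure S) [IsFiniteMeasure μ] [IsFiniteMeasure ν] : ℝ≥0∞ :=
  (μ.toSignedMeasure - ν.toSignedMeasure).totalVariation Set.univ

/-- The Dobrushin coefficient `sup_{z, z'} (1/2) ‖κ(z, ·) - κ(z', ·)‖_TV`. -/
def dobrushin (κ : Kernel S S) [IsMarkovKernel κ] : ℝ≥0∞ :=
  ⨆ (z : S) (z' : S), (1 / 2 : ℝ≥0∞) * tvNorm (κ z) (κ z')

/-- Uniform geometric ergodicity with mixing time `tmix`:
`Δ(κ ^ k) ≤ (1/4) ^ ⌊k / tmix⌋` for all `k ≥ 1`. -/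
def UniformlyErgodic (κ : Kernel S S) [IsMarkovKernel κ] (tmix : ℕ) : Prop :=
  1 ≤ tmix ∧ ∀ k : ℕ, 1 ≤ k →
    haveI := isMarkovKernel_pow κ k
    dobrushin (κ ^ k) ≤ (1 / 4 : ℝ≥0∞) ^ (k / tmix)

/-- The σ-algebra generated by `X 0, …, X n`. -/
abbrev pastSigma {Ω : Type*} (X : ℕ → Ω → S) (n : ℕ) : MeasurableSpace Ω :=
  ⨆ k : ℕ, ⨆ _ : k ≤ n, MeasurableSpace.comap (X k) inferInstance

/-- `X` is a (time-homogeneous) Markov chain with transition kernel `κ` under `P`, with respect to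
its natural filtration, whatever the law of `X 0`. -/
def IsMarkovChain {Ω : Type*} [MeasurableSpace Ω] (P : Measure Ω) (κ : Kernel S S)
    (X : ℕ → Ω → S) : Prop :=
  (∀ n, Measurable (X n)) ∧
    ∀ (n : ℕ) (B : Set S), MeasurableSet B →
      P[(X (n + 1) ⁻¹' B).indicator (fun _ => (1 : ℝ)) | pastSigma X n]
        =ᵐ[P] fun ω => (κ (X n ω)).real B

/-- `μ` is a stationary distribution of `κ`. -/
def IsStationaryDistribution (κ : Kernel S S) (μ : Measure S) : Prop :=
  IsProbabilityMeasure μ ∧ Kernel.Invariant κ μ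

/-- The set of couplings of `μ` and `ν`. -/
def couplings (μ ν : Measure S) : Set (Measure (S × S)) :=
  {Γ | Γ.map Prod.fst = μ ∧ Γ.map Prod.snd = ν}

/-- The Wasserstein semimetric with (nonnegative) cost function `c`:
the infimum of `∫ c dΓ` over the couplings `Γ` of `μ` and `ν`. -/
def wasserstein (c : S → S → ℝ) (μ ν : Measure S) : ℝ≥0∞ :=
  ⨅ Γ ∈ couplings μ ν, ∫⁻ p, ENNReal.ofReal (c p.1 p.2) ∂Γ

end General

/-! ### Matrices -/

/-- `ℝ^d` with the Euclidean norm. -/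
abbrev Vec (d : ℕ) := EuclideanSpace ℝ (Fin d)

/-- Real `d × d` matrices. -/
abbrev Mat (d : ℕ) := Matrix (Fin d) (Fin d) ℝ

section Mat

variable {d : ℕ}

/-- The matrix-vector product on Euclidean space. -/
def act (M : Mat d) (v : Vec d) : Vec d := Matrix.toEuclideanCLM (𝕜 := ℝ) M v

/-- The spectral norm. -/
def specNorm (M : Mat d) : ℝ := ‖Matrix.toEuclideanCLM (𝕜 := ℝ) M‖

/-- All complex eigenvalues have negative real part. -/
def IsHurwitz (M : Mat d) : Prop :=
  ∀ l ∈ spectrum ℂ (M.map (algebraMap ℝ ℂ)), l.re < 0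

/-- The symmetric positive definite solution `Q` of the Lyapunov equation `MᵀQ + QM = I`
(it exists and is unique when `-M` is Hurwitz). -/
def lyapunov (M : Mat d) : Mat d :=
  Classical.epsilon fun Q : Mat d => Q.PosDef ∧ M.transpose * Q + Q * M = 1

/-- The norm `‖x‖_Q = (xᵀ Q x)^{1/2}`. -/
def qNorm (Q : Mat d) (x : Vec d) : ℝ := Real.sqrt (inner ℝ x (act Q x))

/-- The operator norm `‖M‖_Q = max_{‖x‖_Q = 1} ‖M x‖_Q`. -/
def qOpNorm (Q M : Mat d) : ℝ := sSup {r | ∃ x : Vec d, qNorm Q x = 1 ∧ r = qNorm Q (act M x)}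

/-- The condition number `λ_max(Q) / λ_min(Q)`. -/
def condNumber (Q : Mat d) : ℝ := sSup (spectrum ℝ Q) / sInf (spectrum ℝ Q)

end Mat

/-! ### The linear stochastic approximation model -/

/-- Data of a Markovian linear stochastic approximation problem: a Markov kernel `Q` on `Zs`, a
measure `π`, measurable functions `A`, `b`, and a target system with matrix `Abar` and right-hand
side `bbar`. The assumptions on these data are `AssumptionA`, `AssumptionNoise` and
`AssumptionMixing`. -/
structure Model (d : ℕ) (Zs : Type*) [MeasurableSpace Zs] where
  Q : Kernel Zs Zs
  isMarkov : IsMarkovKernel Q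
  π : Measure Zs
  A : Zs → Mat d
  measurable_A : ∀ i j, Measurable fun z => A z i j
  b : Zs → Vec d
  measurable_b : Measurable b
  Abar : Mat d
  bbar : Vec d

attribute [instance] Model.isMarkov

namespace Model

variable {d : ℕ} {Zs : Type*} [MeasurableSpace Zs] (M : Model d Zs)

/-- The solution `θ⋆` of `Abar θ = bbar`. -/
def thetaStar : Vec d := act M.Abar⁻¹ M.bbar

/-- The centered matrix `A(z) - Abar`. -/
def Atilde (z : Zs) : Mat d := M.A z - M.Abar

/-- The centered vector `b(z) - bbar`. -/
def btilde (z : Zs) : Vec d := M.b z - M.bbar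

/-- The noise `ε(z) = (A(z) - Abar) θ⋆ - (b(z) - bbar)`. -/
def noise (z : Zs) : Vec d := act (M.Atilde z) M.thetaStar - M.btilde z

/-- `C_A = sup_z ‖A(z)‖ ∨ sup_z ‖A(z) - Abar‖`. -/
def CA : ℝ := max (⨆ z, specNorm (M.A z)) (⨆ z, specNorm (M.Atilde z))

/-- `‖ε‖_∞ = sup_z ‖ε(z)‖`. -/
def noiseSup : ℝ := ⨆ z, ‖M.noise z‖

/-- `C_A < ∞` and `-Abar` is Hurwitz. -/
def AssumptionA : Prop :=
  BddAbove (Set.range fun z => specNorm (M.A z)) ∧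
    BddAbove (Set.range fun z => specNorm (M.Atilde z)) ∧ IsHurwitz (-M.Abar)

/-- `∫ A dπ = Abar`, `∫ b dπ = bbar` (coordinatewise) and `‖ε‖_∞ < ∞`. -/
def AssumptionNoise : Prop :=
  (∀ i j, Integrable (fun z => M.A z i j) M.π ∧ ∫ z, M.A z i j ∂M.π = M.Abar i j) ∧
    (∀ i, Integrable (fun z => M.b z i) M.π ∧ ∫ z, M.b z i ∂M.π = M.bbar i) ∧
    BddAbove (Set.range fun z => ‖M.noise z‖)

/-- `π` is an invariant distribution of the kernel `Q`, which is uniformly geometrically ergodic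
with mixing time `tmix`. -/
def AssumptionMixing (tmix : ℕ) : Prop :=
  IsStationaryDistribution M.Q M.π ∧ UniformlyErgodic M.Q tmix

/-! Step size thresholds -/

/-- The solution of the Lyapunov equation of `Abar`. -/
def lyap : Mat d := lyapunov M.Abar

/-- `a = ‖Q‖⁻¹ / 2`, with `Q` the solution of the Lyapunov equation. -/
def a : ℝ := (specNorm M.lyap)⁻¹ / 2

/-- `κ_Q = λ_max(Q) / λ_min(Q)`. -/
def kappa : ℝ := condNumber M.lyap

/-- `α_∞ = (1/2) ‖Abar‖_Q⁻² ‖Q‖⁻¹ ∧ ‖Q‖`. -/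
def alphaInf : ℝ :=
  min ((1 / 2) * (qOpNorm M.lyap M.Abar ^ 2)⁻¹ * (specNorm M.lyap)⁻¹) (specNorm M.lyap)

/-- The integer `⌈8 κ_Q^{1/2} C_A / a⌉`. -/
def blockLength : ℕ := ⌈8 * Real.sqrt M.kappa * M.CA / M.a⌉₊

/-- `α_∞^{(M)} = [α_∞ ∧ κ_Q^{-1/2} C_A⁻¹ ∧ a / (6 e κ_Q C_A)] ⌈8 κ_Q^{1/2} C_A / a⌉⁻¹`. -/
def alphaM : ℝ :=
  min (min M.alphaInf ((Real.sqrt M.kappa)⁻¹ * M.CA⁻¹))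
    (M.a / (6 * Real.exp 1 * M.kappa * M.CA)) * (M.blockLength : ℝ)⁻¹

/-- `C_Γ = 4 (κ_Q^{1/2} C_A + a / 6)² ⌈8 κ_Q^{1/2} C_A / a⌉`. -/
def CGamma : ℝ := 4 * (Real.sqrt M.kappa * M.CA + M.a / 6) ^ 2 * (M.blockLength : ℝ)

/-- `α_{q,∞}^{(M)} = α_∞^{(M)} ∧ (a / (12 C_Γ)) / q`. -/
def alphaMq (q : ℝ) : ℝ := min M.alphaM (M.a / (12 * M.CGamma) / q)

/-- `α_{p,∞}^{(b)} = (α_{p(1 + log d),∞}^{(M)} ∧ 1 / (1 + C_A) ∧ 1 / (a p)) / tmix`. -/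
def alphaBp (tmix : ℕ) (p : ℝ) : ℝ :=
  min (min (M.alphaMq (p * (1 + Real.log d))) (1 / (1 + M.CA))) (1 / (M.a * p)) * (tmix : ℝ)⁻¹

/-- `α_∞^{(b)} = α_{2,∞}^{(b)}`. -/
def alphaB (tmix : ℕ) : ℝ := M.alphaBp tmix 2

/-! The processes `J⁽⁰⁾`, `J⁽¹⁾` and their Markov kernels -/

/-- One step of the recursion for `J⁽⁰⁾`: `(I - α Abar) j₀ - α ε(z)`. -/
def step0 (α : ℝ) (z : Zs) (j₀ : Vec d) : Vec d :=
  act (1 - α • M.Abar) j₀ - α • M.noise z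

/-- One step of the recursion for `J⁽¹⁾`: `(I - α Abar) j₁ - α (A(z) - Abar) j₀`. -/
def step1 (α : ℝ) (z : Zs) (j₀ j₁ : Vec d) : Vec d :=
  act (1 - α • M.Abar) j₁ - α • act (M.Atilde z) j₀

/-- `J⁽⁰⁾_n` along a noise sequence `z`, started at `j₀`. -/
def J0 (α : ℝ) (z : ℕ → Zs) (j₀ : Vec d) : ℕ → Vec d
  | 0 => j₀
  | n + 1 => M.step0 α (z (n + 1)) (J0 α z j₀ n)

/-- `J⁽¹⁾_n` along a noise sequence `z`, started at `j₁` (and `J⁽⁰⁾` at `j₀`). -/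
def J1 (α : ℝ) (z : ℕ → Zs) (j₀ j₁ : Vec d) : ℕ → Vec d
  | 0 => j₁
  | n + 1 => M.step1 α (z (n + 1)) (M.J0 α z j₀ n) (J1 α z j₀ j₁ n)

/-- `Y_t = (Z_{t+1}, J⁽⁰⁾_t, J⁽¹⁾_t)`. -/
def Y {Ω : Type*} (α : ℝ) (Z : ℕ → Ω → Zs) (j₀ j₁ : Vec d) (t : ℕ) (ω : Ω) :
    Zs × Vec d × Vec d :=
  (Z (t + 1) ω, M.J0 α (fun k => Z k ω) j₀ t, M.J1 α (fun k => Z k ω) j₀ j₁ t)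

/-- `V_t = (J⁽⁰⁾_t, Z_{t+1})`. -/
def V {Ω : Type*} (α : ℝ) (Z : ℕ → Ω → Zs) (j₀ : Vec d) (t : ℕ) (ω : Ω) : Vec d × Zs :=
  (M.J0 α (fun k => Z k ω) j₀ t, Z (t + 1) ω)

theorem measurable_act (N : Mat d) : Measurable (act N) :=
  (Matrix.toEuclideanCLM (𝕜 := ℝ) N).continuous.measurable

theorem measurable_act_Atilde : Measurable fun p : Zs × Vec d => act (M.Atilde p.1) p.2 := by
  have h : (fun p : Zs × Vec d => act (M.Atilde p.1) p.2)
      = fun p => WithLp.toLp 2 (fun i => ∑ j, (M.A p.1 i j - M.Abar i j) * p.2 j) := by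
    funext p
    ext i
    simp [act, Atilde, Matrix.mulVec, dotProduct, sub_mul]
  rw [h]
  refine (WithLp.measurable_toLp 2 _).comp (measurable_pi_lambda _ fun i => ?_)
  refine Finset.measurable_sum _ fun j _ => ?_
  have h1 : Measurable fun p : Zs × Vec d => M.A p.1 i j :=
    (M.measurable_A i j).comp measurable_fst
  have h2 : Measurable fun p : Zs × Vec d => p.2 j := by fun_prop
  exact (h1.sub_const _).mul h2

theorem measurable_act_Atilde_comp {T : Type*} [MeasurableSpace T] {f : T → Zs} {g : T → Vec d}
    (hf : Measurable f) (hg : Measurable g) : Measurable fun t => act (M.Atilde (f t)) (g t) := by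
  have h := M.measurable_act_Atilde.comp (hf.prodMk hg)
  exact h

theorem measurable_noise : Measurable M.noise := by
  have h1 : Measurable fun z : Zs => act (M.Atilde z) M.thetaStar :=
    M.measurable_act_Atilde_comp measurable_id measurable_const
  have h2 : Measurable fun z : Zs => M.btilde z := M.measurable_b.sub_const _
  exact Measurable.sub h1 h2

theorem measurable_step0_comp (α : ℝ) {T : Type*} [MeasurableSpace T] {f : T → Zs} {g : T → Vec d}
    (hf : Measurable f) (hg : Measurable g) : Measurable fun t => M.step0 α (f t) (g t) := by
  have h1 := (measurable_act (1 - α • M.Abar)).comp hg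
  have h2 := (M.measurable_noise.comp hf).const_smul α
  exact Measurable.sub h1 h2

theorem measurable_step1_comp (α : ℝ) {T : Type*} [MeasurableSpace T] {f : T → Zs}
    {g h : T → Vec d} (hf : Measurable f) (hg : Measurable g) (hh : Measurable h) :
    Measurable fun t => M.step1 α (f t) (g t) (h t) := by
  have h1 := (measurable_act (1 - α • M.Abar)).comp hh
  have h2 := (M.measurable_act_Atilde_comp hf hg).const_smul α
  exact Measurable.sub h1 h2

theorem measurable_steps (α : ℝ) : Measurable fun y : Zs × Vec d × Vec d =>
    (M.step0 α y.1 y.2.1, M.step1 α y.1 y.2.1 y.2.2) :=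
  (M.measurable_step0_comp α measurable_fst (measurable_fst.comp measurable_snd)).prodMk
    (M.measurable_step1_comp α measurable_fst (measurable_fst.comp measurable_snd)
      (measurable_snd.comp measurable_snd))

theorem measurable_step0_swap (α : ℝ) :
    Measurable fun v : Vec d × Zs => M.step0 α v.2 v.1 :=
  M.measurable_step0_comp α measurable_snd measurable_fst

/-- The transition kernel of `Y`: from `(z, j₀, j₁)` move to
`(z', (I - α Abar) j₀ - α ε(z), (I - α Abar) j₁ - α (A(z) - Abar) j₀)` with `z' ∼ Q(z, ·)`. -/
def kernelY (α : ℝ) : Kernel (Zs × Vec d × Vec d) (Zs × Vec d × Vec d) :=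
  (M.Q.comap Prod.fst measurable_fst) ×ₖ
    Kernel.deterministic
      (fun y : Zs × Vec d × Vec d => (M.step0 α y.1 y.2.1, M.step1 α y.1 y.2.1 y.2.2))
      (M.measurable_steps α)

/-- The transition kernel of `V`: from `(j, z)` move to `((I - α Abar) j - α ε(z), z')` with
`z' ∼ Q(z, ·)`. -/
def kernelV (α : ℝ) : Kernel (Vec d × Zs) (Vec d × Zs) :=
  Kernel.deterministic (fun v : Vec d × Zs => M.step0 α v.2 v.1) (M.measurable_step0_swap α) ×ₖ
    (M.Q.comap Prod.snd measurable_snd)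

open Classical in
/-- The cost function on `Zs × ℝ^d × ℝ^d`. -/
def costY (α : ℝ) (y y' : Zs × Vec d × Vec d) : ℝ :=
  ‖y.2.1 - y'.2.1‖ + ‖y.2.2 - y'.2.2‖ +
    (‖y.2.1‖ + ‖y'.2.1‖ + ‖y.2.2‖ + ‖y'.2.2‖ + Real.sqrt (α * M.a) * M.noiseSup) *
      (if y.1 = y'.1 then 0 else 1)

open Classical in
/-- The cost function on `ℝ^d × Zs`. -/
def costV (α : ℝ) (v v' : Vec d × Zs) : ℝ :=
  ‖v.1 - v'.1‖ +
    (‖v.1‖ + ‖v'.1‖ + Real.sqrt (α * M.a) * M.noiseSup) * (if v.2 = v'.2 then 0 else 1)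

/-- The factor `tmix^{3/2} e^{-α a n / 12} √(log (1 / (α a)))` of the contraction bounds. -/
def rate (tmix : ℕ) (α : ℝ) (n : ℕ) : ℝ :=
  (tmix : ℝ) ^ (3 / 2 : ℝ) * Real.exp (-(α * M.a * n) / 12) *
    Real.sqrt (Real.log (1 / (α * M.a)))

end Model

end MarkovLSA

end

/-! The state carries the noise of the next step, so the update of (j₀, j₁) is a deterministic
function of the current state and only the new z is random. The Markov property of Y and V is
therefore inherited from Z, and V is the image of Y under a projection that intertwines the two
kernels. It remains to study Y.

The contraction comes from a coupling over blocks of length tmix. Let N be the Q-norm divided by the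
square root of the smallest eigenvalue of Q. It dominates the Euclidean norm, and I - α Abar
contracts it by ρ = e^{-αa/2} (`exists_contracted_seminorm`). Two copies at the same z can share all
their noise. Their differences then solve a triangular linear recursion, and w N(Δj₀) + N(Δj₁)
shrinks by γ = e^{-αa/12} per step once w absorbs the off-diagonal coefficient. Two copies at
different z are run for one block so that their final z's are maximally coupled. These differ with
probability at most 1/4, while the sizes of j₀, j₁ grow in a controlled way because α tmix (1 + C_A)
≤ 1. The cost charges four times a weighted size when z ≠ z'. One block brings this charge down to
half, and 1/2 ≤ γ^tmix, so one Markov coupling kernel contracts one cost by γ^tmix from every pair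
of states (`exists_coupling_pow_block`). Iterating this kernel needs no coupling time. Comparing the
cost with the one of the theorem gives the constant. The logarithm enters only through the lower
bound 1/2 for its square root, and the power of tmix only through 1 ≤ tmix^{3/2} and √tmix ≤
tmix^{3/2}.

For stationary laws, the contraction is tested on products of an indicator in z and a bounded
Lipschitz function of (j₀, j₁). By dominated convergence any two initial laws are forgotten, with no
moment condition, and this gives uniqueness. For existence, start at π ⊗ δ₀ ⊗ δ₀. The z-marginal
stays π and (j₀, j₁) stays in a compact set, so the laws are tight. A limit point is invariant
provided the kernel maps enough test functions to continuous ones. Since A, b and Q are only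
measurable, the Polish topology of Z is first refined, with the same Borel sets, to make countably
many functions continuous (`exists_polish_refinement`, `exists_invariant_of_tight`). -/

noncomputable section

namespace MarkovLSA

/-! ### Solvability of the Lyapunov equation, through the Cayley transform. -/

section Lyapunov

open Matrix
open scoped Matrix.Norms.L2Operator ComplexOrder

variable {d : ℕ}

/-- The Cayley transform of a matrix with spectrum in the right half plane has its spectrum in the
open unit disc. -/
theorem norm_lt_one_of_mem_spectrum_cayley {A R : Matrix (Fin d) (Fin d) ℂ}
    (hA : ∀ l ∈ spectrum ℂ A, 0 < l.re) (hR : (1 + A) * R = 1) {μ : ℂ}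
    (hμ : μ ∈ spectrum ℂ ((1 - A) * R)) : ‖μ‖ < 1 := by
  have hR' : R * (1 + A) = 1 := mul_eq_one_comm.mp hR
  have hRu : IsUnit R := ⟨⟨R, 1 + A, hR', hR⟩, rfl⟩
  have key : algebraMap ℂ _ μ - (1 - A) * R =
      (algebraMap ℂ _ (μ - 1) + algebraMap ℂ _ (μ + 1) * A) * R := by
    calc algebraMap ℂ _ μ - (1 - A) * R
        = algebraMap ℂ _ μ * ((1 + A) * R) - (1 - A) * R := by rw [hR, mul_one]
      _ = _ := by rw [map_sub, map_add, map_one]; noncomm_ring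
  have hnot : ¬ IsUnit (algebraMap ℂ (Matrix (Fin d) (Fin d) ℂ) (μ - 1)
      + algebraMap ℂ _ (μ + 1) * A) := by
    intro h
    exact hμ (spectrum.mem_resolventSet_iff.mpr (by rw [key]; exact h.mul hRu))
  -- The inverse Cayley map is undefined at μ = -1; there the first factor in `key` is the
  -- invertible scalar -2.
  by_cases h1 : μ + 1 = 0
  · exfalso
    apply hnot
    have : μ - 1 ≠ 0 := by
      intro h2
      have : (2 : ℂ) = 0 := by linear_combination h1 - h2
      norm_num at this
    rw [h1, map_zero, zero_mul, add_zero]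
    exact (IsUnit.mk0 _ this).map (algebraMap ℂ (Matrix (Fin d) (Fin d) ℂ))
  · have hmem : (1 - μ) / (1 + μ) ∈ spectrum ℂ A := by
      intro hu
      apply hnot
      have h1' : 1 + μ ≠ 0 := by rwa [add_comm]
      have hm : algebraMap ℂ (Matrix (Fin d) (Fin d) ℂ) (μ - 1) + algebraMap ℂ _ (μ + 1) * A
          = algebraMap ℂ _ (-(μ + 1)) * (algebraMap ℂ _ ((1 - μ) / (1 + μ)) - A) := by
        rw [mul_sub, ← map_mul]
        have : -(μ + 1) * ((1 - μ) / (1 + μ)) = μ - 1 := by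
          field_simp; ring
        rw [this, map_neg]; noncomm_ring
      rw [hm]
      exact ((IsUnit.mk0 _ (neg_ne_zero.mpr h1)).map
        (algebraMap ℂ (Matrix (Fin d) (Fin d) ℂ))).mul hu
    -- The real part of (1 - μ)/(1 + μ) has the sign of 1 - |μ|².
    have hre := hA _ hmem
    have hpos : 0 < Complex.normSq (1 + μ) := Complex.normSq_pos.mpr (by rwa [add_comm])
    rw [Complex.div_re, ← add_div, div_pos_iff_of_pos_right hpos] at hre
    simp only [Complex.sub_re, Complex.one_re, Complex.add_re, Complex.sub_im, Complex.one_im,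
      Complex.add_im] at hre
    have h2 : Complex.normSq μ < 1 := by
      rw [Complex.normSq_apply]; nlinarith
    rw [Complex.normSq_eq_norm_sq] at h2
    nlinarith [norm_nonneg μ]

/-- By Gelfand's formula the norms of the powers are eventually below a geometric sequence of ratio
c < 1. -/
theorem exists_norm_pow_le_of_spectrum [NeZero d] {B : Matrix (Fin d) (Fin d) ℂ}
    (hB : ∀ l ∈ spectrum ℂ B, ‖l‖ < 1) : Summable fun n : ℕ => ‖B ^ n‖ ^ 2 := by
  have hr : spectralRadius ℂ B < (1 : NNReal) :=
    spectrum.spectralRadius_lt_of_forall_lt B fun z hz => by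
      have := hB z hz
      exact_mod_cast this
  obtain ⟨c, hc1, hc2⟩ := ENNReal.lt_iff_exists_nnreal_btwn.mp hr
  have hlim := spectrum.pow_nnnorm_pow_one_div_tendsto_nhds_spectralRadius B
  have hev : ∀ᶠ n : ℕ in Filter.atTop, ‖B ^ n‖ ^ 2 ≤ ((c : ℝ) ^ 2) ^ n := by
    filter_upwards [hlim.eventually_lt_const hc1, Filter.eventually_gt_atTop 0] with n hn hn0
    have h1 : (‖B ^ n‖₊ : ℝ≥0∞) < (c : ℝ≥0∞) ^ (n : ℝ) := by
      have hn' : (0 : ℝ) < n := by exact_mod_cast hn0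
      calc (‖B ^ n‖₊ : ℝ≥0∞) = ((‖B ^ n‖₊ : ℝ≥0∞) ^ (1 / (n : ℝ))) ^ (n : ℝ) := by
            rw [← ENNReal.rpow_mul, one_div, inv_mul_cancel₀ hn'.ne', ENNReal.rpow_one]
        _ < _ := ENNReal.rpow_lt_rpow hn hn'
    rw [ENNReal.rpow_natCast] at h1
    have h2 : ‖B ^ n‖ < (c : ℝ) ^ n := by exact_mod_cast h1
    rw [← pow_mul, mul_comm, pow_mul]
    gcongr
  have hc : (c : ℝ) ^ 2 < 1 := by
    have : (c : ℝ) < 1 := by exact_mod_cast hc2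
    nlinarith [c.coe_nonneg]
  refine Summable.of_norm_bounded_eventually_nat (summable_geometric_of_lt_one (by positivity) hc) ?_
  filter_upwards [hev] with n hn
  rwa [Real.norm_of_nonneg (by positivity)]

/-- With R = (1 + A)⁻¹ and B = (1 - A)R, the series P = ∑ (Bᵏ)ᴴ RᴴR Bᵏ solves the discrete equation
P = RᴴR + BᴴPB. Multiplying by 1 + A on the right and by its adjoint on the left turns this into the
continuous equation for 2P. This replaces the usual integral of matrix exponentials by a convergent
sum. -/
theorem exists_lyapunov_complex [NeZero d] {A : Matrix (Fin d) (Fin d) ℂ}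
    (hA : ∀ l ∈ spectrum ℂ A, 0 < l.re) :
    ∃ P : Matrix (Fin d) (Fin d) ℂ, P.PosDef ∧ Aᴴ * P + P * A = 1 := by
  have hu : IsUnit (1 + A) := by
    by_contra h
    have : (-1 : ℂ) ∈ spectrum ℂ A := by
      intro h2
      apply h
      have := h2.neg
      simpa [neg_sub, sub_neg_eq_add, add_comm] using this
    have := hA _ this
    norm_num at this
  obtain ⟨R, hR⟩ := hu.exists_right_inv
  have hR' : R * (1 + A) = 1 := mul_eq_one_comm.mp hR
  set B := (1 - A) * R with hBdef
  have hs := exists_norm_pow_le_of_spectrum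
    (fun μ hμ => norm_lt_one_of_mem_spectrum_cayley hA hR hμ : ∀ l ∈ spectrum ℂ B, ‖l‖ < 1)
  set N : Matrix (Fin d) (Fin d) ℂ := Rᴴ * R with hN
  set T : ℕ → Matrix (Fin d) (Fin d) ℂ := fun k => (B ^ k)ᴴ * N * B ^ k with hT
  have hTs : Summable T := by
    refine Summable.of_norm_bounded (hs.mul_left ‖N‖) fun k => ?_
    calc ‖T k‖ ≤ ‖(B ^ k)ᴴ * N‖ * ‖B ^ k‖ := norm_mul_le _ _
      _ ≤ ‖(B ^ k)ᴴ‖ * ‖N‖ * ‖B ^ k‖ := by gcongr; exact norm_mul_le _ _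
      _ = ‖N‖ * ‖B ^ k‖ ^ 2 := by rw [Matrix.l2_opNorm_conjTranspose]; ring
  set P := ∑' k, T k with hP
  have hNpd : N.PosDef := by
    refine Matrix.PosDef.conjTranspose_mul_self R ?_
    have : IsUnit R := ⟨⟨R, 1 + A, hR', hR⟩, rfl⟩
    exact Matrix.mulVec_injective_of_isUnit this
  have hstep : ∀ k, T (k + 1) = Bᴴ * T k * B := fun k => by
    simp only [hT, pow_succ, conjTranspose_mul, mul_assoc]
  have hP1 : P = N + Bᴴ * P * B := by
    have h0 : T 0 = N := by simp [hT]
    conv_lhs => rw [hP, hTs.tsum_eq_zero_add]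
    simp_rw [hstep]
    rw [(hTs.mul_left Bᴴ).tsum_mul_right, hTs.tsum_mul_left, h0]
  have hPh : P.IsHermitian := by
    have hTh : ∀ k, (T k)ᴴ = T k := fun k => by
      simp only [hT, hN, conjTranspose_mul, conjTranspose_conjTranspose, mul_assoc]
    rw [Matrix.IsHermitian, hP, conjTranspose_tsum]
    simp_rw [hTh]
  have hPs : P.PosSemidef := by
    refine Matrix.PosSemidef.of_dotProduct_mulVec_nonneg hPh fun x => ?_
    let φ : Matrix (Fin d) (Fin d) ℂ →L[ℂ] ℂ :=
      LinearMap.toContinuousLinearMap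
        { toFun := fun S => star x ⬝ᵥ S *ᵥ x
          map_add' := fun S S' => by simp [add_mulVec]
          map_smul' := fun c S => by simp [smul_mulVec] }
    have h1 : HasSum (fun k => φ (T k)) (φ P) := hTs.hasSum.mapL φ
    refine h1.nonneg fun k => ?_
    exact (hNpd.posSemidef.conjTranspose_mul_mul_same (B ^ k)).dotProduct_mulVec_nonneg x
  have hPpd : P.PosDef := by
    rw [hP1]
    exact hNpd.add_posSemidef (hPs.conjTranspose_mul_mul_same B)
  have hBA : B * (1 + A) = 1 - A := by rw [hBdef, mul_assoc, hR', mul_one]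
  have hid : (1 + A)ᴴ * P * (1 + A) = 1 + (1 - A)ᴴ * P * (1 - A) := by
    conv_lhs => rw [hP1]
    rw [mul_add (1 + A)ᴴ N _, add_mul _ _ (1 + A)]
    congr 1
    · rw [hN, ← mul_assoc, ← conjTranspose_mul, hR', conjTranspose_one, one_mul, hR']
    · clear_value B
      rw [← hBA, conjTranspose_mul]; simp only [mul_assoc]
  have h2 : (2 : ℂ) • (Aᴴ * P + P * A) = 1 := by
    have e : (2 : ℂ) • (Aᴴ * P + P * A)
        = (1 + A)ᴴ * P * (1 + A) - (1 - A)ᴴ * P * (1 - A) := by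
      rw [conjTranspose_add, conjTranspose_sub, conjTranspose_one, two_smul]; noncomm_ring
    rw [e, hid]; simp
  refine ⟨(2 : ℂ) • P, hPpd.smul (by norm_num), ?_⟩
  rw [← h2]; simp [smul_add]

/-- Since A is real, the entrywise real part of a complex solution is again a solution; its
positivity is read off on real vectors. -/
theorem exists_lyapunov [NeZero d] {A : Mat d} (hA : IsHurwitz (-A)) :
    ∃ P : Mat d, P.PosDef ∧ A.transpose * P + P * A = 1 := by
  obtain ⟨P, hP, hPe⟩ := exists_lyapunov_complex (A := A.map (algebraMap ℝ ℂ)) fun l hl => by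
    have h1 : -l ∈ spectrum ℂ ((-A).map (algebraMap ℝ ℂ)) := by
      have e : (-A).map (algebraMap ℝ ℂ) = -(A.map (algebraMap ℝ ℂ)) := by
        ext i j; simp
      rw [e, ← spectrum.neg_eq]
      simpa using hl
    have := hA _ h1
    simpa using this
  have hre : ∀ i j, (P j i).re = (P i j).re := fun i j => by
    have := congrArg Complex.re (hP.isHermitian.apply i j)
    simpa using this
  refine ⟨P.map Complex.re, ?_, ?_⟩
  · refine Matrix.PosDef.of_dotProduct_mulVec_pos ?_ fun x hx => ?_
    · ext i j; simp [hre]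
    · have hx' : (fun i => (x i : ℂ)) ≠ 0 := fun h => hx (by
        ext i; simpa using congrFun h i)
      have h := hP.dotProduct_mulVec_pos hx'
      have h2 := (Complex.lt_def.mp h).1
      simpa [dotProduct, mulVec, Complex.re_sum] using h2
  · ext i j
    have := congrArg Complex.re (congrFun (congrFun hPe i) j)
    simp only [Matrix.add_apply, Matrix.mul_apply, Complex.add_re, Complex.re_sum] at this
    simp only [Matrix.add_apply, Matrix.mul_apply, Matrix.map_apply, Matrix.transpose_apply]
    simp [Matrix.one_apply, Matrix.conjTranspose_apply] at this ⊢
    convert this using 1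
    split_ifs <;> simp

end Lyapunov

/-! ### The Q-norm, its comparison with the Euclidean norm, and its contraction. -/

section Seminorm

open Matrix
open scoped MatrixOrder

variable {d : ℕ}

theorem inner_act (Q : Mat d) (x : Vec d) : inner ℝ x (act Q x) = x.ofLp ⬝ᵥ Q *ᵥ x.ofLp := by
  rw [act, EuclideanSpace.inner_eq_star_dotProduct, ofLp_toEuclideanCLM, dotProduct_comm]
  simp

theorem act_mul (A B : Mat d) (x : Vec d) : act (A * B) x = act A (act B x) := by
  simp [act, map_mul]

theorem act_one (x : Vec d) : act (1 : Mat d) x = x := by simp [act]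

theorem norm_act_le (A : Mat d) (x : Vec d) : ‖act A x‖ ≤ specNorm A * ‖x‖ :=
  ContinuousLinearMap.le_opNorm _ x

theorem inner_act_transpose_mul (Q A : Mat d) (x : Vec d) :
    inner ℝ x (act (A.transpose * Q) x) = inner ℝ (act A x) (act Q x) := by
  rw [act, act, act, EuclideanSpace.inner_eq_star_dotProduct,
    EuclideanSpace.inner_eq_star_dotProduct, ofLp_toEuclideanCLM, ofLp_toEuclideanCLM,
    ofLp_toEuclideanCLM, ← mulVec_mulVec]
  simp only [star_trivial]
  rw [dotProduct_comm, dotProduct_mulVec, vecMul_transpose, dotProduct_comm]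

theorem spectrum_finite (Q : Mat d) (hQ : Q.IsHermitian) : (spectrum ℝ Q).Finite := by
  rw [hQ.spectrum_real_eq_range_eigenvalues]; exact Set.finite_range _

theorem spectrum_nonempty [NeZero d] (Q : Mat d) (hQ : Q.IsHermitian) :
    (spectrum ℝ Q).Nonempty := by
  rw [hQ.spectrum_real_eq_range_eigenvalues]; exact Set.range_nonempty _

theorem sInf_spectrum_pos [NeZero d] {Q : Mat d} (hQ : Q.PosDef) : 0 < sInf (spectrum ℝ Q) := by
  have h1 := (spectrum_nonempty Q hQ.isHermitian).csInf_mem (spectrum_finite Q hQ.isHermitian)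
  rw [hQ.isHermitian.spectrum_real_eq_range_eigenvalues] at h1 ⊢
  obtain ⟨i, hi⟩ := h1
  rw [← hi]
  exact hQ.eigenvalues_pos i

/-- The matrix Q - λ_min has nonnegative spectrum, hence is positive semidefinite. -/
theorem sInf_spectrum_mul_le {Q : Mat d} (hQ : Q.IsHermitian) (x : Vec d) :
    sInf (spectrum ℝ Q) * ‖x‖ ^ 2 ≤ inner ℝ x (act Q x) := by
  set l := sInf (spectrum ℝ Q)
  have h : (Q - algebraMap ℝ (Mat d) l).PosSemidef := by
    rw [posSemidef_iff_isHermitian_and_spectrum_nonneg]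
    refine ⟨hQ.sub ?_, ?_⟩
    · rw [Algebra.algebraMap_eq_smul_one]
      simp [Matrix.IsHermitian]
    · rw [← spectrum.sub_singleton_eq]
      rintro _ ⟨y, hy, _, rfl, rfl⟩
      have := csInf_le (spectrum_finite Q hQ).bddBelow hy
      simpa using this
  have h2 := h.dotProduct_mulVec_nonneg x.ofLp
  rw [inner_act, EuclideanSpace.real_norm_sq_eq]
  rw [sub_mulVec, dotProduct_sub, Algebra.algebraMap_eq_smul_one, smul_mulVec, one_mulVec,
    dotProduct_smul] at h2
  simp only [star_trivial, smul_eq_mul, sub_nonneg] at h2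
  refine le_trans (le_of_eq ?_) h2
  simp [dotProduct, sq]

theorem le_sSup_spectrum_mul {Q : Mat d} (hQ : Q.IsHermitian) (x : Vec d) :
    inner ℝ x (act Q x) ≤ sSup (spectrum ℝ Q) * ‖x‖ ^ 2 := by
  set l := sSup (spectrum ℝ Q)
  have h : (algebraMap ℝ (Mat d) l - Q).PosSemidef := by
    rw [posSemidef_iff_isHermitian_and_spectrum_nonneg]
    refine ⟨Matrix.IsHermitian.sub ?_ hQ, ?_⟩
    · rw [Algebra.algebraMap_eq_smul_one]
      simp [Matrix.IsHermitian]
    · rw [← spectrum.singleton_sub_eq]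
      rintro _ ⟨_, rfl, y, hy, rfl⟩
      have := le_csSup (spectrum_finite Q hQ).bddAbove hy
      simpa using this
  have h2 := h.dotProduct_mulVec_nonneg x.ofLp
  rw [inner_act, EuclideanSpace.real_norm_sq_eq]
  rw [sub_mulVec, dotProduct_sub, Algebra.algebraMap_eq_smul_one, smul_mulVec, one_mulVec,
    dotProduct_smul] at h2
  simp only [star_trivial, smul_eq_mul, sub_nonneg] at h2
  refine h2.trans (le_of_eq ?_)
  simp [dotProduct, sq]

/-- Factor Q = SᵀS: the Q-norm is a Euclidean norm after applying S, which makes it a seminorm at no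
cost. -/
theorem exists_norm_act_sq {Q : Mat d} (hQ : Q.PosSemidef) :
    ∃ S : Mat d, ∀ x, ‖act S x‖ ^ 2 = inner ℝ x (act Q x) := by
  obtain ⟨S, hS⟩ := CStarAlgebra.nonneg_iff_eq_star_mul_self.mp (nonneg_iff_posSemidef.mpr hQ)
  refine ⟨S, fun x => ?_⟩
  rw [hS, star_eq_conjTranspose, conjTranspose_eq_transpose_of_trivial, inner_act_transpose_mul,
    real_inner_self_eq_norm_sq]

theorem lyapunov_spec [NeZero d] {A : Mat d} (hA : IsHurwitz (-A)) :
    (lyapunov A).PosDef ∧ A.transpose * lyapunov A + lyapunov A * A = 1 :=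
  Classical.epsilon_spec (exists_lyapunov hA)

theorem specNorm_pos [NeZero d] {Q : Mat d} (hQ : Q.PosDef) : 0 < specNorm Q := by
  rw [specNorm, norm_pos_iff]
  intro h
  have h0 : Q = 0 := (map_eq_zero_iff _ (toEuclideanCLM (n := Fin d) (𝕜 := ℝ)).injective).mp h
  have := hQ.diag_pos (i := 0)
  simp [h0] at this

theorem one_le_condNumber [NeZero d] {Q : Mat d} (hQ : Q.PosDef) : 1 ≤ condNumber Q := by
  rw [condNumber, one_le_div (sInf_spectrum_pos hQ)]
  obtain ⟨y, hy⟩ := spectrum_nonempty Q hQ.isHermitian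
  have h := spectrum_finite Q hQ.isHermitian
  exact (csInf_le h.bddBelow hy).trans (le_csSup h.bddAbove hy)

theorem qNorm_act_le [NeZero d] {Q : Mat d} (hQ : Q.PosDef) (A : Mat d) (x : Vec d) :
    qNorm Q (act A x) ≤ qOpNorm Q A * qNorm Q x := by
  obtain ⟨S, hS⟩ := exists_norm_act_sq hQ.posSemidef
  have hq : ∀ x, qNorm Q x = ‖act S x‖ := fun x => by
    rw [qNorm, ← hS, Real.sqrt_sq (norm_nonneg _)]
  have hl := sInf_spectrum_pos hQ
  set l := sInf (spectrum ℝ Q)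
  have hlow : ∀ x, Real.sqrt l * ‖x‖ ≤ ‖act S x‖ := fun x => by
    apply le_of_sq_le_sq _ (norm_nonneg _)
    rw [mul_pow, Real.sq_sqrt hl.le, hS]
    exact sInf_spectrum_mul_le hQ.isHermitian x
  have hsl : 0 < Real.sqrt l := Real.sqrt_pos.mpr hl
  -- Boundedness matters: the supremum defining `qOpNorm` would be the default value 0 on an
  -- unbounded set.
  have hb : BddAbove {r | ∃ x : Vec d, qNorm Q x = 1 ∧ r = qNorm Q (act A x)} := by
    refine ⟨specNorm S * (specNorm A * (1 / Real.sqrt l)), ?_⟩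
    rintro r ⟨x, hx, rfl⟩
    rw [hq] at hx ⊢
    have h1 : ‖x‖ ≤ 1 / Real.sqrt l := by
      rw [le_div_iff₀ hsl, mul_comm, ← hx]; exact hlow x
    refine (norm_act_le S _).trans ?_
    have := norm_act_le A x
    have hA0 : 0 ≤ specNorm A := norm_nonneg _
    have hS0 : 0 ≤ specNorm S := norm_nonneg _
    gcongr
    exact this.trans (by gcongr)
  by_cases hx : x = 0
  · subst hx
    simp [qNorm, act]
  have hpos : 0 < ‖act S x‖ := lt_of_lt_of_le (mul_pos hsl (norm_pos_iff.mpr hx)) (hlow x)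
  have h1 := le_csSup hb ⟨(‖act S x‖)⁻¹ • x, by
    rw [hq]; simp [act, map_smul, norm_smul]
    exact inv_mul_cancel₀ hpos.ne', rfl⟩
  rw [hq] at h1 ⊢
  rw [hq]
  have e : ‖act S (act A ((‖act S x‖)⁻¹ • x))‖ = ‖act S (act A x)‖ / ‖act S x‖ := by
    simp [act, map_smul, norm_smul, div_eq_inv_mul]
  rw [e, div_le_iff₀ hpos] at h1
  exact h1

/-- Expanding the square, the Lyapunov equation makes the first-order term -α‖x‖², which is at most
-α‖Q‖⁻¹‖x‖_Q². The bound on α lets the second-order term cancel at most half of it, which leaves the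
rate a = ‖Q‖⁻¹/2. -/
theorem inner_act_one_sub_smul_le [NeZero d] {A : Mat d} (hA : IsHurwitz (-A)) {α : ℝ}
    (h0 : 0 < α)
    (hα : α ≤ (1 / 2) * (qOpNorm (lyapunov A) A ^ 2)⁻¹ * (specNorm (lyapunov A))⁻¹) (x : Vec d) :
    inner ℝ (act (1 - α • A) x) (act (lyapunov A) (act (1 - α • A) x)) ≤
      (1 - α * ((specNorm (lyapunov A))⁻¹ / 2)) * inner ℝ x (act (lyapunov A) x) := by
  obtain ⟨hQ, hE⟩ := lyapunov_spec hA
  set Q := lyapunov A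
  have hn := specNorm_pos hQ
  set n := specNorm Q
  have hy : act (1 - α • A) x = x - α • act A x := by
    simp [act, map_sub, map_smul]
  have hmid : inner ℝ x (act Q (act A x)) + inner ℝ (act A x) (act Q x) = ‖x‖ ^ 2 := by
    rw [← inner_act_transpose_mul, ← act_mul, ← inner_add_right, add_comm, act, act,
      ← _root_.add_apply, ← map_add, hE, ← act, act_one, real_inner_self_eq_norm_sq]
  have hexp : inner ℝ (act (1 - α • A) x) (act Q (act (1 - α • A) x)) =
      inner ℝ x (act Q x) - α * ‖x‖ ^ 2 + α ^ 2 * inner ℝ (act A x) (act Q (act A x)) := by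
    have e : act Q (x - α • act A x) = act Q x - α • act Q (act A x) := by
      simp [act, map_sub, map_smul]
    rw [hy, e, inner_sub_left, inner_sub_right, inner_sub_right, real_inner_smul_left,
      real_inner_smul_right, real_inner_smul_left, real_inner_smul_right, ← hmid]
    ring
  have hx0 : 0 ≤ inner ℝ x (act Q x) :=
    le_trans (mul_nonneg (sInf_spectrum_pos hQ).le (sq_nonneg _))
      (sInf_spectrum_mul_le hQ.isHermitian x)
  have hA0 : 0 ≤ inner ℝ (act A x) (act Q (act A x)) :=
    le_trans (mul_nonneg (sInf_spectrum_pos hQ).le (sq_nonneg _))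
      (sInf_spectrum_mul_le hQ.isHermitian _)
  have h1 : inner ℝ x (act Q x) ≤ n * ‖x‖ ^ 2 := by
    calc inner ℝ x (act Q x) ≤ ‖x‖ * ‖act Q x‖ := real_inner_le_norm _ _
      _ ≤ ‖x‖ * (n * ‖x‖) := by gcongr; exact norm_act_le Q x
      _ = _ := by ring
  have h2 : inner ℝ (act A x) (act Q (act A x)) ≤ qOpNorm Q A ^ 2 * inner ℝ x (act Q x) := by
    have := qNorm_act_le hQ A x
    have h3 := pow_le_pow_left₀ (Real.sqrt_nonneg _) this 2
    rwa [mul_pow, Real.sq_sqrt hA0, qNorm, Real.sq_sqrt hx0] at h3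
  -- If the operator norm vanished, its inverse would be 0 by convention and the bound on α would
  -- contradict α > 0.
  have hp : 0 < qOpNorm Q A ^ 2 := by
    rcases (sq_nonneg (qOpNorm Q A)).eq_or_lt with h | h
    · rw [← h] at hα; simp at hα; linarith
    · exact h
  set p := qOpNorm Q A ^ 2
  have h3 : α * p ≤ n⁻¹ / 2 := by
    calc α * p ≤ (1 / 2 * p⁻¹ * n⁻¹) * p := by gcongr
      _ = n⁻¹ / 2 := by field_simp
  have h4 : n⁻¹ * inner ℝ x (act Q x) ≤ ‖x‖ ^ 2 := by
    rw [inv_mul_le_iff₀ hn]; exact h1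
  rw [hexp]
  have h5 : α ^ 2 * inner ℝ (act A x) (act Q (act A x)) ≤ α * (n⁻¹ / 2) * inner ℝ x (act Q x) := by
    calc _ ≤ α ^ 2 * (p * inner ℝ x (act Q x)) := by gcongr
      _ = α * (α * p) * inner ℝ x (act Q x) := by ring
      _ ≤ _ := by gcongr
  nlinarith [mul_le_mul_of_nonneg_left h4 h0.le]

end Seminorm

namespace Model

variable {d : ℕ} {Zs : Type*} [MeasurableSpace Zs] (M : Model d Zs)

theorem a_pos [NeZero d] (hA : M.AssumptionA) : 0 < M.a := by
  have := specNorm_pos (lyapunov_spec hA.2.2).1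
  rw [a, lyap]; positivity

theorem one_le_kappa [NeZero d] (hA : M.AssumptionA) : 1 ≤ M.kappa :=
  one_le_condNumber (lyapunov_spec hA.2.2).1

/-- A multiple of `‖·‖_Q` that dominates the Euclidean norm and is contracted by `I - α Abar`. -/
theorem exists_contracted_seminorm [NeZero d] (hA : M.AssumptionA) {α : ℝ} (h0 : 0 < α)
    (hα : α ≤ M.alphaInf) :
    ∃ N : Seminorm ℝ (Vec d), (∀ x, ‖x‖ ≤ N x) ∧ (∀ x, N x ≤ Real.sqrt M.kappa * ‖x‖) ∧
      ∀ x, N (act (1 - α • M.Abar) x) ≤ Real.exp (-(α * M.a) / 2) * N x := by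
  have hQ := (lyapunov_spec hA.2.2).1
  have hl := sInf_spectrum_pos hQ
  obtain ⟨S, hS⟩ := exists_norm_act_sq hQ.posSemidef
  have hsl := Real.sqrt_pos.mpr hl
  set l := sInf (spectrum ℝ (lyapunov M.Abar)) with hldef
  let r : NNReal := ⟨(Real.sqrt l)⁻¹, by positivity⟩
  let N : Seminorm ℝ (Vec d) := r •
    (normSeminorm ℝ (Vec d)).comp (Matrix.toEuclideanCLM (𝕜 := ℝ) S).toLinearMap
  have hN : ∀ x, N x = (Real.sqrt l)⁻¹ * ‖act S x‖ := fun x => rfl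
  refine ⟨N, fun x => ?_, fun x => ?_, fun x => ?_⟩
  · rw [hN, ← div_eq_inv_mul, le_div_iff₀ hsl]
    apply le_of_sq_le_sq _ (norm_nonneg _)
    rw [mul_pow, Real.sq_sqrt hl.le, hS, mul_comm]
    exact sInf_spectrum_mul_le hQ.isHermitian x
  · rw [hN, ← div_eq_inv_mul, div_le_iff₀ hsl]
    have hk : 0 ≤ M.kappa := zero_le_one.trans (M.one_le_kappa hA)
    apply le_of_sq_le_sq _ (by positivity)
    rw [mul_pow, mul_pow, Real.sq_sqrt hl.le, Real.sq_sqrt hk, hS]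
    have e : M.kappa * l = sSup (spectrum ℝ (lyapunov M.Abar)) := by
      rw [kappa, condNumber, lyap, div_mul_cancel₀ _ hl.ne']
    calc _ ≤ _ := le_sSup_spectrum_mul hQ.isHermitian x
      _ = M.kappa * ‖x‖ ^ 2 * l := by rw [← e]; ring
  · rw [hN, hN, mul_left_comm]
    gcongr
    apply le_of_sq_le_sq _ (by positivity)
    rw [mul_pow, hS, hS, ← Real.exp_nat_mul]
    refine (inner_act_one_sub_smul_le hA.2.2 h0 (hα.trans (min_le_left _ _)) x).trans ?_
    have hx0 : 0 ≤ inner ℝ x (act (lyapunov M.Abar) x) := by rw [← hS]; positivity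
    have h := Real.add_one_le_exp (-(α * M.a))
    have e : ((2 : ℕ) : ℝ) * (-(α * M.a) / 2) = -(α * M.a) := by push_cast; ring
    rw [e]
    gcongr
    have : M.a = (specNorm (lyapunov M.Abar))⁻¹ / 2 := rfl
    rw [← this]; linarith

end Model

/-! ### Iterates of kernels and the total variation bound. -/

section Kernels

variable {X Y : Type*} [MeasurableSpace X] [MeasurableSpace Y]

attribute [local instance] isMarkovKernel_pow

theorem map_pow_apply_of_semiconj {K : Kernel X X} {L : Kernel Y Y} {φ : X → Y}
    (hφ : Measurable φ) (h : ∀ x, (K x).map φ = L (φ x)) (n : ℕ) (x : X) :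
    ((K ^ n) x).map φ = (L ^ n) (φ x) := by
  induction n generalizing x with
  | zero =>
    change (Kernel.id x).map φ = Kernel.id (φ x)
    rw [Kernel.id_apply, Kernel.id_apply, Measure.map_dirac' hφ]
  | succ n ih =>
    ext s hs
    rw [Measure.map_apply hφ hs, Kernel.pow_succ_apply_eq_lintegral K n x (hφ hs),
      Kernel.pow_succ_apply_eq_lintegral L n (φ x) hs, ← ih,
      lintegral_map (Kernel.measurable_coe _ hs) hφ]
    refine lintegral_congr fun y => ?_
    rw [← h, Measure.map_apply hφ hs]

theorem ae_pow_of_ae_step {K : Kernel X X} {P : ℕ → X → Prop}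
    (hP : ∀ n, MeasurableSet {x | P n x})
    (h : ∀ n x, P n x → ∀ᵐ y ∂K x, P (n + 1) y) (n : ℕ) {x : X} (hx : P 0 x) :
    ∀ᵐ y ∂(K ^ n) x, P n y := by
  induction n with
  | zero =>
    change ∀ᵐ y ∂Kernel.id x, P 0 y
    rw [Kernel.id_apply, ae_dirac_iff (hP 0)]
    exact hx
  | succ n ih =>
    rw [pow_succ']
    exact Kernel.ae_comp_of_ae_ae (hP _) (ih.mono fun y hy => h n y hy)

theorem lintegral_pow_le {K : Kernel X X} {c : X → ℝ≥0∞} (hc : Measurable c) {γ : ℝ≥0∞}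
    (h : ∀ x, ∫⁻ y, c y ∂K x ≤ γ * c x) (n : ℕ) (x : X) :
    ∫⁻ y, c y ∂(K ^ n) x ≤ γ ^ n * c x := by
  induction n generalizing x with
  | zero =>
    change ∫⁻ y, c y ∂Kernel.id x ≤ _
    rw [Kernel.id_apply, lintegral_dirac' _ hc, pow_zero, one_mul]
  | succ n ih =>
    rw [pow_succ]
    change ∫⁻ y, c y ∂((K ^ n) ∘ₖ K) x ≤ _
    rw [Kernel.lintegral_comp _ _ _ hc]
    calc ∫⁻ y, ∫⁻ z, c z ∂(K ^ n) y ∂K x ≤ ∫⁻ y, γ ^ n * c y ∂K x := lintegral_mono fun y => ih y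
      _ = γ ^ n * ∫⁻ y, c y ∂K x := lintegral_const_mul _ hc
      _ ≤ γ ^ n * (γ * c x) := by gcongr; exact h x
      _ = _ := by rw [pow_succ, mul_assoc]

/-- The difference s of two probability measures satisfies |s(B)| = |s(Bᶜ)|, and the variations on B
and Bᶜ add up to the total; hence the factor 1/2. -/
theorem measure_le_add_half_tvNorm (μ ν : Measure X) [IsProbabilityMeasure μ]
    [IsProbabilityMeasure ν] {B : Set X} (hB : MeasurableSet B) :
    μ B ≤ ν B + (1 / 2 : ℝ≥0∞) * tvNorm μ ν := by
  set s := μ.toSignedMeasure - ν.toSignedMeasure with hs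
  have hval : ∀ C, MeasurableSet C → s C = μ.real C - ν.real C := fun C hC => by
    rw [hs, _root_.sub_apply, Measure.toSignedMeasure_apply_measurable hC,
      Measure.toSignedMeasure_apply_measurable hC]
  have h1 := s.norm_le_totalVariation B
  have h2 := s.norm_le_totalVariation Bᶜ
  rw [hval _ hB, Real.norm_eq_abs] at h1
  rw [hval _ hB.compl, probReal_compl_eq_one_sub hB, probReal_compl_eq_one_sub hB,
    Real.norm_eq_abs] at h2
  have h3 : s.totalVariation.real B + s.totalVariation.real Bᶜ = s.totalVariation.real Set.univ :=
    measureReal_add_measureReal_compl hB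
  have h4 : μ.real B ≤ ν.real B + 1 / 2 * s.totalVariation.real Set.univ := by
    have := le_abs_self (μ.real B - ν.real B)
    have := neg_abs_le (1 - μ.real B - (1 - ν.real B))
    linarith
  have h5 : (1 / 2 : ℝ≥0∞) * tvNorm μ ν = ENNReal.ofReal (1 / 2 * s.totalVariation.real Set.univ) := by
    rw [ENNReal.ofReal_mul (by norm_num), ofReal_measureReal, tvNorm, ENNReal.ofReal_div_of_pos
      (by norm_num)]
    simp [hs]
  rw [h5, ← ofReal_measureReal (μ := μ), ← ofReal_measureReal (μ := ν),
    ← ENNReal.ofReal_add measureReal_nonneg (by positivity)]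
  exact ENNReal.ofReal_le_ofReal h4

end Kernels

/-! ### Measurable maximal couplings of kernels. -/

section MaximalCoupling

variable {X Z W : Type*} [MeasurableSpace X] [MeasurableSpace Z] [MeasurableSpace W]

/-- The maximal coupling of two Markov kernels, measurable in the starting point. -/
theorem exists_maximal_coupling [MeasurableSpace.CountablyGenerated Z] [MeasurableEq Z]
    (κ κ' : Kernel X Z) [IsMarkovKernel κ] [IsMarkovKernel κ'] :
    ∃ Γ : Kernel X (Z × Z), IsMarkovKernel Γ ∧ (∀ x, (Γ x).map Prod.fst = κ x) ∧
      (∀ x, (Γ x).map Prod.snd = κ' x) ∧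
      ∀ x (δ : ℝ≥0∞), (∀ B, MeasurableSet B → κ x B ≤ κ' x B + δ) → Γ x {p | p.1 ≠ p.2} ≤ δ := by
  set μ := κ + κ' with hμ
  set f := κ.rnDeriv μ with hf
  set g := κ'.rnDeriv μ with hg
  have hfm : Measurable (Function.uncurry f) := Kernel.measurable_rnDeriv _ _
  have hgm : Measurable (Function.uncurry g) := Kernel.measurable_rnDeriv _ _
  have hac : ∀ x, κ x ≪ μ x := fun x => by
    rw [hμ, _root_.add_apply]; exact Measure.absolutelyContinuous_of_le (Measure.le_add_right le_rfl)
  have hac' : ∀ x, κ' x ≪ μ x := fun x => by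
    rw [hμ, _root_.add_apply]; exact Measure.absolutelyContinuous_of_le (Measure.le_add_left le_rfl)
  have hκ : ∀ x, κ x = (μ x).withDensity (f x) := fun x => by
    rw [← Kernel.withDensity_rnDeriv_eq (hac x), Kernel.withDensity_apply _ hfm]
  have hκ' : ∀ x, κ' x = (μ x).withDensity (g x) := fun x => by
    rw [← Kernel.withDensity_rnDeriv_eq (hac' x), Kernel.withDensity_apply _ hgm]
  -- The common part, with density min(f, g), will sit on the diagonal. The two residuals have equal
  -- mass and are coupled by their normalized product.
  set h : X → Z → ℝ≥0∞ := fun x z => min (f x z) (g x z) with hh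
  have hhm : Measurable (Function.uncurry h) := hfm.min hgm
  set r : X → Z → ℝ≥0∞ := fun x z => f x z - h x z with hr
  set r' : X → Z → ℝ≥0∞ := fun x z => g x z - h x z with hr'
  have hrm : Measurable (Function.uncurry r) := hfm.sub hhm
  have hrm' : Measurable (Function.uncurry r') := hgm.sub hhm
  set m := μ.withDensity h with hm
  set R := μ.withDensity r with hR
  set R' := μ.withDensity r' with hR'
  have hma : ∀ x, m x = (μ x).withDensity (h x) := fun x => Kernel.withDensity_apply _ hhm x
  have hRa : ∀ x, R x = (μ x).withDensity (r x) := fun x => Kernel.withDensity_apply _ hrm x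
  have hRa' : ∀ x, R' x = (μ x).withDensity (r' x) := fun x => Kernel.withDensity_apply _ hrm' x
  have hsum : ∀ x, m x + R x = κ x := fun x => by
    rw [hma, hRa, hκ, ← withDensity_add_right _ (Measurable.of_uncurry_left hrm)]
    congr 1; funext z
    exact add_tsub_cancel_of_le (min_le_left _ _)
  have hsum' : ∀ x, m x + R' x = κ' x := fun x => by
    rw [hma, hRa', hκ', ← withDensity_add_right _ (Measurable.of_uncurry_left hrm')]
    congr 1; funext z
    exact add_tsub_cancel_of_le (min_le_right _ _)
  have hRle : ∀ x, R x Set.univ ≤ 1 := fun x => by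
    have := congrArg (fun ν : Measure Z => ν Set.univ) (hsum x)
    simp only [Measure.add_apply, measure_univ] at this
    rw [← this]; exact le_add_self
  have hmle : ∀ x, m x Set.univ ≤ 1 := fun x => by
    have := congrArg (fun ν : Measure Z => ν Set.univ) (hsum x)
    simp only [Measure.add_apply, measure_univ] at this
    rw [← this]; exact le_self_add
  have hRR : ∀ x, R' x Set.univ = R x Set.univ := fun x => by
    have h1 := congrArg (fun ν : Measure Z => ν Set.univ) (hsum x)
    have h2 := congrArg (fun ν : Measure Z => ν Set.univ) (hsum' x)
    simp only [Measure.add_apply, measure_univ] at h1 h2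
    have hne : m x Set.univ ≠ ∞ := ne_top_of_le_ne_top ENNReal.one_ne_top (hmle x)
    exact (ENNReal.add_right_inj hne).mp (h2.trans h1.symm)
  have hfinR : IsFiniteKernel R := ⟨1, ENNReal.one_lt_top, hRle⟩
  have hfinR' : IsFiniteKernel R' := ⟨1, ENNReal.one_lt_top, fun x => (hRR x).trans_le (hRle x)⟩
  set c : X → Z × Z → ℝ≥0∞ := fun x _ => (R x Set.univ)⁻¹ with hc
  have hcm : Measurable (Function.uncurry c) :=
    ((Kernel.measurable_coe R MeasurableSet.univ).inv).comp measurable_fst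
  set D : Z → Z × Z := fun z => (z, z) with hD
  have hDm : Measurable D := measurable_id.prodMk measurable_id
  set Γ : Kernel X (Z × Z) := m.map D + (R ×ₖ R').withDensity c with hΓ
  have hΓa : ∀ x, Γ x = (m x).map D + (R x Set.univ)⁻¹ • (R x).prod (R' x) := fun x => by
    rw [hΓ, _root_.add_apply, Kernel.map_apply _ hDm, Kernel.withDensity_apply _ hcm,
      Kernel.prod_apply, withDensity_const]
  -- When the residual mass is 0 its inverse is ∞, but the residual measure is then 0 and the
  -- product still vanishes.
  have hcancel : ∀ x, (R x Set.univ)⁻¹ • R x Set.univ • R x = R x := fun x => by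
    by_cases h0 : R x Set.univ = 0
    · rw [Measure.measure_univ_eq_zero.mp h0]; simp
    · rw [smul_smul, ENNReal.inv_mul_cancel h0
        (ne_top_of_le_ne_top ENNReal.one_ne_top (hRle x)), one_smul]
  have hcancel' : ∀ x, (R x Set.univ)⁻¹ • R x Set.univ • R' x = R' x := fun x => by
    by_cases h0 : R x Set.univ = 0
    · rw [Measure.measure_univ_eq_zero.mp ((hRR x).trans h0)]; simp
    · rw [smul_smul, ENNReal.inv_mul_cancel h0
        (ne_top_of_le_ne_top ENNReal.one_ne_top (hRle x)), one_smul]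
  have hfst : ∀ x, (Γ x).map Prod.fst = κ x := fun x => by
    rw [hΓa, Measure.map_add _ _ measurable_fst, Measure.map_smul, Measure.map_fst_prod,
      Measure.map_map measurable_fst hDm, hRR, hcancel, ← hsum x]
    congr 1; exact Measure.map_id
  have hsnd : ∀ x, (Γ x).map Prod.snd = κ' x := fun x => by
    rw [hΓa, Measure.map_add _ _ measurable_snd, Measure.map_smul, Measure.map_snd_prod,
      Measure.map_map measurable_snd hDm, hcancel', ← hsum' x]
    congr 1; exact Measure.map_id
  refine ⟨Γ, ⟨fun x => ⟨?_⟩⟩, hfst, hsnd, fun x δ hδ => ?_⟩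
  · rw [← Set.preimage_univ (f := Prod.fst), ← Measure.map_apply measurable_fst MeasurableSet.univ,
      hfst]
    exact measure_univ
  · have hdm : MeasurableSet {p : Z × Z | p.1 ≠ p.2} := measurableSet_diagonal.compl
    have h1 : Γ x {p | p.1 ≠ p.2} ≤ R x Set.univ := by
      rw [hΓa, Measure.add_apply, Measure.map_apply hDm hdm]
      have : D ⁻¹' {p | p.1 ≠ p.2} = ∅ := by ext z; simp [hD]
      rw [this, measure_empty, zero_add, Measure.smul_apply, smul_eq_mul]
      calc _ ≤ (R x Set.univ)⁻¹ * ((R x).prod (R' x)) Set.univ := by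
            gcongr; exact Set.subset_univ _
        _ = (R x Set.univ)⁻¹ * (R x Set.univ * R x Set.univ) := by
            rw [← Set.univ_prod_univ, Measure.prod_prod, hRR]
        _ ≤ R x Set.univ := by
            rw [← mul_assoc]
            exact (mul_le_mul_left (ENNReal.inv_mul_le_one _) _).trans (one_mul _).le
    refine h1.trans ?_
    -- The residual R lives on E = {g < f} and R' on its complement, so on E the inequality between
    -- the two kernels reads R(E) ≤ δ.
    set E : Set Z := {z | g x z < f x z} with hE
    have hEm : MeasurableSet E := measurableSet_lt (Measurable.of_uncurry_left hgm)
      (Measurable.of_uncurry_left hfm)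
    have hRE : R x Eᶜ = 0 := by
      rw [hRa, withDensity_apply _ hEm.compl, setLIntegral_eq_zero_iff hEm.compl
        (Measurable.of_uncurry_left hrm)]
      refine Filter.Eventually.of_forall fun z hz => ?_
      have hz' : f x z ≤ g x z := not_lt.mp hz
      simp [hr, hh, hz']
    have hRE' : R' x E = 0 := by
      rw [hRa', withDensity_apply _ hEm, setLIntegral_eq_zero_iff hEm
        (Measurable.of_uncurry_left hrm')]
      refine Filter.Eventually.of_forall fun z hz => ?_
      have hz' : g x z ≤ f x z := le_of_lt hz
      simp [hr', hh, hz']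
    have h2 : R x Set.univ = R x E := by
      rw [← measure_add_measure_compl hEm, hRE, add_zero]
    have h3 := hδ E hEm
    rw [← hsum, ← hsum', Measure.add_apply, Measure.add_apply, hRE', add_zero] at h3
    rw [h2]
    have hne : m x E ≠ ∞ := ne_top_of_le_ne_top ENNReal.one_ne_top
      ((measure_mono (Set.subset_univ _)).trans (hmle x))
    exact (ENNReal.add_le_add_iff_left hne).mp h3

/-- Two Markov kernels into a product can be coupled so that their first components form a maximal
coupling. -/
theorem exists_coupling_fst_maximal [MeasurableSpace.CountablyGenerated Z] [MeasurableEq Z]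
    [StandardBorelSpace W] [Nonempty W]
    (κ κ' : Kernel X (Z × W)) [IsMarkovKernel κ] [IsMarkovKernel κ'] :
    ∃ Γ : Kernel X ((Z × W) × (Z × W)), IsMarkovKernel Γ ∧ (∀ x, (Γ x).map Prod.fst = κ x) ∧
      (∀ x, (Γ x).map Prod.snd = κ' x) ∧
      ∀ x (δ : ℝ≥0∞), (∀ B, MeasurableSet B →
        (κ x).map Prod.fst B ≤ (κ' x).map Prod.fst B + δ) → Γ x {p | p.1.1 ≠ p.2.1} ≤ δ := by
  obtain ⟨Γ₀, hΓ₀, h1, h2, h3⟩ := exists_maximal_coupling κ.fst κ'.fst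
  have hm1 : Measurable fun q : X × (Z × Z) => (q.1, q.2.1) := by fun_prop
  have hm2 : Measurable fun q : X × (Z × Z) => (q.1, q.2.2) := by fun_prop
  -- Given the maximally coupled first components, the second components are drawn independently
  -- from the conditional laws.
  set η : Kernel (X × (Z × Z)) (W × W) :=
    (κ.condKernel.comap _ hm1) ×ₖ (κ'.condKernel.comap _ hm2) with hη
  set ψ : (Z × Z) × (W × W) → (Z × W) × (Z × W) := fun q => ((q.1.1, q.2.1), (q.1.2, q.2.2)) with hψ
  have hψm : Measurable ψ := by fun_prop
  have hη1 : ∀ q, (η q).map Prod.fst = κ.condKernel (q.1, q.2.1) := fun q => by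
    rw [hη, Kernel.prod_apply, Measure.map_fst_prod]; simp [Kernel.comap_apply]
  have hη2 : ∀ q, (η q).map Prod.snd = κ'.condKernel (q.1, q.2.2) := fun q => by
    rw [hη, Kernel.prod_apply, Measure.map_snd_prod]; simp [Kernel.comap_apply]
  refine ⟨(Γ₀ ⊗ₖ η).map ψ, Kernel.IsMarkovKernel.map _ hψm, fun x => ?_, fun x => ?_,
    fun x δ hδ => ?_⟩
  · have hd : κ x = (κ.fst ⊗ₖ κ.condKernel) x := by rw [Kernel.disintegrate]
    refine Measure.ext_of_lintegral _ fun f hf => ?_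
    rw [Kernel.map_apply _ hψm, lintegral_map hf measurable_fst,
      lintegral_map (f := fun p => f p.1) (by fun_prop) hψm,
      Kernel.lintegral_compProd _ _ _ (by fun_prop), hd, Kernel.lintegral_compProd _ _ _ hf,
      ← h1 x, lintegral_map (hf.lintegral_kernel_prod_right'' (η := κ.condKernel)) measurable_fst]
    refine lintegral_congr fun z => ?_
    rw [← hη1 (x, z), lintegral_map (f := fun w => f (z.1, w)) (by fun_prop) measurable_fst]
  · have hd : κ' x = (κ'.fst ⊗ₖ κ'.condKernel) x := by rw [Kernel.disintegrate]
    refine Measure.ext_of_lintegral _ fun f hf => ?_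
    rw [Kernel.map_apply _ hψm, lintegral_map hf measurable_snd,
      lintegral_map (f := fun p => f p.2) (by fun_prop) hψm,
      Kernel.lintegral_compProd _ _ _ (by fun_prop), hd, Kernel.lintegral_compProd _ _ _ hf,
      ← h2 x, lintegral_map (hf.lintegral_kernel_prod_right'' (η := κ'.condKernel)) measurable_snd]
    refine lintegral_congr fun z => ?_
    rw [← hη2 (x, z), lintegral_map (f := fun w => f (z.2, w)) (by fun_prop) measurable_snd]
  · have hdm : MeasurableSet {p : Z × Z | p.1 ≠ p.2} := measurableSet_diagonal.compl
    have hdm' : MeasurableSet {p : (Z × W) × (Z × W) | p.1.1 ≠ p.2.1} :=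
      (measurable_fst.comp measurable_fst).prodMk (measurable_fst.comp measurable_snd) hdm
    have h4 : (Γ₀ ⊗ₖ η).map ψ x {p | p.1.1 ≠ p.2.1} = Γ₀ x {p | p.1 ≠ p.2} := by
      rw [Kernel.map_apply' _ hψm _ hdm', ← Kernel.fst_compProd Γ₀ η,
        Kernel.fst_apply' _ _ hdm, Kernel.fst_compProd]
      rfl
    rw [h4]
    refine h3 x δ fun B hB => ?_
    rw [Kernel.fst_apply, Kernel.fst_apply]
    exact hδ B hB

end MaximalCoupling

/-! ### Couplings of a kernel with itself and their composition. -/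

section Couples

variable {X : Type*} [MeasurableSpace X]

/-- `G` couples, for each pair of starting points, the corresponding laws of `K`. -/
structure Couples (G : Kernel (X × X) (X × X)) (K : Kernel X X) : Prop where
  fst : ∀ p, (G p).map Prod.fst = K p.1
  snd : ∀ p, (G p).map Prod.snd = K p.2

theorem Couples.pow {G : Kernel (X × X) (X × X)} {K : Kernel X X} (h : Couples G K) (n : ℕ) :
    Couples (G ^ n) (K ^ n) :=
  ⟨map_pow_apply_of_semiconj measurable_fst h.fst n,
    map_pow_apply_of_semiconj measurable_snd h.snd n⟩

theorem map_comp_apply_of_semiconj {Y : Type*} [MeasurableSpace Y] {K K' : Kernel X X}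
    {L L' : Kernel Y Y} {φ : X → Y} (hφ : Measurable φ) (h : ∀ x, (K x).map φ = L (φ x))
    (h' : ∀ x, (K' x).map φ = L' (φ x)) (x : X) :
    ((K' ∘ₖ K) x).map φ = (L' ∘ₖ L) (φ x) := by
  ext s hs
  rw [Measure.map_apply hφ hs, Kernel.comp_apply' _ _ _ (hφ hs), Kernel.comp_apply' _ _ _ hs, ← h,
    lintegral_map (Kernel.measurable_coe _ hs) hφ]
  refine lintegral_congr fun y => ?_
  rw [← h', Measure.map_apply hφ hs]

theorem Couples.comp {G G' : Kernel (X × X) (X × X)} {K K' : Kernel X X} (h : Couples G K)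
    (h' : Couples G' K') : Couples (G' ∘ₖ G) (K' ∘ₖ K) :=
  ⟨map_comp_apply_of_semiconj measurable_fst h.fst h'.fst,
    map_comp_apply_of_semiconj measurable_snd h.snd h'.snd⟩

end Couples

/-! ### One-step estimates, and the coupling over one block. -/

namespace Model

variable {d : ℕ} {Zs : Type*} [MeasurableSpace Zs] (M : Model d Zs)

instance (α : ℝ) : IsMarkovKernel (M.kernelY α) := by
  rw [kernelY]; infer_instance

instance (α : ℝ) : IsMarkovKernel (M.kernelV α) := by
  rw [kernelV]; infer_instance

/-- Bounds, in a seminorm `N`, for one step of the recursions. -/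
structure StepBounds (α : ℝ) (N : Seminorm ℝ (Vec d)) (ρ g ε : ℝ) : Prop where
  continuous : Continuous N
  rho_nonneg : 0 ≤ ρ
  rho_le_one : ρ ≤ 1
  g_nonneg : 0 ≤ g
  eps_nonneg : 0 ≤ ε
  contraction : ∀ x, N (act (1 - α • M.Abar) x) ≤ ρ * N x
  multiplicative : ∀ z x, N (α • act (M.Atilde z) x) ≤ g * N x
  additive : ∀ z, N (α • M.noise z) ≤ ε

/-- The state space of the chain `Y`. -/
abbrev StateY (d : ℕ) (Zs : Type*) := Zs × Vec d × Vec d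

namespace StepBounds

variable {M} {α : ℝ} {N : Seminorm ℝ (Vec d)} {ρ g ε : ℝ}

theorem step0_le (h : M.StepBounds α N ρ g ε) (z : Zs) (j : Vec d) :
    N (M.step0 α z j) ≤ ρ * N j + ε :=
  (map_sub_le_add N _ _).trans (add_le_add (h.contraction j) (h.additive z))

theorem step1_le (h : M.StepBounds α N ρ g ε) (z : Zs) (j₀ j₁ : Vec d) :
    N (M.step1 α z j₀ j₁) ≤ ρ * N j₁ + g * N j₀ :=
  (map_sub_le_add N _ _).trans (add_le_add (h.contraction j₁) (h.multiplicative z j₀))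

theorem step0_sub_le (h : M.StepBounds α N ρ g ε) (z : Zs) (j j' : Vec d) :
    N (M.step0 α z j - M.step0 α z j') ≤ ρ * N (j - j') := by
  have e : M.step0 α z j - M.step0 α z j' = act (1 - α • M.Abar) (j - j') := by
    simp only [step0, act, map_sub (Matrix.toEuclideanCLM (𝕜 := ℝ) (1 - α • M.Abar))]; abel
  rw [e]
  exact h.contraction _

theorem step1_sub_le (h : M.StepBounds α N ρ g ε) (z : Zs) (j₀ j₁ j₀' j₁' : Vec d) :
    N (M.step1 α z j₀ j₁ - M.step1 α z j₀' j₁') ≤ ρ * N (j₁ - j₁') + g * N (j₀ - j₀') := by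
  have e : M.step1 α z j₀ j₁ - M.step1 α z j₀' j₁' =
      act (1 - α • M.Abar) (j₁ - j₁') - α • act (M.Atilde z) (j₀ - j₀') := by
    simp only [step1, act, map_sub (Matrix.toEuclideanCLM (𝕜 := ℝ) (1 - α • M.Abar)),
      map_sub (Matrix.toEuclideanCLM (𝕜 := ℝ) (M.Atilde z)), smul_sub]; abel
  rw [e]
  exact (map_sub_le_add N _ _).trans (add_le_add (h.contraction _) (h.multiplicative z _))

end StepBounds

/-- The pair of the two recursion steps. -/
def steps (α : ℝ) (z : Zs) (j : Vec d × Vec d) : Vec d × Vec d :=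
  (M.step0 α z j.1, M.step1 α z j.1 j.2)

theorem measurable_steps_comp (α : ℝ) {T : Type*} [MeasurableSpace T] {f : T → Zs}
    {g : T → Vec d × Vec d} (hf : Measurable f) (hg : Measurable g) :
    Measurable fun t => M.steps α (f t) (g t) :=
  (M.measurable_step0_comp α hf (measurable_fst.comp hg)).prodMk
    (M.measurable_step1_comp α hf (measurable_fst.comp hg) (measurable_snd.comp hg))

theorem kernelY_apply (α : ℝ) (y : Zs × Vec d × Vec d) :
    M.kernelY α y = (M.Q y.1).map fun z => (z, M.steps α y.1 y.2) := by
  rw [kernelY, Kernel.prod_apply, Kernel.comap_apply, Kernel.deterministic_apply,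
    Measure.prod_dirac]
  rfl

theorem kernelV_apply (α : ℝ) (v : Vec d × Zs) :
    M.kernelV α v = (M.Q v.2).map fun z => (M.step0 α v.2 v.1, z) := by
  rw [kernelV, Kernel.prod_apply, Kernel.comap_apply, Kernel.deterministic_apply,
    Measure.dirac_prod]

theorem kernelY_map_fst (α : ℝ) (y : Zs × Vec d × Vec d) :
    (M.kernelY α y).map Prod.fst = M.Q y.1 := by
  rw [kernelY_apply, Measure.map_map measurable_fst (by fun_prop)]
  exact Measure.map_id

theorem ae_kernelY (α : ℝ) (y : Zs × Vec d × Vec d) {p : Zs × Vec d × Vec d → Prop}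
    (hp : MeasurableSet {y | p y}) (h : ∀ z, p (z, M.steps α y.1 y.2)) :
    ∀ᵐ y' ∂M.kernelY α y, p y' := by
  rw [kernelY_apply, ae_map_iff (by fun_prop) hp]
  exact Filter.Eventually.of_forall h

/-- The projection of the chain `Y` onto the chain `V`. -/
def projV (y : Zs × Vec d × Vec d) : Vec d × Zs := (y.2.1, y.1)

theorem measurable_projV : Measurable (projV : Zs × Vec d × Vec d → Vec d × Zs) := by
  unfold projV; fun_prop

theorem kernelY_map_projV (α : ℝ) (y : Zs × Vec d × Vec d) :
    (M.kernelY α y).map projV = M.kernelV α (projV y) := by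
  rw [kernelY_apply, kernelV_apply, Measure.map_map measurable_projV (by fun_prop)]
  rfl

theorem measurableSet_seminorm_le {N : Seminorm ℝ (Vec d)} (hN : Continuous N) (c c' : ℝ) :
    MeasurableSet {y : Zs × Vec d × Vec d | N y.2.1 ≤ c ∧ N y.2.2 ≤ c'} := by
  have hNm := hN.measurable
  have h1 : Measurable fun y : Zs × Vec d × Vec d => N y.2.1 := by fun_prop
  have h2 : Measurable fun y : Zs × Vec d × Vec d => N y.2.2 := by fun_prop
  exact (measurableSet_le h1 measurable_const).inter (measurableSet_le h2 measurable_const)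

/-- The contraction is discarded (ρ ≤ 1): over one block only linear growth is needed, and it holds
surely because the noise is bounded. -/
theorem ae_kernelY_pow_le {α : ℝ} {N : Seminorm ℝ (Vec d)} {ρ g ε : ℝ}
    (h : M.StepBounds α N ρ g ε) (n : ℕ) (y : Zs × Vec d × Vec d) :
    ∀ᵐ y' ∂(M.kernelY α ^ n) y, N y'.2.1 ≤ N y.2.1 + n * ε ∧
      N y'.2.2 ≤ N y.2.2 + n * g * (N y.2.1 + n * ε) := by
  refine ae_pow_of_ae_step (K := M.kernelY α) (P := fun n y' => N y'.2.1 ≤ N y.2.1 + n * ε ∧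
      N y'.2.2 ≤ N y.2.2 + n * g * (N y.2.1 + n * ε)) (fun n => measurableSet_seminorm_le h.continuous _ _)
      (fun n x hx => ?_) n ?_
  · refine M.ae_kernelY α x (measurableSet_seminorm_le h.continuous _ _) fun z => ?_
    have h0 := h.step0_le x.1 x.2.1
    have h1 := h.step1_le x.1 x.2.1 x.2.2
    have hg := h.g_nonneg
    have he := h.eps_nonneg
    have hr := h.rho_le_one
    have a0 : ρ * N x.2.1 ≤ N x.2.1 := mul_le_of_le_one_left (apply_nonneg N _) hr
    have a1 : ρ * N x.2.2 ≤ N x.2.2 := mul_le_of_le_one_left (apply_nonneg N _) hr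
    have a2 : g * N x.2.1 ≤ g * (N y.2.1 + n * ε) := by gcongr; exact hx.1
    have a3 : 0 ≤ (n + 1) * g * ε := by positivity
    simp only [steps]
    push_cast
    constructor
    · linarith [hx.1]
    · nlinarith [hx.2]
  · simp

/-- The kernel that moves two copies of the recursions with the same noise. -/
def kernelSync (α : ℝ) : Kernel (Zs × (Vec d × Vec d) × (Vec d × Vec d))
    (Zs × (Vec d × Vec d) × (Vec d × Vec d)) :=
  (M.Q.comap Prod.fst measurable_fst) ×ₖ
    Kernel.deterministic
      (fun x : Zs × (Vec d × Vec d) × (Vec d × Vec d) =>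
        (M.steps α x.1 x.2.1, M.steps α x.1 x.2.2))
      ((M.measurable_steps_comp α measurable_fst (measurable_fst.comp measurable_snd)).prodMk
        (M.measurable_steps_comp α measurable_fst (measurable_snd.comp measurable_snd)))

instance (α : ℝ) : IsMarkovKernel (M.kernelSync α) := by
  rw [kernelSync]; infer_instance

theorem kernelSync_apply (α : ℝ) (x : Zs × (Vec d × Vec d) × (Vec d × Vec d)) :
    M.kernelSync α x =
      (M.Q x.1).map fun z => (z, M.steps α x.1 x.2.1, M.steps α x.1 x.2.2) := by
  rw [kernelSync, Kernel.prod_apply, Kernel.comap_apply, Kernel.deterministic_apply,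
    Measure.prod_dirac]

/-- The part of the cost that does not involve the noise. -/
def syncCost (N : Seminorm ℝ (Vec d)) (w : ℝ) (j j' : Vec d × Vec d) : ℝ :=
  w * N (j.1 - j'.1) + N (j.2 - j'.2)

open Classical in
/-- The cost function that is contracted by the block couplings. -/
def blockCost (N : Seminorm ℝ (Vec d)) (w B s : ℝ) (p : (Zs × Vec d × Vec d) × (Zs × Vec d × Vec d)) :
    ℝ :=
  syncCost N w p.1.2 p.2.2 + (if p.1.1 = p.2.1 then 0 else
    4 * (B * (N p.1.2.1 + N p.2.2.1) + (N p.1.2.2 + N p.2.2.2) + s))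

theorem syncCost_nonneg (N : Seminorm ℝ (Vec d)) {w : ℝ} (hw : 0 ≤ w) (j j' : Vec d × Vec d) :
    0 ≤ syncCost N w j j' :=
  add_nonneg (mul_nonneg hw (apply_nonneg N _)) (apply_nonneg N _)

theorem measurable_syncCost {N : Seminorm ℝ (Vec d)} (hN : Continuous N) (w : ℝ) :
    Measurable fun q : (Vec d × Vec d) × (Vec d × Vec d) => syncCost N w q.1 q.2 := by
  have : Continuous fun q : (Vec d × Vec d) × (Vec d × Vec d) => syncCost N w q.1 q.2 := by
    unfold syncCost; fun_prop
  exact this.measurable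

theorem measurable_blockCost [MeasurableEq Zs] {N : Seminorm ℝ (Vec d)} (hN : Continuous N)
    (w B s : ℝ) : Measurable (blockCost (Zs := Zs) N w B s) := by
  have hNm := hN.measurable
  have hd : MeasurableSet {p : (Zs × Vec d × Vec d) × (Zs × Vec d × Vec d) | p.1.1 = p.2.1} :=
    (measurable_fst.comp measurable_fst).prodMk (measurable_fst.comp measurable_snd)
      measurableSet_diagonal
  have h1 : Measurable fun p : (Zs × Vec d × Vec d) × (Zs × Vec d × Vec d) =>
      syncCost N w p.1.2 p.2.2 :=
    (measurable_syncCost hN w).comp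
      ((measurable_snd.comp measurable_fst).prodMk (measurable_snd.comp measurable_snd))
  have h2 : Measurable fun p : (Zs × Vec d × Vec d) × (Zs × Vec d × Vec d) =>
      4 * (B * (N p.1.2.1 + N p.2.2.1) + (N p.1.2.2 + N p.2.2.2) + s) := by fun_prop
  exact h1.add (Measurable.ite hd measurable_const h2)

/-- With common noise the additive terms cancel and the differences obey a triangular system with
diagonal ρ and off-diagonal entry g. The weight w absorbs g at the price of the slower rate γ. -/
theorem StepBounds.syncCost_steps_le {M : Model d Zs} {α : ℝ} {N : Seminorm ℝ (Vec d)} {ρ g ε : ℝ}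
    (h : M.StepBounds α N ρ g ε) {w γ : ℝ} (hw : 0 ≤ w) (hργ : ρ ≤ γ) (hγ : w * ρ + g ≤ γ * w)
    (z : Zs) (j j' : Vec d × Vec d) :
    syncCost N w (M.steps α z j) (M.steps α z j') ≤ γ * syncCost N w j j' := by
  have h0 := h.step0_sub_le z j.1 j'.1
  have h1 := h.step1_sub_le z j.1 j.2 j'.1 j'.2
  have a0 : 0 ≤ N (j.1 - j'.1) := apply_nonneg N _
  have a1 : 0 ≤ N (j.2 - j'.2) := apply_nonneg N _
  simp only [syncCost, steps]
  calc _ ≤ w * (ρ * N (j.1 - j'.1)) + (ρ * N (j.2 - j'.2) + g * N (j.1 - j'.1)) := by gcongr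
    _ = (w * ρ + g) * N (j.1 - j'.1) + ρ * N (j.2 - j'.2) := by ring
    _ ≤ (γ * w) * N (j.1 - j'.1) + γ * N (j.2 - j'.2) := by gcongr
    _ = _ := by ring

theorem lintegral_kernelSync_pow_le {α : ℝ} {N : Seminorm ℝ (Vec d)} {ρ g ε : ℝ}
    (h : M.StepBounds α N ρ g ε) {w γ : ℝ} (hw : 0 ≤ w) (hργ : ρ ≤ γ) (hγ : w * ρ + g ≤ γ * w)
    (n : ℕ) (x : Zs × (Vec d × Vec d) × (Vec d × Vec d)) :
    ∫⁻ x', ENNReal.ofReal (syncCost N w x'.2.1 x'.2.2) ∂(M.kernelSync α ^ n) x ≤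
      ENNReal.ofReal (γ ^ n * syncCost N w x.2.1 x.2.2) := by
  have hγ0 : 0 ≤ γ := h.rho_nonneg.trans hργ
  rw [ENNReal.ofReal_mul (by positivity), ENNReal.ofReal_pow hγ0]
  have hm : Measurable fun x' : Zs × (Vec d × Vec d) × (Vec d × Vec d) =>
      ENNReal.ofReal (syncCost N w x'.2.1 x'.2.2) :=
    ((measurable_syncCost h.continuous w).comp measurable_snd).ennreal_ofReal
  refine lintegral_pow_le hm (fun x => ?_) n x
  rw [kernelSync_apply, lintegral_map hm (by fun_prop)]
  simp only
  rw [lintegral_const, measure_univ, mul_one, ← ENNReal.ofReal_mul hγ0]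
  exact ENNReal.ofReal_le_ofReal (h.syncCost_steps_le hw hργ hγ _ _ _)

/-- A coupling of the `r`-step transition probabilities: synchronous if the noises agree, maximal
in the noise otherwise. -/
theorem exists_block_coupling [StandardBorelSpace Zs] {α : ℝ} {N : Seminorm ℝ (Vec d)}
    {ρ g ε : ℝ} (h : M.StepBounds α N ρ g ε) {w γ B s : ℝ} (hw : 0 ≤ w) (hργ : ρ ≤ γ)
    (hγ : w * ρ + g ≤ γ * w) (hB : 0 ≤ B) (hs : 0 ≤ s) (r : ℕ) {e k : ℝ} (he : r * ε ≤ e)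
    (hk : r * g ≤ k) :
    ∃ G : Kernel (StateY d Zs × StateY d Zs)
        (StateY d Zs × StateY d Zs),
      IsMarkovKernel G ∧ Couples G (M.kernelY α ^ r) ∧
      (∀ p, p.1.1 = p.2.1 → ∫⁻ q, ENNReal.ofReal (blockCost N w B s q) ∂G p ≤
        ENNReal.ofReal (γ ^ r * blockCost N w B s p)) ∧
      ∀ p, p.1.1 ≠ p.2.1 → ∀ δ : ℝ, 0 ≤ δ →
        (∀ C, MeasurableSet C → (M.Q ^ r) p.1.1 C ≤ (M.Q ^ r) p.2.1 C + ENNReal.ofReal δ) →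
        ∫⁻ q, ENNReal.ofReal (blockCost N w B s q) ∂G p ≤
          ENNReal.ofReal ((w + δ * (4 * B)) * (N p.1.2.1 + N p.2.2.1 + 2 * e) +
            (1 + δ * 4) * (N p.1.2.2 + N p.2.2.2 + k * (N p.1.2.1 + N p.2.2.1 + 2 * e)) +
            δ * (4 * s)) := by
  have := isMarkovKernel_pow (M.kernelY α) r
  have := isMarkovKernel_pow (M.kernelSync α) r
  have hd : MeasurableSet {p : StateY d Zs × StateY d Zs | p.1.1 = p.2.1} :=
    (measurable_fst.comp measurable_fst).prodMk (measurable_fst.comp measurable_snd)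
      measurableSet_diagonal
  obtain ⟨Γ, hΓ, hΓ1, hΓ2, hΓ3⟩ := exists_coupling_fst_maximal
    ((M.kernelY α ^ r).comap (Prod.fst : StateY d Zs × StateY d Zs → StateY d Zs) measurable_fst)
    ((M.kernelY α ^ r).comap (Prod.snd : StateY d Zs × StateY d Zs → StateY d Zs) measurable_snd)
  let ι : StateY d Zs × StateY d Zs → Zs × (Vec d × Vec d) × (Vec d × Vec d) := fun p => (p.1.1, p.1.2, p.2.2)
  have hι : Measurable ι := by fun_prop
  let π₁ : Zs × (Vec d × Vec d) × (Vec d × Vec d) → StateY d Zs := fun x => (x.1, x.2.1)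
  let π₂ : Zs × (Vec d × Vec d) × (Vec d × Vec d) → StateY d Zs := fun x => (x.1, x.2.2)
  have hπ₁ : Measurable π₁ := by fun_prop
  have hπ₂ : Measurable π₂ := by fun_prop
  have hsemi₁ : ∀ x, (M.kernelSync α x).map π₁ = M.kernelY α (π₁ x) := fun x => by
    rw [kernelSync_apply, kernelY_apply, Measure.map_map hπ₁ (by fun_prop)]; rfl
  have hsemi₂ : ∀ x, (M.kernelSync α x).map π₂ = M.kernelY α (π₂ x) := fun x => by
    rw [kernelSync_apply, kernelY_apply, Measure.map_map hπ₂ (by fun_prop)]; rfl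
  have hπ : Measurable fun x => (π₁ x, π₂ x) := hπ₁.prodMk hπ₂
  -- From equal z's both copies follow one noise path, so they still have equal z's at the end of
  -- the block and the penalty stays zero.
  let T : Kernel (StateY d Zs × StateY d Zs) (StateY d Zs × StateY d Zs) :=
    ((M.kernelSync α ^ r).comap ι hι).map fun x => (π₁ x, π₂ x)
  have hTa : ∀ p, T p = ((M.kernelSync α ^ r) (ι p)).map fun x => (π₁ x, π₂ x) := fun p => by
    rw [Kernel.map_apply _ hπ, Kernel.comap_apply]
  have hTM : IsMarkovKernel T := Kernel.IsMarkovKernel.map _ hπ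
  classical
  let G : Kernel (StateY d Zs × StateY d Zs) (StateY d Zs × StateY d Zs) := Kernel.piecewise hd T Γ
  have hG1 : ∀ p : StateY d Zs × StateY d Zs, p.1.1 = p.2.1 → G p = T p := fun p hp => by
    rw [Kernel.piecewise_apply]; exact if_pos hp
  have hG2 : ∀ p : StateY d Zs × StateY d Zs, p.1.1 ≠ p.2.1 → G p = Γ p := fun p hp => by
    rw [Kernel.piecewise_apply]; exact if_neg hp
  have hbm := (measurable_blockCost (Zs := Zs) h.continuous w B s).ennreal_ofReal
  refine ⟨G, inferInstance, ⟨fun p => ?_, fun p => ?_⟩, fun p hp => ?_, fun p hp δ hδ hC' => ?_⟩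
  · by_cases hp : p.1.1 = p.2.1
    · rw [hG1 p hp, hTa, Measure.map_map measurable_fst hπ]
      exact map_pow_apply_of_semiconj hπ₁ hsemi₁ r (ι p)
    · rw [hG2 p hp, hΓ1]; rfl
  · by_cases hp : p.1.1 = p.2.1
    · rw [hG1 p hp, hTa, Measure.map_map measurable_snd hπ]
      have : p.2 = π₂ (ι p) := Prod.ext hp.symm rfl
      rw [this]
      exact map_pow_apply_of_semiconj hπ₂ hsemi₂ r (ι p)
    · rw [hG2 p hp, hΓ2]; rfl
  · rw [hG1 p hp, hTa, lintegral_map hbm hπ]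
    refine le_trans (le_of_eq ?_)
      ((M.lintegral_kernelSync_pow_le h hw hργ hγ r (ι p)).trans (le_of_eq ?_))
    · refine lintegral_congr fun x => ?_
      simp [blockCost, π₁, π₂]
    · simp [blockCost, hp, ι]
  · rw [hG2 p hp]
    have hfst : (Γ p).map Prod.fst = (M.kernelY α ^ r) p.1 := hΓ1 p
    have hsnd : (Γ p).map Prod.snd = (M.kernelY α ^ r) p.2 := hΓ2 p
    have ae1 := M.ae_kernelY_pow_le h r p.1
    have ae2 := M.ae_kernelY_pow_le h r p.2
    rw [← hfst] at ae1
    rw [← hsnd] at ae2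
    replace ae1 := ae_of_ae_map measurable_fst.aemeasurable ae1
    replace ae2 := ae_of_ae_map measurable_snd.aemeasurable ae2
    have hneq : Γ p {q | q.1.1 ≠ q.2.1} ≤ ENNReal.ofReal δ := by
      refine hΓ3 p _ fun C hC => ?_
      rw [Kernel.comap_apply, Kernel.comap_apply,
        map_pow_apply_of_semiconj measurable_fst (M.kernelY_map_fst α),
        map_pow_apply_of_semiconj measurable_fst (M.kernelY_map_fst α)]
      exact hC' C hC
    set U := N p.1.2.1 + N p.2.2.1 + 2 * e
    set V := N p.1.2.2 + N p.2.2.2 + k * U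
    have hNn : ∀ x, 0 ≤ N x := fun x => apply_nonneg N x
    have he0 : 0 ≤ e := le_trans (mul_nonneg (Nat.cast_nonneg r) h.eps_nonneg) he
    have hk0 : 0 ≤ k := le_trans (mul_nonneg (Nat.cast_nonneg r) h.g_nonneg) hk
    have hU : 0 ≤ U := by have := hNn p.1.2.1; have := hNn p.2.2.1; positivity
    have hV : 0 ≤ V := by have := hNn p.1.2.2; have := hNn p.2.2.2; positivity
    -- The final sizes are bounded surely by U and V. The difference part is bounded by the sizes,
    -- and the penalty is paid only on the event of unequal z's, whose probability is at most δ.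
    have hbound : ∀ᵐ q ∂Γ p, ENNReal.ofReal (blockCost N w B s q) ≤
        ENNReal.ofReal (w * U + V) +
          {q : StateY d Zs × StateY d Zs | q.1.1 ≠ q.2.1}.indicator
            (fun _ => ENNReal.ofReal (4 * (B * U + V + s))) q := by
      filter_upwards [ae1, ae2] with q hq1 hq2
      have u1 : N q.1.2.1 + N q.2.2.1 ≤ U := by linarith [hq1.1, hq2.1]
      have v1 : N q.1.2.2 + N q.2.2.2 ≤ V := by
        have b1 : r * g * (N p.1.2.1 + r * ε) ≤ k * (N p.1.2.1 + e) := by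
          have := hNn p.1.2.1; have := h.eps_nonneg; gcongr
        have b2 : r * g * (N p.2.2.1 + r * ε) ≤ k * (N p.2.2.1 + e) := by
          have := hNn p.2.2.1; have := h.eps_nonneg; gcongr
        have : k * (N p.1.2.1 + e) + k * (N p.2.2.1 + e) = k * U := by simp only [U]; ring
        linarith [hq1.2, hq2.2]
      have hc : syncCost N w q.1.2 q.2.2 ≤ w * U + V := by
        have c1 : N (q.1.2.1 - q.2.2.1) ≤ U := (map_sub_le_add N _ _).trans u1
        have c2 : N (q.1.2.2 - q.2.2.2) ≤ V := (map_sub_le_add N _ _).trans v1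
        simp only [syncCost]; gcongr
      by_cases hq : q.1.1 = q.2.1
      · rw [Set.indicator_of_notMem (by simpa using hq), add_zero]
        exact ENNReal.ofReal_le_ofReal (by simpa [blockCost, hq] using hc)
      · rw [Set.indicator_of_mem hq, ← ENNReal.ofReal_add (by positivity) (by positivity)]
        refine ENNReal.ofReal_le_ofReal ?_
        simp only [blockCost, hq, if_false]
        gcongr
    refine (lintegral_mono_ae hbound).trans ?_
    have hdc : MeasurableSet {q : StateY d Zs × StateY d Zs | q.1.1 ≠ q.2.1} := hd.compl
    rw [lintegral_add_left measurable_const, lintegral_const, measure_univ, mul_one,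
      lintegral_indicator_const hdc]
    calc _ ≤ ENNReal.ofReal (w * U + V) +
          ENNReal.ofReal (4 * (B * U + V + s)) * ENNReal.ofReal δ := by gcongr
      _ = ENNReal.ofReal (w * U + V + 4 * (B * U + V + s) * δ) := by
          rw [← ENNReal.ofReal_mul (by positivity), ← ENNReal.ofReal_add (by positivity)
            (by positivity)]
      _ = _ := by congr 1; ring

end Model

/-- At time k = tmix the exponent ⌊k/tmix⌋ is exactly 1. -/
theorem UniformlyErgodic.measure_pow_le {Zs : Type*} [MeasurableSpace Zs]
    {Q : Kernel Zs Zs} [IsMarkovKernel Q] {t : ℕ} (h : UniformlyErgodic Q t) (z z' : Zs) {B : Set Zs}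
    (hB : MeasurableSet B) : (Q ^ t) z B ≤ (Q ^ t) z' B + ENNReal.ofReal (1 / 4) := by
  have := isMarkovKernel_pow Q t
  have h1 := h.2 t h.1
  rw [Nat.div_self h.1, pow_one] at h1
  have h2 : (1 / 2 : ℝ≥0∞) * tvNorm ((Q ^ t) z) ((Q ^ t) z') ≤ 1 / 4 :=
    (le_iSup₂ (f := fun z z' => (1 / 2 : ℝ≥0∞) * tvNorm ((Q ^ t) z) ((Q ^ t) z')) z z').trans h1
  refine (measure_le_add_half_tvNorm _ ((Q ^ t) z') hB).trans ?_
  gcongr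
  refine h2.trans (le_of_eq ?_)
  rw [ENNReal.ofReal_div_of_pos (by norm_num)]
  simp

/-! ### Contraction of the block cost at all times. -/

namespace Model

variable {d : ℕ} {Zs : Type*} [MeasurableSpace Zs] (M : Model d Zs)

/-- Conditions on the constants of `blockCost` for blocks of length `t`. -/
structure BlockConstants (α : ℝ) (N : Seminorm ℝ (Vec d)) (ρ g ε : ℝ) (t : ℕ)
    (w B s γ : ℝ) : Prop extends M.StepBounds α N ρ g ε where
  w_nonneg : 0 ≤ w
  rho_le : ρ ≤ γ
  gamma_le_one : γ ≤ 1
  sync : w * ρ + g ≤ γ * w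
  w_add_le : w + 2 * (t * g) ≤ B
  le_s : 4 * B * (t * ε) ≤ s
  half_le : 1 / 2 ≤ γ ^ t

variable {M} {α : ℝ} {N : Seminorm ℝ (Vec d)} {ρ g ε w B s γ : ℝ} {t : ℕ}

namespace BlockConstants

theorem tg_nonneg (h : M.BlockConstants α N ρ g ε t w B s γ) : 0 ≤ t * g :=
  mul_nonneg (Nat.cast_nonneg t) h.g_nonneg

theorem te_nonneg (h : M.BlockConstants α N ρ g ε t w B s γ) : 0 ≤ t * ε :=
  mul_nonneg (Nat.cast_nonneg t) h.eps_nonneg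

theorem B_nonneg (h : M.BlockConstants α N ρ g ε t w B s γ) : 0 ≤ B := by
  linarith [h.w_nonneg, h.w_add_le, h.tg_nonneg]

theorem s_nonneg (h : M.BlockConstants α N ρ g ε t w B s γ) : 0 ≤ s :=
  le_trans (mul_nonneg (mul_nonneg (by norm_num) h.B_nonneg) h.te_nonneg) h.le_s

theorem gamma_nonneg (h : M.BlockConstants α N ρ g ε t w B s γ) : 0 ≤ γ :=
  h.rho_nonneg.trans h.rho_le

theorem blockCost_nonneg (h : M.BlockConstants α N ρ g ε t w B s γ) (p : StateY d Zs × StateY d Zs) :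
    0 ≤ blockCost N w B s p := by
  have h1 := syncCost_nonneg N h.w_nonneg p.1.2 p.2.2
  have hN : ∀ x, 0 ≤ N x := fun x => apply_nonneg N x
  have hB := h.B_nonneg
  have hs := h.s_nonneg
  have h2 : 0 ≤ 4 * (B * (N p.1.2.1 + N p.2.2.1) + (N p.1.2.2 + N p.2.2.2) + s) := by
    have := hN p.1.2.1; have := hN p.2.2.1; have := hN p.1.2.2; have := hN p.2.2.2
    positivity
  rw [blockCost]
  split_ifs <;> linarith

theorem blockCost_ge (h : M.BlockConstants α N ρ g ε t w B s γ) {p : StateY d Zs × StateY d Zs}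
    (hp : p.1.1 ≠ p.2.1) :
    4 * (B * (N p.1.2.1 + N p.2.2.1) + (N p.1.2.2 + N p.2.2.2) + s) ≤ blockCost N w B s p := by
  have h1 := syncCost_nonneg N h.w_nonneg p.1.2 p.2.2
  rw [blockCost, if_neg hp]
  linarith

/-- From unequal z's, take δ = 1/4, which cancels the factor 4 of the penalty. With e = tε and k =
tg the bound becomes (w + B + 2k)(U + 2e) + 2V + s. The conditions w + 2k ≤ B and 4Be ≤ s reduce it
to 2(BU + V + s), half of the penalty at the start, and 1/2 ≤ γᵗ. -/
theorem exists_coupling_pow_block [StandardBorelSpace Zs]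
    (h : M.BlockConstants α N ρ g ε t w B s γ) (hQ : UniformlyErgodic M.Q t) :
    ∃ G : Kernel (StateY d Zs × StateY d Zs) (StateY d Zs × StateY d Zs), IsMarkovKernel G ∧
      Couples G (M.kernelY α ^ t) ∧ ∀ p, ∫⁻ q, ENNReal.ofReal (blockCost N w B s q) ∂G p ≤
        ENNReal.ofReal (γ ^ t) * ENNReal.ofReal (blockCost N w B s p) := by
  have hγ0 := h.gamma_nonneg
  obtain ⟨G, hG, hGc, h1, h2⟩ := M.exists_block_coupling h.toStepBounds h.w_nonneg h.rho_le h.sync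
    h.B_nonneg h.s_nonneg t (le_refl (t * ε)) (le_refl (t * g))
  refine ⟨G, hG, hGc, fun p => ?_⟩
  rw [← ENNReal.ofReal_mul (by positivity)]
  by_cases hp : p.1.1 = p.2.1
  · exact h1 p hp
  refine (h2 p hp (1 / 4) (by norm_num) fun C hC => hQ.measure_pow_le _ _ hC).trans ?_
  refine ENNReal.ofReal_le_ofReal ?_
  have hge := h.blockCost_ge hp
  have hU : 0 ≤ N p.1.2.1 + N p.2.2.1 := add_nonneg (apply_nonneg N _) (apply_nonneg N _)
  have hV : 0 ≤ N p.1.2.2 + N p.2.2.2 := add_nonneg (apply_nonneg N _) (apply_nonneg N _)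
  set U := N p.1.2.1 + N p.2.2.1
  set V := N p.1.2.2 + N p.2.2.2
  have a1 := h.w_add_le
  have a2 := h.le_s
  have hB := h.B_nonneg
  have hs := h.s_nonneg
  have he := h.te_nonneg
  set e := t * ε
  set k := t * g
  have b1 : (w + B + 2 * k) * (U + 2 * e) ≤ 2 * B * (U + 2 * e) := by gcongr; linarith
  have b2 : 1 / 2 * (4 * (B * U + V + s)) ≤ γ ^ t * blockCost N w B s p := by
    have := h.half_le
    have : 0 ≤ B * U := by positivity
    gcongr
  nlinarith

/-- For an incomplete block no mixing is available, so δ = 1 is used; the loss is a factor 2. -/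
theorem exists_coupling_pow_lt [StandardBorelSpace Zs]
    (h : M.BlockConstants α N ρ g ε t w B s γ) {r : ℕ} (hr : r ≤ t) :
    ∃ G : Kernel (StateY d Zs × StateY d Zs) (StateY d Zs × StateY d Zs), IsMarkovKernel G ∧
      Couples G (M.kernelY α ^ r) ∧ ∀ p, ∫⁻ q, ENNReal.ofReal (blockCost N w B s q) ∂G p ≤
        ENNReal.ofReal 2 * ENNReal.ofReal (blockCost N w B s p) := by
  have hγ0 := h.gamma_nonneg
  have hr' : (r : ℝ) ≤ t := by exact_mod_cast hr
  obtain ⟨G, hG, hGc, h1, h2⟩ := M.exists_block_coupling h.toStepBounds h.w_nonneg h.rho_le h.sync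
    h.B_nonneg h.s_nonneg r (mul_le_mul_of_nonneg_right hr' h.eps_nonneg)
    (mul_le_mul_of_nonneg_right hr' h.g_nonneg)
  refine ⟨G, hG, hGc, fun p => ?_⟩
  rw [← ENNReal.ofReal_mul (by norm_num)]
  have h0 := h.blockCost_nonneg p
  by_cases hp : p.1.1 = p.2.1
  · refine (h1 p hp).trans (ENNReal.ofReal_le_ofReal ?_)
    gcongr
    exact (pow_le_one₀ hγ0 h.gamma_le_one).trans (by norm_num)
  have hle : ∀ C, MeasurableSet C → (M.Q ^ r) p.1.1 C ≤ (M.Q ^ r) p.2.1 C + ENNReal.ofReal 1 := by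
    intro C _
    have := isMarkovKernel_pow M.Q r
    rw [ENNReal.ofReal_one]
    exact prob_le_one.trans le_add_self
  refine (h2 p hp 1 zero_le_one hle).trans (ENNReal.ofReal_le_ofReal ?_)
  have hge := h.blockCost_ge hp
  have hU : 0 ≤ N p.1.2.1 + N p.2.2.1 := add_nonneg (apply_nonneg N _) (apply_nonneg N _)
  have hV : 0 ≤ N p.1.2.2 + N p.2.2.2 := add_nonneg (apply_nonneg N _) (apply_nonneg N _)
  set U := N p.1.2.1 + N p.2.2.1
  set V := N p.1.2.2 + N p.2.2.2
  have a1 := h.w_add_le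
  have a2 := h.le_s
  have hB := h.B_nonneg
  have hs := h.s_nonneg
  have he := h.te_nonneg
  have hw := h.w_nonneg
  set e := t * ε
  set k := t * g
  -- Here w + 2k ≤ B and, since w ≥ 0, 3k ≤ 3B/2.
  have b1 : (w + 4 * B + 5 * k) * (U + 2 * e) ≤ (13 / 2 * B) * (U + 2 * e) := by
    gcongr; linarith
  have : 0 ≤ B * U := by positivity
  nlinarith

/-- Write n as full blocks plus a remainder, the full blocks run first. The constant 4 is the factor
2 lost on the remainder times the factor 2 that replaces γ to the number of steps in full blocks by
γⁿ, as 1/2 ≤ γ^(n % t). -/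
theorem exists_coupling_pow [StandardBorelSpace Zs]
    (h : M.BlockConstants α N ρ g ε t w B s γ) (hQ : UniformlyErgodic M.Q t) (n : ℕ) :
    ∃ G : Kernel (StateY d Zs × StateY d Zs) (StateY d Zs × StateY d Zs), IsMarkovKernel G ∧
      Couples G (M.kernelY α ^ n) ∧ ∀ p, ∫⁻ q, ENNReal.ofReal (blockCost N w B s q) ∂G p ≤
        ENNReal.ofReal (4 * γ ^ n * blockCost N w B s p) := by
  obtain ⟨G, hG, hGc, hGi⟩ := h.exists_coupling_pow_block hQ
  obtain ⟨G', hG', hGc', hGi'⟩ := h.exists_coupling_pow_lt (r := n % t)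
    (Nat.mod_lt _ hQ.1).le
  have := isMarkovKernel_pow G (n / t)
  have hbm := (measurable_blockCost (Zs := Zs) h.continuous w B s).ennreal_ofReal
  have hγ0 := h.gamma_nonneg
  refine ⟨G' ∘ₖ (G ^ (n / t)), inferInstance, ?_, fun p => ?_⟩
  · have := (hGc.pow (n / t)).comp hGc'
    have e : M.kernelY α ^ n = (M.kernelY α ^ (n % t)) ∘ₖ ((M.kernelY α ^ t) ^ (n / t)) := by
      change _ = M.kernelY α ^ (n % t) * (M.kernelY α ^ t) ^ (n / t)
      rw [← pow_mul, ← pow_add, Nat.mod_add_div]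
    rwa [e]
  · rw [Kernel.lintegral_comp _ _ _ hbm]
    calc ∫⁻ q, ∫⁻ q', ENNReal.ofReal (blockCost N w B s q') ∂G' q ∂(G ^ (n / t)) p
        ≤ ∫⁻ q, ENNReal.ofReal 2 * ENNReal.ofReal (blockCost N w B s q) ∂(G ^ (n / t)) p :=
          lintegral_mono fun q => hGi' q
      _ = ENNReal.ofReal 2 * ∫⁻ q, ENNReal.ofReal (blockCost N w B s q) ∂(G ^ (n / t)) p :=
          lintegral_const_mul _ hbm
      _ ≤ ENNReal.ofReal 2 * (ENNReal.ofReal (γ ^ t) ^ (n / t) * ENNReal.ofReal (blockCost N w B s p)) := by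
          gcongr; exact lintegral_pow_le hbm hGi _ p
      _ = ENNReal.ofReal (2 * ((γ ^ t) ^ (n / t) * blockCost N w B s p)) := by
          rw [← ENNReal.ofReal_pow (by positivity), ← ENNReal.ofReal_mul (by positivity),
            ENNReal.ofReal_mul zero_le_two]
      _ ≤ _ := by
          refine ENNReal.ofReal_le_ofReal ?_
          have h0 := h.blockCost_nonneg p
          have h1 : 1 / 2 ≤ γ ^ (n % t) := h.half_le.trans
            (pow_le_pow_of_le_one hγ0 h.gamma_le_one (Nat.mod_lt _ hQ.1).le)
          have h2 : γ ^ n = γ ^ (n % t) * (γ ^ t) ^ (n / t) := by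
            rw [← pow_mul, ← pow_add, Nat.mod_add_div]
          have h3 : 0 ≤ (γ ^ t) ^ (n / t) := by positivity
          rw [h2, ← mul_assoc]
          refine mul_le_mul_of_nonneg_right ?_ h0
          nlinarith

end BlockConstants

end Model

/-! ### Choice of the constants and comparison of the costs. -/

/-- The weight of the `J⁽⁰⁾`-difference in the contracted cost. -/
def costWeight (κ a c : ℝ) : ℝ := 1 + 4 * (Real.sqrt κ * c) / a

/-- The weight of `‖J⁽⁰⁾‖` in the contracted cost. -/
def costWeightNe (κ a c : ℝ) : ℝ := costWeight κ a c + 2 * Real.sqrt κ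

/-- The constant in the comparison of the contracted cost with the cost of the theorem. -/
def costRatio (κ a c : ℝ) : ℝ :=
  4 * (costWeightNe κ a c * Real.sqrt κ) *
    (1 + 4 * (costWeightNe κ a c * Real.sqrt κ) * Real.sqrt (1 / a))

/-- This is the room between ρ = e^{-x/2} and γ = e^{-x/12}, with x = αa, that pays for the coupling
of J⁽¹⁾ to J⁽⁰⁾. -/
theorem exp_gap {x : ℝ} (h0 : 0 ≤ x) (h1 : x ≤ 1 / 2) :
    Real.exp (-x / 2) + x / 4 ≤ Real.exp (-x / 12) := by
  have e : Real.exp (-x / 12) = Real.exp (-x / 2) * Real.exp (5 * x / 12) := by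
    rw [← Real.exp_add]; congr 1; ring
  have a1 := Real.add_one_le_exp (5 * x / 12)
  have a2 := Real.add_one_le_exp (-x / 2)
  have a3 := Real.exp_pos (-x / 2)
  rw [e]
  nlinarith

namespace Model

variable {d : ℕ} {Zs : Type*} [MeasurableSpace Zs] (M : Model d Zs)

theorem CA_nonneg : 0 ≤ M.CA :=
  (Real.iSup_nonneg fun _ => norm_nonneg _).trans (le_max_left _ _)

theorem specNorm_Atilde_le (hA : M.AssumptionA) (z : Zs) : specNorm (M.Atilde z) ≤ M.CA :=
  (le_ciSup hA.2.1 z).trans (le_max_right _ _)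

theorem noiseSup_nonneg : 0 ≤ M.noiseSup := Real.iSup_nonneg fun _ => norm_nonneg _

theorem norm_noise_le (hN : M.AssumptionNoise) (z : Zs) : ‖M.noise z‖ ≤ M.noiseSup :=
  le_ciSup hN.2.2 z

/-- The only consequences of the step size threshold that the proof uses: the contraction of I - α
Abar, bounded growth over a block, and γ^tmix ≥ 1/2. -/
theorem alpha_bounds {tmix : ℕ} (ht : 1 ≤ tmix) {α : ℝ} (h0 : 0 < α) (hα : α < M.alphaB tmix)
    (ha : 0 < M.a) :
    α ≤ M.alphaInf ∧ α * tmix * (1 + M.CA) ≤ 1 ∧ α * tmix * M.a ≤ 1 / 2 := by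
  have ht' : (1 : ℝ) ≤ tmix := by exact_mod_cast ht
  have htp : (0 : ℝ) < tmix := by linarith
  have h1 : α * tmix < min (min (M.alphaMq (2 * (1 + Real.log d))) (1 / (1 + M.CA)))
      (1 / (M.a * 2)) := by
    rw [alphaB, alphaBp, ← div_eq_mul_inv, lt_div_iff₀ htp] at hα
    exact hα
  have hαt : α ≤ α * tmix := le_mul_of_one_le_right h0.le ht'
  refine ⟨?_, ?_, ?_⟩
  · have h2 : α * tmix < M.alphaM :=
      h1.trans_le ((min_le_left _ _).trans ((min_le_left _ _).trans (min_le_left _ _)))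
    have hpos : 0 < M.alphaM := (mul_pos h0 htp).trans h2
    rw [alphaM] at hpos h2
    set X := min (min M.alphaInf ((Real.sqrt M.kappa)⁻¹ * M.CA⁻¹))
      (M.a / (6 * Real.exp 1 * M.kappa * M.CA)) with hX
    -- This includes a zero block length, whose inverse is 0 by convention; the positivity of α
    -- excludes that case and a nonpositive minimum alike.
    have hm : (M.blockLength : ℝ)⁻¹ ≤ 1 := Nat.cast_inv_le_one _
    have hm0 : 0 ≤ (M.blockLength : ℝ)⁻¹ := by positivity
    have hX0 : 0 < X := by
      by_contra hc
      exact absurd hpos (not_lt.mpr (mul_nonpos_of_nonpos_of_nonneg (not_lt.mp hc) hm0))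
    have hXle : X ≤ M.alphaInf := (min_le_left _ _).trans (min_le_left _ _)
    have : X * (M.blockLength : ℝ)⁻¹ ≤ X := mul_le_of_le_one_right hX0.le hm
    linarith
  · have h2 := h1.le.trans ((min_le_left _ _).trans (min_le_right _ _))
    rwa [le_div_iff₀ (by linarith [M.CA_nonneg])] at h2
  · have h2 := h1.le.trans (min_le_right _ _)
    rw [le_div_iff₀ (by positivity)] at h2
    linarith

/-- The offset s is left free above its lower bound: the Wasserstein estimate needs it comparable
with √(αa)‖ε‖_∞, the stationarity argument needs it at least 1. -/
theorem exists_blockConstants [NeZero d] {tmix : ℕ} (hA : M.AssumptionA) (hN : M.AssumptionNoise)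
    (ht : 1 ≤ tmix) {α : ℝ} (h0 : 0 < α) (hα : α < M.alphaB tmix) :
    ∃ N : Seminorm ℝ (Vec d), (∀ x, ‖x‖ ≤ N x) ∧ (∀ x, N x ≤ Real.sqrt M.kappa * ‖x‖) ∧
      ∀ s, 4 * costWeightNe M.kappa M.a M.CA * (tmix * (α * (Real.sqrt M.kappa * M.noiseSup))) ≤ s →
        M.BlockConstants α N (Real.exp (-(α * M.a) / 2)) (α * (Real.sqrt M.kappa * M.CA))
          (α * (Real.sqrt M.kappa * M.noiseSup)) tmix (costWeight M.kappa M.a M.CA)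
          (costWeightNe M.kappa M.a M.CA) s (Real.exp (-(α * M.a) / 12)) := by
  have ha := M.a_pos hA
  have hCA := M.CA_nonneg
  have hnS := M.noiseSup_nonneg
  obtain ⟨b1, b2, b3⟩ := M.alpha_bounds ht h0 hα ha
  obtain ⟨N, hN1, hN2, hN3⟩ := M.exists_contracted_seminorm hA h0 b1
  have ht' : (1 : ℝ) ≤ tmix := by exact_mod_cast ht
  have hK := Real.sqrt_nonneg M.kappa
  set K := Real.sqrt M.kappa
  have hx0 : 0 ≤ α * M.a := by positivity
  have hxt : α * M.a ≤ α * tmix * M.a := by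
    rw [mul_right_comm]; exact le_mul_of_one_le_right hx0 ht'
  have hcont : Continuous N := by
    have hL : LipschitzWith (Real.toNNReal K) N := LipschitzWith.of_dist_le_mul fun x y => by
      rw [Real.dist_eq, Real.coe_toNNReal _ hK, dist_eq_norm]
      exact (abs_sub_map_le_sub N x y).trans (hN2 _)
    exact hL.continuous
  refine ⟨N, hN1, hN2, fun s hs => ?_⟩
  refine
    { continuous := hcont
      rho_nonneg := (Real.exp_pos _).le
      rho_le_one := Real.exp_le_one_iff.mpr (by linarith)
      g_nonneg := by positivity
      eps_nonneg := by positivity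
      contraction := hN3
      multiplicative := fun z x => ?_
      additive := fun z => ?_
      w_nonneg := by unfold costWeight; positivity
      rho_le := Real.exp_le_exp.mpr (by linarith)
      gamma_le_one := Real.exp_le_one_iff.mpr (by linarith)
      sync := ?_
      w_add_le := ?_
      le_s := hs
      half_le := ?_ }
  · rw [map_smul_eq_mul, Real.norm_of_nonneg h0.le, mul_assoc]
    gcongr
    calc N (act (M.Atilde z) x) ≤ K * ‖act (M.Atilde z) x‖ := hN2 _
      _ ≤ K * (M.CA * N x) := by
          gcongr
          refine (norm_act_le _ _).trans ?_
          have := M.specNorm_Atilde_le hA z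
          gcongr
          exact hN1 x
      _ = K * M.CA * N x := by ring
  · rw [map_smul_eq_mul, Real.norm_of_nonneg h0.le]
    gcongr
    refine (hN2 _).trans ?_
    gcongr
    exact M.norm_noise_le hN z
  · have hgap := exp_gap hx0 (hxt.trans b3)
    have hw : 0 ≤ costWeight M.kappa M.a M.CA := by unfold costWeight; positivity
    -- The weight w = 1 + 4√κ C_A/a is chosen so that g = α√κ C_A is at most w αa/4, the gap
    -- supplied by `exp_gap`.
    have h1 : α * (K * M.CA) ≤ costWeight M.kappa M.a M.CA * (α * M.a / 4) := by
      have e : costWeight M.kappa M.a M.CA * (α * M.a / 4) = α * M.a / 4 + α * (K * M.CA) := by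
        unfold costWeight; field_simp; ring
      rw [e]; linarith
    nlinarith [mul_le_mul_of_nonneg_left hgap hw]
  -- As α tmix C_A ≤ 1, the growth coefficient over a block is at most √κ, whence B = w + 2√κ.
  · have : tmix * (α * (K * M.CA)) ≤ K := by
      calc tmix * (α * (K * M.CA)) = K * (α * tmix * M.CA) := by ring
        _ ≤ K * 1 := by
            gcongr
            have : 0 ≤ α * tmix := by positivity
            linarith
        _ = K := mul_one K
    unfold costWeightNe
    linarith
  · rw [← Real.exp_nat_mul]
    have h1 := Real.add_one_le_exp (tmix * (-(α * M.a) / 12))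
    have e : tmix * (-(α * M.a) / 12) = -(α * tmix * M.a) / 12 := by ring
    rw [e] at h1 ⊢
    linarith

theorem one_le_costWeight {κ a c : ℝ} (ha : 0 < a) (hc : 0 ≤ c) : 1 ≤ costWeight κ a c := by
  have : 0 ≤ 4 * (Real.sqrt κ * c) / a := by positivity
  unfold costWeight; linarith

theorem costWeight_le_costWeightNe {κ a c : ℝ} : costWeight κ a c ≤ costWeightNe κ a c := by
  have := Real.sqrt_nonneg κ
  unfold costWeightNe; linarith

theorem costY_le_blockCost {N : Seminorm ℝ (Vec d)} (hN1 : ∀ x, ‖x‖ ≤ N x) {α w B s : ℝ}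
    (hw : 1 ≤ w) (hB : 1 ≤ B) (hs : Real.sqrt (α * M.a) * M.noiseSup ≤ s)
    (p : StateY d Zs × StateY d Zs) : M.costY α p.1 p.2 ≤ blockCost N w B s p := by
  have hNn : ∀ x, 0 ≤ N x := fun x => apply_nonneg N x
  have d0 := hN1 (p.1.2.1 - p.2.2.1)
  have d1 := hN1 (p.1.2.2 - p.2.2.2)
  have d0' : N (p.1.2.1 - p.2.2.1) ≤ w * N (p.1.2.1 - p.2.2.1) :=
    le_mul_of_one_le_left (hNn _) hw
  rw [costY, blockCost, syncCost]
  split_ifs with hp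
  · linarith
  · have u0 := hN1 p.1.2.1
    have u1 := hN1 p.2.2.1
    have u2 := hN1 p.1.2.2
    have u3 := hN1 p.2.2.2
    have hU : N p.1.2.1 + N p.2.2.1 ≤ B * (N p.1.2.1 + N p.2.2.1) :=
      le_mul_of_one_le_left (add_nonneg (hNn _) (hNn _)) hB
    have := hNn p.1.2.1
    have := hNn p.2.2.1
    have := hNn p.1.2.2
    have := hNn p.2.2.2
    have hs0 : 0 ≤ Real.sqrt (α * M.a) * M.noiseSup :=
      mul_nonneg (Real.sqrt_nonneg _) M.noiseSup_nonneg
    linarith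

theorem blockCost_le_costY {N : Seminorm ℝ (Vec d)} {K : ℝ} (hN2 : ∀ x, N x ≤ K * ‖x‖) {α w B s D : ℝ}
    (hw0 : 0 ≤ w) (hB : 0 ≤ B)
    (hw : w * K ≤ D) (hK1 : 1 * K ≤ D) (hK : 4 * K ≤ D) (hB' : 4 * (B * K) ≤ D)
    (hs : 4 * s ≤ D * (Real.sqrt (α * M.a) * M.noiseSup))
    (p : StateY d Zs × StateY d Zs) : blockCost N w B s p ≤ D * M.costY α p.1 p.2 := by
  have key : ∀ (c : ℝ) x, 0 ≤ c → c * K ≤ D → c * N x ≤ D * ‖x‖ := fun c x hc h => by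
    calc c * N x ≤ c * (K * ‖x‖) := by gcongr; exact hN2 x
      _ = c * K * ‖x‖ := by ring
      _ ≤ _ := by gcongr
  have d0 := key w (p.1.2.1 - p.2.2.1) hw0 hw
  have d1 := key 1 (p.1.2.2 - p.2.2.2) zero_le_one hK1
  rw [costY, blockCost, syncCost]
  split_ifs with hp
  · linarith
  · have u0 := key (4 * B) p.1.2.1 (by positivity) (by linarith)
    have u1 := key (4 * B) p.2.2.1 (by positivity) (by linarith)
    have u2 := key 4 p.1.2.2 (by norm_num) hK
    have u3 := key 4 p.2.2.2 (by norm_num) hK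
    linarith

theorem mul_le_sqrt_mul_sqrt {x y : ℝ} (hx0 : 0 ≤ x) (hx : x ≤ 1) (hy : x ≤ y) :
    x ≤ Real.sqrt y := by
  apply Real.le_sqrt_of_sq_le
  nlinarith

/-- Since α tmix ≤ 1, it is at most its square root, √(αa) √tmix √(1/a). This converts the
accumulated noise of a block, of order α tmix‖ε‖_∞, into the offset √(αa)‖ε‖_∞ of the cost, and
explains the factor √(1/a) in `costRatio`. -/
theorem four_mul_offset_le [NeZero d] {tmix : ℕ} (hA : M.AssumptionA)
    (ht : 1 ≤ tmix) {α : ℝ} (h0 : 0 < α) (hα : α < M.alphaB tmix) :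
    4 * (Real.sqrt (α * M.a) * M.noiseSup + 4 * costWeightNe M.kappa M.a M.CA *
      (tmix * (α * (Real.sqrt M.kappa * M.noiseSup)))) ≤
    costRatio M.kappa M.a M.CA * (tmix : ℝ) ^ (3 / 2 : ℝ) *
      (Real.sqrt (α * M.a) * M.noiseSup) := by
  have ha := M.a_pos hA
  obtain ⟨-, b2, -⟩ := M.alpha_bounds ht h0 hα ha
  have hCA := M.CA_nonneg
  have hnS := M.noiseSup_nonneg
  have ht' : (1 : ℝ) ≤ tmix := by exact_mod_cast ht
  have hK : 1 ≤ Real.sqrt M.kappa := Real.one_le_sqrt.mpr (M.one_le_kappa hA)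
  have hw := one_le_costWeight (κ := M.kappa) ha hCA
  have hB : 1 ≤ costWeightNe M.kappa M.a M.CA := hw.trans costWeight_le_costWeightNe
  have hBK : 1 ≤ costWeightNe M.kappa M.a M.CA * Real.sqrt M.kappa := by nlinarith
  unfold costRatio
  set F := costWeightNe M.kappa M.a M.CA * Real.sqrt M.kappa
  have hT1 : 1 ≤ (tmix : ℝ) ^ (3 / 2 : ℝ) := Real.one_le_rpow ht' (by norm_num)
  have hT2 : Real.sqrt tmix ≤ (tmix : ℝ) ^ (3 / 2 : ℝ) := by
    rw [Real.sqrt_eq_rpow]; exact Real.rpow_le_rpow_of_exponent_le ht' (by norm_num)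
  set T := (tmix : ℝ) ^ (3 / 2 : ℝ)
  have hq : Real.sqrt (α * tmix) = Real.sqrt (α * M.a) * Real.sqrt tmix * Real.sqrt (1 / M.a) := by
    rw [← Real.sqrt_mul (by positivity), ← Real.sqrt_mul (by positivity)]
    congr 1; field_simp
  have hαt : α * tmix ≤ Real.sqrt (α * M.a) * T * Real.sqrt (1 / M.a) := by
    have h1 : α * tmix ≤ 1 := by
      have : 0 ≤ α * tmix * M.CA := by positivity
      linarith
    refine (mul_le_sqrt_mul_sqrt (by positivity) h1 le_rfl).trans ?_
    rw [hq]; gcongr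
  have hσ := Real.sqrt_nonneg (α * M.a)
  set σ := Real.sqrt (α * M.a)
  have e1 : 4 * costWeightNe M.kappa M.a M.CA * (tmix * (α * (Real.sqrt M.kappa * M.noiseSup)))
      = 4 * F * (α * tmix) * M.noiseSup := by simp only [F]; ring
  rw [e1]
  calc 4 * (σ * M.noiseSup + 4 * F * (α * tmix) * M.noiseSup)
      ≤ 4 * (T * (σ * M.noiseSup) + 4 * F * (σ * T * Real.sqrt (1 / M.a)) * M.noiseSup) := by
        refine mul_le_mul_of_nonneg_left (add_le_add ?_ ?_) (by norm_num)
        · exact le_mul_of_one_le_left (by positivity) hT1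
        · gcongr
    _ = 4 * 1 * (1 + 4 * F * Real.sqrt (1 / M.a)) * T * (σ * M.noiseSup) := by ring
    _ ≤ _ := by gcongr

theorem half_le_sqrt_log {x : ℝ} (h0 : 0 < x) (h1 : x ≤ 1 / 2) :
    1 / 2 ≤ Real.sqrt (Real.log (1 / x)) := by
  have h2 : Real.log 2 ≤ Real.log (1 / x) :=
    Real.log_le_log (by norm_num) (by rw [le_div_iff₀ h0]; linarith)
  apply Real.le_sqrt_of_sq_le
  linarith [Real.log_two_gt_d9]

/-! ### The Wasserstein bounds for the two chains. -/

theorem wasserstein_le_of_couples {X : Type*} [MeasurableSpace X] {G : Kernel (X × X) (X × X)}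
    {K : Kernel X X} (hG : Couples G K) {c : X → X → ℝ} {C : ℝ≥0∞} {x y : X}
    (h : ∫⁻ q, ENNReal.ofReal (c q.1 q.2) ∂G (x, y) ≤ C) : wasserstein c (K x) (K y) ≤ C :=
  (iInf₂_le (G (x, y)) ⟨hG.fst (x, y), hG.snd (x, y)⟩).trans h

theorem wasserstein_kernelY_le [NeZero d] [StandardBorelSpace Zs] {tmix : ℕ} (hA : M.AssumptionA)
    (hN : M.AssumptionNoise) (hQ : UniformlyErgodic M.Q tmix) {α : ℝ} (h0 : 0 < α)
    (hα : α < M.alphaB tmix) (n : ℕ) (y y' : StateY d Zs) :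
    wasserstein (M.costY α) ((M.kernelY α ^ n) y) ((M.kernelY α ^ n) y') ≤
      ENNReal.ofReal (8 * costRatio M.kappa M.a M.CA * M.rate tmix α n * M.costY α y y') := by
  have ha := M.a_pos hA
  have hCA := M.CA_nonneg
  have hnS := M.noiseSup_nonneg
  obtain ⟨-, -, b3⟩ := M.alpha_bounds hQ.1 h0 hα ha
  have ht' : (1 : ℝ) ≤ tmix := by exact_mod_cast hQ.1
  obtain ⟨N, hN1, hN2, hC⟩ := M.exists_blockConstants hA hN hQ.1 h0 hα
  have hoff := M.four_mul_offset_le hA hQ.1 h0 hα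
  have hK : 1 ≤ Real.sqrt M.kappa := Real.one_le_sqrt.mpr (M.one_le_kappa hA)
  have hw := one_le_costWeight (κ := M.kappa) ha hCA
  have hwB := costWeight_le_costWeightNe (κ := M.kappa) (a := M.a) (c := M.CA)
  have hB := hw.trans hwB
  have hT1 : 1 ≤ (tmix : ℝ) ^ (3 / 2 : ℝ) := Real.one_le_rpow ht' (by norm_num)
  have hoff0 : 0 ≤ 4 * costWeightNe M.kappa M.a M.CA *
      (tmix * (α * (Real.sqrt M.kappa * M.noiseSup))) := by positivity
  -- The first summand makes the block cost dominate the cost of the theorem; the second is the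
  -- lower bound required of s.
  set s := Real.sqrt (α * M.a) * M.noiseSup + 4 * costWeightNe M.kappa M.a M.CA *
      (tmix * (α * (Real.sqrt M.kappa * M.noiseSup)))
  have hs1 : Real.sqrt (α * M.a) * M.noiseSup ≤ s := le_add_of_nonneg_right hoff0
  have hs2 : 4 * costWeightNe M.kappa M.a M.CA *
      (tmix * (α * (Real.sqrt M.kappa * M.noiseSup))) ≤ s :=
    le_add_of_nonneg_left (by positivity)
  have h := hC s hs2
  obtain ⟨G, hG, hGc, hGi⟩ := h.exists_coupling_pow hQ n
  refine wasserstein_le_of_couples hGc ?_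
  have hR : 4 * (costWeightNe M.kappa M.a M.CA * Real.sqrt M.kappa) ≤
      costRatio M.kappa M.a M.CA := by
    have : 0 ≤ 4 * (costWeightNe M.kappa M.a M.CA * Real.sqrt M.kappa) * Real.sqrt (1 / M.a) := by
      positivity
    unfold costRatio
    exact le_mul_of_one_le_right (by positivity) (by linarith)
  have hRT : costRatio M.kappa M.a M.CA ≤
      costRatio M.kappa M.a M.CA * (tmix : ℝ) ^ (3 / 2 : ℝ) :=
    le_mul_of_one_le_right (le_trans (by positivity) hR) hT1
  have hcomp := M.blockCost_le_costY (α := α) hN2 (zero_le_one.trans hw) (zero_le_one.trans hB)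
    (D := costRatio M.kappa M.a M.CA * (tmix : ℝ) ^ (3 / 2 : ℝ))
    (le_trans (by nlinarith) (hR.trans hRT)) (le_trans (by nlinarith) (hR.trans hRT))
    (le_trans (by nlinarith) (hR.trans hRT))
    (hR.trans hRT) hoff (y, y')
  have hcost : 0 ≤ M.costY α y y' := by
    rw [costY]; split_ifs <;> positivity
  calc ∫⁻ q, ENNReal.ofReal (M.costY α q.1 q.2) ∂G (y, y')
      ≤ ∫⁻ q, ENNReal.ofReal (blockCost N (costWeight M.kappa M.a M.CA)
          (costWeightNe M.kappa M.a M.CA) s q) ∂G (y, y') :=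
        lintegral_mono fun q => ENNReal.ofReal_le_ofReal
          (M.costY_le_blockCost hN1 hw hB hs1 q)
    _ ≤ _ := hGi (y, y')
    _ ≤ _ := by
        refine ENNReal.ofReal_le_ofReal ?_
        -- The logarithmic factor only has to be bounded below: αa ≤ αa tmix ≤ 1/2.
        have hlog := half_le_sqrt_log (x := α * M.a) (by positivity)
          (le_trans (by rw [mul_right_comm]; exact le_mul_of_one_le_right (by positivity) ht') b3)
        have he : Real.exp (-(α * M.a) / 12) ^ n = Real.exp (-(α * M.a * n) / 12) := by
          rw [← Real.exp_nat_mul]; congr 1; ring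
        rw [he, rate]
        have hR0 : 0 ≤ costRatio M.kappa M.a M.CA := le_trans (by positivity) hR
        have hT0 : 0 ≤ (tmix : ℝ) ^ (3 / 2 : ℝ) := zero_le_one.trans hT1
        set T := (tmix : ℝ) ^ (3 / 2 : ℝ)
        set E := Real.exp (-(α * M.a * n) / 12)
        have hE : 0 ≤ E := (Real.exp_pos _).le
        calc 4 * E * _ ≤ 4 * E * (costRatio M.kappa M.a M.CA * T * M.costY α y y') := by
              gcongr
          _ = 8 * costRatio M.kappa M.a M.CA * (T * E * (1 / 2)) * M.costY α y y' := by ring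
          _ ≤ _ := by gcongr

theorem costV_projV_le (α : ℝ) (y y' : StateY d Zs) :
    M.costV α (projV y) (projV y') ≤ M.costY α y y' := by
  have hnS := M.noiseSup_nonneg
  have h1 := norm_nonneg (y.2.2 - y'.2.2)
  have h2 := norm_nonneg y.2.2
  have h3 := norm_nonneg y'.2.2
  by_cases hz : y.1 = y'.1
  · simp only [costV, costY, projV, hz, if_true]; linarith
  · simp only [costV, costY, projV, hz, if_false]; linarith

theorem wasserstein_map_le {X Y : Type*} [MeasurableSpace X] [MeasurableSpace Y] {φ : X → Y}
    (hφ : Measurable φ) {c : X → X → ℝ} {c' : Y → Y → ℝ}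
    (hc' : Measurable fun p : Y × Y => c' p.1 p.2) (h : ∀ x x', c' (φ x) (φ x') ≤ c x x')
    (μ ν : Measure X) : wasserstein c' (μ.map φ) (ν.map φ) ≤ wasserstein c μ ν := by
  refine le_iInf₂ fun Γ hΓ => ?_
  have hφ2 : Measurable (Prod.map φ φ) := hφ.prodMap hφ
  have h1 : (Γ.map (Prod.map φ φ)).map Prod.fst = μ.map φ := by
    rw [← hΓ.1, Measure.map_map measurable_fst hφ2, Measure.map_map hφ measurable_fst]; rfl
  have h2 : (Γ.map (Prod.map φ φ)).map Prod.snd = ν.map φ := by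
    rw [← hΓ.2, Measure.map_map measurable_snd hφ2, Measure.map_map hφ measurable_snd]; rfl
  refine (iInf₂_le (Γ.map (Prod.map φ φ)) ⟨h1, h2⟩).trans ?_
  rw [lintegral_map hc'.ennreal_ofReal hφ2]
  exact lintegral_mono fun p => ENNReal.ofReal_le_ofReal (h _ _)

theorem measurable_costV [MeasurableEq Zs] (α : ℝ) :
    Measurable fun p : (Vec d × Zs) × (Vec d × Zs) => M.costV α p.1 p.2 := by
  have hd : MeasurableSet {p : (Vec d × Zs) × (Vec d × Zs) | p.1.2 = p.2.2} :=
    (measurable_snd.comp measurable_fst).prodMk (measurable_snd.comp measurable_snd)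
      measurableSet_diagonal
  unfold costV
  refine Measurable.add (by fun_prop) (Measurable.mul (by fun_prop) ?_)
  exact Measurable.ite hd measurable_const measurable_const

/-- Lift both points with j₁ = 0: the lifted cost equals `costV`, and projecting a coupling of the
Y-laws can only lower the cost. -/
theorem wasserstein_kernelV_le [NeZero d] [StandardBorelSpace Zs] {tmix : ℕ} (hA : M.AssumptionA)
    (hN : M.AssumptionNoise) (hQ : UniformlyErgodic M.Q tmix) {α : ℝ} (h0 : 0 < α)
    (hα : α < M.alphaB tmix) (n : ℕ) (v v' : Vec d × Zs) :
    wasserstein (M.costV α) ((M.kernelV α ^ n) v) ((M.kernelV α ^ n) v') ≤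
      ENNReal.ofReal (8 * costRatio M.kappa M.a M.CA * M.rate tmix α n * M.costV α v v') := by
  have e : ∀ v : Vec d × Zs,
      ((M.kernelY α ^ n) (v.2, v.1, 0)).map projV = (M.kernelV α ^ n) v := fun v =>
    map_pow_apply_of_semiconj measurable_projV (M.kernelY_map_projV α) n _
  rw [← e, ← e]
  refine (wasserstein_map_le measurable_projV (M.measurable_costV α) (M.costV_projV_le α) _ _).trans
    ((M.wasserstein_kernelY_le hA hN hQ h0 hα n _ _).trans (le_of_eq ?_))
  congr 2
  simp [costY, costV]

end Model

/-! ### The Markov property of Y and V. -/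

section MarkovChain

variable {Ω S T : Type*} {m m' : MeasurableSpace Ω} [mΩ : MeasurableSpace Ω] [MeasurableSpace S] [MeasurableSpace T]
  {P : Measure Ω} [IsProbabilityMeasure P]

/-- A conditional law given m becomes an identity of joint laws on every m-measurable event. It
suffices to check it on rectangles, where it is the defining property of the conditional
expectation. -/
theorem restrict_map_prodMk_eq_compProd (hm : m ≤ mΩ) {Q : Kernel S T}
    [IsMarkovKernel Q] {ξ : Ω → S} {ζ : Ω → T} (hξ : Measurable[m] ξ) (hζ : Measurable ζ)
    (h : ∀ B, MeasurableSet B → P[(ζ ⁻¹' B).indicator (fun _ => (1 : ℝ)) | m]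
      =ᵐ[P] fun ω => (Q (ξ ω)).real B) {A : Set Ω} (hA : MeasurableSet[m] A) :
    (P.restrict A).map (fun ω => (ξ ω, ζ ω)) = ((P.restrict A).map ξ) ⊗ₘ Q := by
  have hξ' : Measurable ξ := hξ.mono hm le_rfl
  have hpair : Measurable fun ω => (ξ ω, ζ ω) := hξ'.prodMk hζ
  refine Measure.ext_prod fun {C D} hC hD => ?_
  have hAC : MeasurableSet[m] (A ∩ ξ ⁻¹' C) := hA.inter (hξ hC)
  have hAC' : MeasurableSet (A ∩ ξ ⁻¹' C) := hm _ hAC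
  rw [Measure.map_apply hpair (hC.prod hD), Measure.compProd_apply_prod hC hD,
    setLIntegral_map hC (Kernel.measurable_coe Q hD) hξ',
    Measure.restrict_restrict (hξ' hC), Measure.restrict_apply (hpair (hC.prod hD))]
  have e : (fun ω => (ξ ω, ζ ω)) ⁻¹' C ×ˢ D ∩ A = (ζ ⁻¹' D) ∩ (A ∩ ξ ⁻¹' C) := by
    ext ω; simp only [Set.mem_inter_iff, Set.mem_preimage, Set.mem_prod]; tauto
  rw [e, Set.inter_comm _ A]
  have h1 : ∫ ω in A ∩ ξ ⁻¹' C, (ζ ⁻¹' D).indicator (fun _ => (1 : ℝ)) ω ∂P =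
      ∫ ω in A ∩ ξ ⁻¹' C, (Q (ξ ω)).real D ∂P := by
    rw [← setIntegral_condExp hm ((integrable_const (1 : ℝ)).indicator (hζ hD)) hAC]
    exact setIntegral_congr_ae hAC' ((h D hD).mono fun ω hω _ => hω)
  rw [integral_indicator_const _ (hζ hD), smul_eq_mul, mul_one] at h1
  have h2 : ∫ ω in A ∩ ξ ⁻¹' C, (Q (ξ ω)).real D ∂P =
      (∫⁻ ω in A ∩ ξ ⁻¹' C, Q (ξ ω) D ∂P).toReal := by
    refine integral_toReal ((Kernel.measurable_coe Q hD).comp hξ').aemeasurable ?_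
    exact Filter.Eventually.of_forall fun ω => measure_lt_top _ _
  rw [h2, measureReal_def, Measure.restrict_apply (hζ hD)] at h1
  refine (ENNReal.toReal_eq_toReal_iff' (measure_ne_top _ _) ?_).mp h1
  refine ne_top_of_le_ne_top (measure_ne_top P (A ∩ ξ ⁻¹' C)) ?_
  calc _ ≤ ∫⁻ _ in A ∩ ξ ⁻¹' C, 1 ∂P := lintegral_mono fun ω => prob_le_one
    _ = _ := by simp

/-- Conditional laws are transported along measurable updates and to coarser σ-algebras. -/
theorem condExp_indicator_update {U : Type*} [MeasurableSpace U]
    (hm : m ≤ mΩ) (hm' : m' ≤ m) {Q : Kernel S T} [IsMarkovKernel Q] {κ : Kernel S U}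
    [IsMarkovKernel κ] {f : S × T → U} (hf : Measurable f)
    (hκ : ∀ x, κ x = (Q x).map fun t => f (x, t)) {ξ : Ω → S} {ζ : Ω → T}
    (hξ : Measurable[m'] ξ) (hζ : Measurable ζ)
    (h : ∀ B, MeasurableSet B → P[(ζ ⁻¹' B).indicator (fun _ => (1 : ℝ)) | m]
      =ᵐ[P] fun ω => (Q (ξ ω)).real B) {B : Set U} (hB : MeasurableSet B) :
    P[((fun ω => f (ξ ω, ζ ω)) ⁻¹' B).indicator (fun _ => (1 : ℝ)) | m']
      =ᵐ[P] fun ω => (κ (ξ ω)).real B := by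
  have hξ' : Measurable ξ := hξ.mono (hm'.trans hm) le_rfl
  have hpair : Measurable fun ω => (ξ ω, ζ ω) := hξ'.prodMk hζ
  have hBm := (hf.comp hpair) hB
  have hmeas : Measurable[m'] fun ω => (κ (ξ ω)).real B :=
    (Kernel.measurable_coe κ hB).ennreal_toReal.comp hξ
  have hint : Integrable (fun ω => (κ (ξ ω)).real B) P := by
    refine Integrable.of_bound (hmeas.mono (hm'.trans hm) le_rfl).aestronglyMeasurable 1 ?_
    exact Filter.Eventually.of_forall fun ω => by
      rw [Real.norm_of_nonneg measureReal_nonneg]; exact measureReal_le_one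
  refine (ae_eq_condExp_of_forall_setIntegral_eq (hm'.trans hm)
    ((integrable_const (1 : ℝ)).indicator hBm) (fun _ _ _ => hint.integrableOn) (fun A hA _ => ?_)
    hmeas.stronglyMeasurable.aestronglyMeasurable).symm
  rw [integral_indicator_const _ hBm, smul_eq_mul, mul_one]
  have h2 : ∫ ω in A, (κ (ξ ω)).real B ∂P = (∫⁻ ω in A, κ (ξ ω) B ∂P).toReal := by
    refine integral_toReal ((Kernel.measurable_coe κ hB).comp hξ').aemeasurable ?_
    exact Filter.Eventually.of_forall fun ω => measure_lt_top _ _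
  rw [h2, measureReal_def]
  congr 1
  have h3 := congrArg (fun μ : Measure (S × T) => μ (f ⁻¹' B))
    (restrict_map_prodMk_eq_compProd hm (hξ.mono hm' le_rfl) hζ h (hm' A hA))
  rw [Measure.map_apply hpair (hf hB), Measure.compProd_apply (hf hB),
    lintegral_map (Kernel.measurable_kernel_prodMk_left (hf hB)) hξ'] at h3
  refine Eq.trans ?_ (h3.symm.trans ?_)
  · refine lintegral_congr fun ω => ?_
    rw [hκ, Measure.map_apply (by fun_prop) hB]
    rfl
  · rfl

end MarkovChain

theorem pastSigma_le {Ω S : Type*} [mΩ : MeasurableSpace Ω] [MeasurableSpace S] {X : ℕ → Ω → S}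
    (hX : ∀ n, Measurable (X n)) (n : ℕ) : pastSigma X n ≤ mΩ :=
  iSup₂_le fun k _ => (hX k).comap_le

theorem measurable_pastSigma {Ω S : Type*} [MeasurableSpace S] (X : ℕ → Ω → S)
    {k n : ℕ} (hk : k ≤ n) : Measurable[pastSigma X n] (X k) :=
  Measurable.of_comap_le (le_iSup₂ (f := fun k (_ : k ≤ n) =>
    MeasurableSpace.comap (X k) inferInstance) k hk)

namespace Model

variable {d : ℕ} {Zs : Type*} [MeasurableSpace Zs] (M : Model d Zs)

theorem measurable_J0_J1 {Ω : Type*} {Z : ℕ → Ω → Zs} (α : ℝ) (j₀ j₁ : Vec d) (n : ℕ) :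
    Measurable[pastSigma Z n] (fun ω => M.J0 α (fun k => Z k ω) j₀ n) ∧
      Measurable[pastSigma Z n] (fun ω => M.J1 α (fun k => Z k ω) j₀ j₁ n) := by
  induction n with
  | zero => exact ⟨measurable_const, measurable_const⟩
  | succ n ih =>
    have hmono : pastSigma Z n ≤ pastSigma Z (n + 1) :=
      iSup₂_le fun k hk => le_iSup₂ (f := fun k (_ : k ≤ n + 1) =>
        MeasurableSpace.comap (Z k) inferInstance) k (hk.trans n.le_succ)
    have hZ := measurable_pastSigma Z (le_refl (n + 1))
    have h0 := ih.1.mono hmono le_rfl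
    have h1 := ih.2.mono hmono le_rfl
    let _ := pastSigma Z (n + 1)
    exact ⟨M.measurable_step0_comp α hZ h0, M.measurable_step1_comp α hZ h0 h1⟩

theorem isMarkovChain_Y {Ω : Type*} [mΩ : MeasurableSpace Ω] {P : Measure Ω}
    [IsProbabilityMeasure P] {Z : ℕ → Ω → Zs} (hZ : IsMarkovChain P M.Q Z) (α : ℝ)
    (j₀ j₁ : Vec d) : IsMarkovChain P (M.kernelY α) (M.Y α Z j₀ j₁) := by
  have hpast : ∀ k n, k ≤ n → Measurable[pastSigma Z (n + 1)] (M.Y α Z j₀ j₁ k) := by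
    intro k n hkn
    have hmono : pastSigma Z k ≤ pastSigma Z (n + 1) :=
      iSup₂_le fun i hi => le_iSup₂ (f := fun k (_ : k ≤ n + 1) =>
        MeasurableSpace.comap (Z k) inferInstance) i (by omega)
    have h := M.measurable_J0_J1 (Z := Z) α j₀ j₁ k
    have h0 := h.1.mono hmono le_rfl
    have h1 := h.2.mono hmono le_rfl
    have hZk := measurable_pastSigma Z (show k + 1 ≤ n + 1 by omega)
    let _ := pastSigma Z (n + 1)
    exact hZk.prodMk (h0.prodMk h1)
  have hY : ∀ n, Measurable (M.Y α Z j₀ j₁ n) := fun n =>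
    (hpast n n le_rfl).mono (pastSigma_le hZ.1 _) le_rfl
  refine ⟨hY, fun n B hB => ?_⟩
  -- Y at time n + 1 is a function of Y at time n and of Z at time n + 2. The past of Y up to n is
  -- contained in the past of Z up to n + 1, where the Markov property of Z applies.
  refine condExp_indicator_update (Q := M.Q.comap Prod.fst measurable_fst)
    (f := fun p : StateY d Zs × Zs => (p.2, M.steps α p.1.1 p.1.2)) (ζ := Z (n + 2))
    (m := pastSigma Z (n + 1)) (pastSigma_le hZ.1 _)
    (iSup₂_le fun k hk => (hpast k n hk).comap_le) ?_ (fun y => M.kernelY_apply α y)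
    (measurable_pastSigma _ le_rfl) (hZ.1 _) (fun B hB => hZ.2 (n + 1) B hB) hB
  exact measurable_snd.prodMk (M.measurable_steps_comp α (by fun_prop) (by fun_prop))

theorem isMarkovChain_V {Ω : Type*} [mΩ : MeasurableSpace Ω] {P : Measure Ω}
    [IsProbabilityMeasure P] {Z : ℕ → Ω → Zs} (hZ : IsMarkovChain P M.Q Z) (α : ℝ)
    (j₀ : Vec d) : IsMarkovChain P (M.kernelV α) (M.V α Z j₀) := by
  have hpast : ∀ k n, k ≤ n → Measurable[pastSigma Z (n + 1)] (M.V α Z j₀ k) := by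
    intro k n hkn
    have hmono : pastSigma Z k ≤ pastSigma Z (n + 1) :=
      iSup₂_le fun i hi => le_iSup₂ (f := fun k (_ : k ≤ n + 1) =>
        MeasurableSpace.comap (Z k) inferInstance) i (by omega)
    have h0 := (M.measurable_J0_J1 (Z := Z) α j₀ 0 k).1.mono hmono le_rfl
    have hZk := measurable_pastSigma Z (show k + 1 ≤ n + 1 by omega)
    let _ := pastSigma Z (n + 1)
    exact h0.prodMk hZk
  have hV : ∀ n, Measurable (M.V α Z j₀ n) := fun n =>
    (hpast n n le_rfl).mono (pastSigma_le hZ.1 _) le_rfl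
  refine ⟨hV, fun n B hB => ?_⟩
  refine condExp_indicator_update (Q := M.Q.comap Prod.snd measurable_snd)
    (f := fun p : (Vec d × Zs) × Zs => (M.step0 α p.1.2 p.1.1, p.2)) (ζ := Z (n + 2))
    (m := pastSigma Z (n + 1)) (pastSigma_le hZ.1 _)
    (iSup₂_le fun k hk => (hpast k n hk).comap_le) ?_ (fun y => M.kernelV_apply α y)
    (measurable_pastSigma _ le_rfl) (hZ.1 _) (fun B hB => hZ.2 (n + 1) B hB) hB
  exact (M.measurable_step0_comp α (by fun_prop) (by fun_prop)).prodMk measurable_snd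

end Model

/-! ### Test functions that determine a measure on the product. -/

section Separation

open Filter Topology
open scoped NNReal

/-- Product test functions: the indicator of a set times a Lipschitz function. -/
def prodTest {Z E : Type*} (B : Set Z) (g : E → ℝ) (x : Z × E) : ℝ :=
  B.indicator (fun _ => (1 : ℝ)) x.1 * g x.2

variable {Z E : Type*} [MeasurableSpace Z] [PseudoMetricSpace E] [MeasurableSpace E] [BorelSpace E]

theorem measurable_prodTest {B : Set Z} (hB : MeasurableSet B) {g : E → ℝ} (hg : Continuous g) :
    Measurable (prodTest B g) :=
  ((measurable_const.indicator hB).comp measurable_fst).mul (hg.measurable.comp measurable_snd)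

theorem abs_prodTest_le {Z E : Type*} (B : Set Z) {g : E → ℝ} (h0 : ∀ x, 0 ≤ g x)
    (h1 : ∀ x, g x ≤ 1) (x : Z × E) : |prodTest B g x| ≤ 1 := by
  by_cases hx : x.1 ∈ B <;> simp [prodTest, hx, abs_of_nonneg (h0 _), h1]

theorem integral_prodTest {B : Set Z} (hB : MeasurableSet B) {g : E → ℝ} (hg : Continuous g)
    (μ : Measure (Z × E)) :
    ∫ x, prodTest B g x ∂μ = ∫ y, g y ∂(μ.restrict (Prod.fst ⁻¹' B)).map Prod.snd := by
  rw [integral_map measurable_snd.aemeasurable hg.aestronglyMeasurable,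
    ← integral_indicator (measurable_fst hB)]
  refine integral_congr_ae (Eventually.of_forall fun x => ?_)
  by_cases hx : x.1 ∈ B <;> simp [prodTest, hx]

/-- Thickened indicators are Lipschitz and converge to the indicator of a closed set, so the two
measures agree on products of a set of C with a closed set; these form a generating π-system. -/
theorem ext_of_integral_prodTest {C : Set (Set Z)} (hC : IsPiSystem C)
    (hgen : MeasurableSpace.generateFrom C = ‹MeasurableSpace Z›) (huniv : Set.univ ∈ C)
    {μ ν : Measure (Z × E)} [IsFiniteMeasure μ] [IsFiniteMeasure ν]
    (h : ∀ B ∈ C, ∀ (g : E → ℝ) (K : ℝ≥0), LipschitzWith K g → (∀ x, 0 ≤ g x) →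
      (∀ x, g x ≤ 1) → ∫ x, prodTest B g x ∂μ = ∫ x, prodTest B g x ∂ν) : μ = ν := by
  have hCm : ∀ B ∈ C, MeasurableSet B := fun B hB => by
    rw [← hgen]; exact MeasurableSpace.measurableSet_generateFrom hB
  have key : ∀ B ∈ C, ∀ F : Set E, IsClosed F → μ (B ×ˢ F) = ν (B ×ˢ F) := by
    intro B hB F hF
    have e : ∀ ρ : Measure (Z × E), IsFiniteMeasure ρ →
        ((ρ.restrict (Prod.fst ⁻¹' B)).map Prod.snd) F = ρ (B ×ˢ F) := fun ρ _ => by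
      rw [Measure.map_apply measurable_snd hF.measurableSet,
        Measure.restrict_apply (measurable_snd hF.measurableSet), Set.inter_comm, ← Set.prod_eq]
    have hδ : ∀ n : ℕ, (0 : ℝ) < 1 / ((n : ℝ) + 1) := fun n => by positivity
    have l1 := tendsto_integral_thickenedIndicator_of_isClosed
      ((μ.restrict (Prod.fst ⁻¹' B)).map Prod.snd) hF hδ tendsto_one_div_add_atTop_nhds_zero_nat
    have l2 := tendsto_integral_thickenedIndicator_of_isClosed
      ((ν.restrict (Prod.fst ⁻¹' B)).map Prod.snd) hF hδ tendsto_one_div_add_atTop_nhds_zero_nat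
    have l3 := tendsto_nhds_unique l1 (l2.congr fun n => by
      have hg := lipschitzWith_thickenedIndicator (hδ n) F
      have hg' : LipschitzWith (1 / ((n : ℝ) + 1)).toNNReal⁻¹
          fun x => (thickenedIndicator (hδ n) F x : ℝ) := fun x y => hg x y
      have := h B hB _ _ hg' (fun x => NNReal.coe_nonneg _) fun x => by
        exact_mod_cast thickenedIndicator_le_one (hδ n) F x
      rw [integral_prodTest (hCm B hB) hg'.continuous,
        integral_prodTest (hCm B hB) hg'.continuous] at this
      exact this.symm)
    rw [measureReal_def, measureReal_def, e μ inferInstance, e ν inferInstance] at l3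
    exact (ENNReal.toReal_eq_toReal_iff' (measure_ne_top _ _) (measure_ne_top _ _)).1 l3
  have hcl : MeasurableSpace.generateFrom {F : Set E | IsClosed F} = ‹MeasurableSpace E› := by
    rw [BorelSpace.measurable_eq (α := E), borel_eq_generateFrom_isClosed]
  refine ext_of_generate_finite _
    (generateFrom_eq_prod hgen hcl ⟨fun _ => Set.univ, fun _ => huniv, Set.iUnion_const _⟩
      ⟨fun _ => Set.univ, fun _ => isClosed_univ, Set.iUnion_const _⟩).symm
    (hC.prod isPiSystem_isClosed) ?_ ?_
  · rintro _ ⟨B, hB, F, hF, rfl⟩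
    exact key B hB F hF
  · rw [← Set.univ_prod_univ]
    exact key _ huniv _ isClosed_univ

/-- Pull back the rational half-lines along a Borel embedding into ℝ. Countability is what later
allows all these indicators to be made continuous at once. -/
theorem exists_countable_piSystem (Z : Type*) [MeasurableSpace Z] [StandardBorelSpace Z] :
    ∃ C : Set (Set Z), C.Countable ∧ IsPiSystem C ∧
      MeasurableSpace.generateFrom C = ‹MeasurableSpace Z› ∧ Set.univ ∈ C := by
  obtain ⟨e, he⟩ := exists_measurableEmbedding_real Z
  refine ⟨insert Set.univ (Set.preimage e '' (⋃ a : ℚ, {Set.Iic (a : ℝ)})), ?_, ?_, ?_, ?_⟩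
  · exact ((Set.countable_iUnion fun _ => Set.countable_singleton _).image _).insert _
  · refine IsPiSystem.insert_univ ?_
    exact Real.isPiSystem_Iic_rat.comap e
  · rw [MeasurableSpace.generateFrom_insert_univ]
    rw [← MeasurableSpace.comap_generateFrom, ← Real.borel_eq_generateFrom_Iic_rat,
      ← BorelSpace.measurable_eq (α := ℝ)]
    exact he.comap_eq
  · exact Set.mem_insert _ _

end Separation

/-! ### Forgetting of the initial law. -/

section Mixing

open Filter Topology

variable {X : Type*} [MeasurableSpace X]

theorem integrable_of_abs_le_one {f : X → ℝ} (hf : Measurable f) (h1 : ∀ x, |f x| ≤ 1)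
    (μ : Measure X) [IsFiniteMeasure μ] : Integrable f μ :=
  .of_bound hf.aestronglyMeasurable 1 (Eventually.of_forall h1)

theorem integral_bind_kernel {K : Kernel X X} [IsMarkovKernel K] {f : X → ℝ} (hf : Measurable f)
    (h1 : ∀ x, |f x| ≤ 1) (μ : Measure X) [IsProbabilityMeasure μ] :
    ∫ x, f x ∂(μ.bind K) = ∫ x, ∫ y, f y ∂K x ∂μ := by
  have := Kernel.integral_comp (κ := Kernel.const Unit μ) (η := K) (a := ())
    (f := f) (integrable_of_abs_le_one hf h1 _)
  rwa [← Measure.comp_eq_comp_const_apply, Kernel.const_apply] at this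

theorem abs_integral_le_one {f : X → ℝ} (h1 : ∀ x, |f x| ≤ 1) (μ : Measure X)
    [IsProbabilityMeasure μ] : |∫ x, f x ∂μ| ≤ 1 := by
  have := norm_integral_le_of_norm_le_const (f := f) (μ := μ) (C := 1) (Eventually.of_forall h1)
  simpa using this

/-- The difference is an integral over μ ⊗ ν of a bounded function that tends to 0 pointwise.
Dominated convergence thus covers arbitrary initial laws, although the contraction bound is not
uniform in the starting points. -/
theorem tendsto_integral_bind_pow_sub {K : Kernel X X} [IsMarkovKernel K] {f : X → ℝ}
    (hf : Measurable f) (h1 : ∀ x, |f x| ≤ 1)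
    (h : ∀ x y, Tendsto (fun n : ℕ => ∫ z, f z ∂(K ^ n) x - ∫ z, f z ∂(K ^ n) y) atTop (𝓝 0))
    (μ ν : Measure X) [IsProbabilityMeasure μ] [IsProbabilityMeasure ν] :
    Tendsto (fun n : ℕ => ∫ z, f z ∂(μ.bind (K ^ n)) - ∫ z, f z ∂(ν.bind (K ^ n))) atTop (𝓝 0) := by
  have hK : ∀ n : ℕ, IsMarkovKernel (K ^ n) := fun n => isMarkovKernel_pow K n
  have hm : ∀ n : ℕ, Measurable fun x => ∫ z, f z ∂(K ^ n) x := fun n =>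
    (hf.stronglyMeasurable.integral_kernel (κ := K ^ n)).measurable
  have hb : ∀ (n : ℕ) x, |∫ z, f z ∂(K ^ n) x| ≤ 1 := fun n x => abs_integral_le_one h1 _
  have hi : ∀ n : ℕ, Integrable (fun x => ∫ z, f z ∂(K ^ n) x) μ := fun n =>
    integrable_of_abs_le_one (hm n) (hb n) μ
  have hi' : ∀ n : ℕ, Integrable (fun x => ∫ z, f z ∂(K ^ n) x) ν := fun n =>
    integrable_of_abs_le_one (hm n) (hb n) ν
  have e : ∀ n : ℕ, ∫ z, f z ∂(μ.bind (K ^ n)) - ∫ z, f z ∂(ν.bind (K ^ n)) =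
      ∫ p : X × X, (∫ z, f z ∂(K ^ n) p.1 - ∫ z, f z ∂(K ^ n) p.2) ∂μ.prod ν := fun n => by
    rw [integral_bind_kernel hf h1, integral_bind_kernel hf h1,
      integral_sub ((hi n).comp_fst ν) ((hi' n).comp_snd μ),
      integral_fun_fst (μ := μ) (ν := ν) (f := fun x => ∫ z, f z ∂(K ^ n) x),
      integral_fun_snd (μ := μ) (ν := ν) (f := fun x => ∫ z, f z ∂(K ^ n) x)]
    simp
  simp_rw [e]
  have := tendsto_integral_of_dominated_convergence (μ := μ.prod ν)
    (F := fun (n : ℕ) (p : X × X) => ∫ z, f z ∂(K ^ n) p.1 - ∫ z, f z ∂(K ^ n) p.2)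
    (f := fun _ => 0) (fun _ => 2)
    (fun n => (((hm n).comp measurable_fst).sub ((hm n).comp measurable_snd)).aestronglyMeasurable)
    (integrable_const _)
    (fun n => Eventually.of_forall fun p => by
      refine (abs_sub _ _).trans ?_
      linarith [hb n p.1, hb n p.2])
    (Eventually.of_forall fun p => h p.1 p.2)
  simpa using this

theorem Couples.abs_integral_sub_le {G : Kernel (X × X) (X × X)} [IsMarkovKernel G]
    {K : Kernel X X} (hG : Couples G K) {f : X → ℝ} (hf : Measurable f) (h1 : ∀ x, |f x| ≤ 1)
    {c : X × X → ℝ} (hc : ∀ p, |f p.1 - f p.2| ≤ c p) {D : ℝ} (hD : 0 ≤ D) (p : X × X)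
    (h : ∫⁻ q, ENNReal.ofReal (c q) ∂G p ≤ ENNReal.ofReal D) :
    |∫ z, f z ∂K p.1 - ∫ z, f z ∂K p.2| ≤ D := by
  have i1 := integrable_of_abs_le_one (hf.comp measurable_fst) (fun q => h1 q.1) (G p)
  have i2 := integrable_of_abs_le_one (hf.comp measurable_snd) (fun q => h1 q.2) (G p)
  rw [← hG.fst, ← hG.snd, integral_map measurable_fst.aemeasurable hf.aestronglyMeasurable,
    integral_map measurable_snd.aemeasurable hf.aestronglyMeasurable]
  erw [← integral_sub i1 i2]
  rw [← Real.norm_eq_abs]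
  refine (norm_integral_le_lintegral_norm _).trans ?_
  refine ENNReal.toReal_le_of_le_ofReal hD (le_trans (lintegral_mono fun q => ?_) h)
  exact ENNReal.ofReal_le_ofReal (hc q)

end Mixing

namespace Model

open Filter Topology
open scoped NNReal

variable {d : ℕ} {Zs : Type*} [MeasurableSpace Zs] {M : Model d Zs}
variable {α : ℝ} {N : Seminorm ℝ (Vec d)} {ρ g ε w B s γ : ℝ} {t : ℕ}

/-- For equal z's this is the Lipschitz bound; otherwise the difference is at most 2, and the
penalty is at least 4s ≥ 4. -/
theorem BlockConstants.abs_prodTest_sub_le (h : M.BlockConstants α N ρ g ε t w B s γ)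
    (hN : ∀ x, ‖x‖ ≤ N x) (hw : 1 ≤ w) (hs : 1 ≤ s) (S : Set Zs) {f : Vec d × Vec d → ℝ} {L : ℝ≥0}
    (hf : LipschitzWith L f) (h0 : ∀ x, 0 ≤ f x) (h1 : ∀ x, f x ≤ 1)
    (p : StateY d Zs × StateY d Zs) :
    |prodTest S f p.1 - prodTest S f p.2| ≤ (L + 1) * blockCost N w B s p := by
  have hc := h.blockCost_nonneg p
  by_cases hp : p.1.1 = p.2.1
  · have e1 : |prodTest S f p.1 - prodTest S f p.2| ≤ |f p.1.2 - f p.2.2| := by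
      by_cases hx : p.2.1 ∈ S <;> simp [prodTest, hp, hx]
    have e2 := hf.dist_le_mul p.1.2 p.2.2
    rw [Real.dist_eq] at e2
    have e3 : dist p.1.2 p.2.2 ≤ blockCost N w B s p := by
      have a0 : 0 ≤ N (p.1.2.1 - p.2.2.1) := apply_nonneg N _
      have a1 : 0 ≤ N (p.1.2.2 - p.2.2.2) := apply_nonneg N _
      rw [blockCost, if_pos hp, add_zero, syncCost, Prod.dist_eq, dist_eq_norm, dist_eq_norm]
      refine max_le ?_ ?_
      · nlinarith [hN (p.1.2.1 - p.2.2.1)]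
      · nlinarith [hN (p.1.2.2 - p.2.2.2)]
    have : (L : ℝ) * dist p.1.2 p.2.2 ≤ L * blockCost N w B s p := by gcongr
    linarith
  · have e1 := abs_prodTest_le S h0 h1 p.1
    have e2 := abs_prodTest_le S h0 h1 p.2
    have e3 := h.blockCost_ge hp
    have hB := h.B_nonneg
    have n1 : 0 ≤ N p.1.2.1 + N p.2.2.1 := add_nonneg (apply_nonneg N _) (apply_nonneg N _)
    have n2 : 0 ≤ N p.1.2.2 + N p.2.2.2 := add_nonneg (apply_nonneg N _) (apply_nonneg N _)
    have n3 : 0 ≤ B * (N p.1.2.1 + N p.2.2.1) := by positivity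
    have n4 : 0 ≤ (L : ℝ) * blockCost N w B s p := by positivity
    have := abs_sub (prodTest S f p.1) (prodTest S f p.2)
    linarith

theorem BlockConstants.tendsto_integral_prodTest [StandardBorelSpace Zs]
    (h : M.BlockConstants α N ρ g ε t w B s γ) (hQ : UniformlyErgodic M.Q t)
    (hN : ∀ x, ‖x‖ ≤ N x) (hw : 1 ≤ w) (hs : 1 ≤ s) (hγ : γ < 1) {S : Set Zs}
    (hS : MeasurableSet S) {f : Vec d × Vec d → ℝ} {L : ℝ≥0}
    (hf : LipschitzWith L f) (h0 : ∀ x, 0 ≤ f x) (h1 : ∀ x, f x ≤ 1) (y y' : StateY d Zs) :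
    Tendsto (fun n => ∫ z, prodTest S f z ∂((M.kernelY α ^ t) ^ n) y -
      ∫ z, prodTest S f z ∂((M.kernelY α ^ t) ^ n) y') atTop (𝓝 0) := by
  obtain ⟨G, hG, hGc, hGi⟩ := h.exists_coupling_pow_block hQ
  have hγ0 := h.gamma_nonneg
  have hm := measurable_prodTest hS hf.continuous
  have hc0 := h.blockCost_nonneg (y, y')
  have hbm := (measurable_blockCost (Zs := Zs) h.continuous w B s).ennreal_ofReal
  refine squeeze_zero_norm (a := fun n => ((L : ℝ) + 1) * ((γ ^ t) ^ n * blockCost N w B s (y, y')))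
    (fun n => ?_) ?_
  · have := isMarkovKernel_pow G n
    refine (hGc.pow n).abs_integral_sub_le hm (abs_prodTest_le S h0 h1)
      (h.abs_prodTest_sub_le hN hw hs S hf h0 h1) (by positivity) (y, y') ?_
    have hL : (0 : ℝ) ≤ L + 1 := by positivity
    simp_rw [ENNReal.ofReal_mul hL]
    rw [lintegral_const_mul _ hbm, ENNReal.ofReal_mul (by positivity : 0 ≤ (γ ^ t) ^ n),
      ENNReal.ofReal_pow (by positivity)]
    gcongr
    exact lintegral_pow_le hbm hGi n (y, y')
  · have ht : γ ^ t < 1 := pow_lt_one₀ hγ0 hγ (Nat.one_le_iff_ne_zero.1 hQ.1)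
    have := ((tendsto_pow_atTop_nhds_zero_of_lt_one (by positivity) ht).mul_const
      (blockCost N w B s (y, y'))).const_mul ((L : ℝ) + 1)
    simpa using this

end Model

/-! ### Uniqueness by forgetting, existence by tightness. -/

section Invariant

open Filter Topology
open scoped NNReal

theorem bind_pow_succ {X : Type*} [MeasurableSpace X] (K : Kernel X X) (μ : Measure X) (n : ℕ) :
    (μ.bind K).bind (K ^ n) = (μ.bind (K ^ n)).bind K := by
  have e1 : (K ^ n) ∘ₘ (K ∘ₘ μ) = ((K ^ n) ∘ₖ K) ∘ₘ μ := Measure.comp_assoc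
  have e2 : K ∘ₘ ((K ^ n) ∘ₘ μ) = (K ∘ₖ (K ^ n)) ∘ₘ μ := Measure.comp_assoc
  rw [e1, e2]
  have : (K ^ n) ∘ₖ K = K ∘ₖ (K ^ n) := (pow_succ K n).symm.trans (pow_succ' K n)
  rw [this]

theorem invariant_pow {X : Type*} [MeasurableSpace X] {K : Kernel X X} {μ : Measure X}
    (h : Kernel.Invariant K μ) (n : ℕ) : μ.bind (K ^ n) = μ := by
  induction n with
  | zero =>
    rw [pow_zero]
    exact Measure.id_comp
  | succ n ih =>
    have e : (K ^ n) ∘ₘ (K ∘ₘ μ) = ((K ^ n) ∘ₖ K) ∘ₘ μ := Measure.comp_assoc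
    have e' : (K ^ n) ∘ₖ K = K ^ (n + 1) := (pow_succ K n).symm
    rw [← e', ← e]
    exact (congrArg (fun ρ => ρ.bind (K ^ n)) h).trans ih

theorem map_bind_of_semiconj {X Y : Type*} [MeasurableSpace X] [MeasurableSpace Y] {K : Kernel X X}
    {L : Kernel Y Y} {φ : X → Y} (hφ : Measurable φ) (h : ∀ x, (K x).map φ = L (φ x))
    (μ : Measure X) : (μ.bind K).map φ = (μ.map φ).bind L := by
  ext s hs
  rw [Measure.map_apply hφ hs, Measure.bind_apply (hφ hs) K.aemeasurable,
    Measure.bind_apply hs L.aemeasurable, lintegral_map (L.measurable_coe hs) hφ]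
  refine lintegral_congr fun x => ?_
  rw [← h, Measure.map_apply hφ hs]

variable {Z E : Type*} [MeasurableSpace Z] [PseudoMetricSpace E] [MeasurableSpace E] [BorelSpace E]

/-- The laws of the chain forget their initial distribution, when tested against products of
indicators and Lipschitz functions. -/
def ForgetsInitialLaw (P : Kernel (Z × E) (Z × E)) : Prop :=
  ∀ (S : Set Z), MeasurableSet S → ∀ (f : E → ℝ) (L : ℝ≥0), LipschitzWith L f → (∀ x, 0 ≤ f x) →
    (∀ x, f x ≤ 1) → ∀ (μ ν : Measure (Z × E)) [IsProbabilityMeasure μ] [IsProbabilityMeasure ν],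
      Tendsto (fun n : ℕ => ∫ z, prodTest S f z ∂(μ.bind (P ^ n)) -
        ∫ z, prodTest S f z ∂(ν.bind (P ^ n))) atTop (𝓝 0)

/-- For stationary laws the differences of integrals are constant in n and tend to 0. -/
theorem ForgetsInitialLaw.unique {K : Kernel (Z × E) (Z × E)} {t : ℕ}
    (h : ForgetsInitialLaw (K ^ t)) {μ ν : Measure (Z × E)} (hμ : IsStationaryDistribution K μ)
    (hν : IsStationaryDistribution K ν) : μ = ν := by
  have := hμ.1
  have := hν.1
  refine ext_of_integral_prodTest (MeasurableSpace.isPiSystem_measurableSet)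
    MeasurableSpace.generateFrom_measurableSet MeasurableSet.univ fun S hS f L hf h0 h1 => ?_
  have l := h S hS f L hf h0 h1 μ ν
  have e : ∀ n : ℕ, μ.bind ((K ^ t) ^ n) = μ ∧ ν.bind ((K ^ t) ^ n) = ν := fun n => by
    rw [← pow_mul]
    exact ⟨invariant_pow hμ.2 _, invariant_pow hν.2 _⟩
  simp_rw [fun n => (e n).1, fun n => (e n).2] at l
  exact sub_eq_zero.1 (tendsto_nhds_unique tendsto_const_nhds l)

/-- A Krylov–Bogoliubov argument without averaging: the asymptotic invariance of μ n is assumed, and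
it passes to a weak limit because both the test function and its image under K are bounded and
continuous. -/
theorem exists_invariant_of_tight [TopologicalSpace Z] [PolishSpace Z] [BorelSpace Z]
    [SecondCountableTopology E] [T2Space E]
    {K : Kernel (Z × E) (Z × E)} [IsMarkovKernel K] {C : Set (Set Z)} (hC : IsPiSystem C)
    (hgen : MeasurableSpace.generateFrom C = ‹MeasurableSpace Z›) (huniv : Set.univ ∈ C)
    (hc : ∀ B ∈ C, ∀ (f : E → ℝ) (L : ℝ≥0), LipschitzWith L f →
      Continuous (prodTest B f) ∧ Continuous fun x => ∫ y, prodTest B f y ∂K x)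
    {μ : ℕ → Measure (Z × E)} (hμ : ∀ n, IsProbabilityMeasure (μ n))
    (htight : IsTightMeasureSet (Set.range μ))
    (hlim : ∀ B ∈ C, ∀ (f : E → ℝ) (L : ℝ≥0), LipschitzWith L f → (∀ x, 0 ≤ f x) →
      (∀ x, f x ≤ 1) → Tendsto (fun n : ℕ => ∫ z, prodTest B f z ∂μ n -
        ∫ z, prodTest B f z ∂((μ n).bind K)) atTop (𝓝 0)) :
    ∃ ν, IsStationaryDistribution K ν := by
  let u : ℕ → ProbabilityMeasure (Z × E) := fun n => ⟨μ n, hμ n⟩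
  have hcomp : IsCompact (closure (Set.range u)) := by
    refine isCompact_closure_of_isTightMeasureSet (htight.subset ?_)
    rintro _ ⟨_, ⟨n, rfl⟩, rfl⟩
    exact ⟨n, rfl⟩
  -- An ultrafilter finer than `atTop` plays the role of a convergent subsequence.
  let U : Ultrafilter ℕ := Ultrafilter.of atTop
  have hU : (U : Filter ℕ) ≤ atTop := Ultrafilter.of_le atTop
  obtain ⟨ν, -, hν⟩ := hcomp.ultrafilter_le_nhds (U.map u) (by
    rw [le_principal_iff]
    exact Filter.Eventually.of_forall (f := (U : Filter ℕ)) fun n =>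
      (subset_closure ⟨n, rfl⟩ : u n ∈ closure (Set.range u)))
  have hν' : Tendsto u U (𝓝 ν) := hν
  rw [ProbabilityMeasure.tendsto_iff_forall_integral_tendsto] at hν'
  refine ⟨ν, inferInstance, ?_⟩
  refine ext_of_integral_prodTest hC hgen huniv fun B hB f L hf h0 h1 => ?_
  have hBm : MeasurableSet B := by
    rw [← hgen]; exact MeasurableSpace.measurableSet_generateFrom hB
  have hm := measurable_prodTest hBm hf.continuous
  have hb := abs_prodTest_le B h0 h1
  obtain ⟨c1, c2⟩ := hc B hB f L hf
  have l1 := hν' (BoundedContinuousFunction.ofNormedAddCommGroup _ c1 1 hb)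
  have l2 := hν' (BoundedContinuousFunction.ofNormedAddCommGroup _ c2 1
    fun x => abs_integral_le_one hb (K x))
  have l3 := (hlim B hB f L hf h0 h1).mono_left hU
  have l4 := l1.sub l2
  simp only [BoundedContinuousFunction.coe_ofNormedAddCommGroup] at l4
  have e : ∀ n, ∫ z, prodTest B f z ∂((μ n).bind K) = ∫ x, ∫ y, prodTest B f y ∂K x ∂μ n :=
    fun n => integral_bind_kernel hm hb _
  simp_rw [e] at l3
  rw [integral_bind_kernel hm hb]
  exact (sub_eq_zero.1 (tendsto_nhds_unique l4 l3)).symm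

end Invariant

/-! ### Stationary distributions of Y and V. -/

namespace Model

open Filter Topology
open scoped NNReal

variable {d : ℕ} {Zs : Type*} [MeasurableSpace Zs] {M : Model d Zs}

section Continuity

variable [TopologicalSpace Zs]

theorem continuous_act_Atilde (hA : ∀ i j, Continuous fun z => M.A z i j) :
    Continuous fun p : Zs × Vec d => act (M.Atilde p.1) p.2 := by
  have h : (fun p : Zs × Vec d => act (M.Atilde p.1) p.2)
      = fun p => WithLp.toLp 2 (fun i => ∑ j, (M.A p.1 i j - M.Abar i j) * p.2 j) := by
    funext p
    ext i
    simp [act, Atilde, Matrix.mulVec, dotProduct, sub_mul]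
  rw [h]
  refine (PiLp.continuous_toLp 2 _).comp (continuous_pi fun i => ?_)
  refine continuous_finsetSum _ fun j _ => ?_
  have h1 : Continuous fun p : Zs × Vec d => M.A p.1 i j := (hA i j).comp continuous_fst
  fun_prop

theorem continuous_noise (hA : ∀ i j, Continuous fun z => M.A z i j) (hb : Continuous M.b) :
    Continuous M.noise :=
  ((continuous_act_Atilde hA).comp (continuous_id.prodMk continuous_const)).sub
    (hb.sub continuous_const)

theorem continuous_steps (hA : ∀ i j, Continuous fun z => M.A z i j) (hb : Continuous M.b) (α : ℝ) :
    Continuous fun y : StateY d Zs => M.steps α y.1 y.2 := by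
  have hact : Continuous (act (1 - α • M.Abar) : Vec d → Vec d) :=
    (Matrix.toEuclideanCLM (𝕜 := ℝ) _).continuous
  have hA' := (continuous_act_Atilde hA).comp
    (continuous_fst.prodMk (continuous_fst.comp continuous_snd) :
      Continuous fun y : StateY d Zs => (y.1, y.2.1))
  have h0 : Continuous fun y : StateY d Zs => M.step0 α y.1 y.2.1 :=
    (hact.comp (continuous_fst.comp continuous_snd)).sub
      (((continuous_noise hA hb).comp continuous_fst).const_smul α)
  have h1 : Continuous fun y : StateY d Zs => M.step1 α y.1 y.2.1 y.2.2 :=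
    (hact.comp (continuous_snd.comp continuous_snd)).sub (hA'.const_smul α)
  exact h0.prodMk h1

end Continuity

/-- Given the state, the new z and the new (j₀, j₁) are independent, the latter being deterministic.
So continuity of Q(·, S) and of the recursion maps is all that is needed for the image of a test
function. -/
theorem integral_prodTest_kernelY {S : Set Zs} (hS : MeasurableSet S) {f : Vec d × Vec d → ℝ}
    (hf : Continuous f) (α : ℝ) (y : StateY d Zs) :
    ∫ x, prodTest S f x ∂M.kernelY α y = (M.Q y.1).real S * f (M.steps α y.1 y.2) := by
  rw [kernelY_apply, integral_map (by fun_prop) (measurable_prodTest hS hf).aestronglyMeasurable]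
  simp only [prodTest]
  rw [integral_mul_const, integral_indicator_const _ hS]
  simp

/-- On a Polish space, the topology can be refined without changing the Borel sets so that the
data of the model become continuous. -/
theorem exists_polish_refinement (M : Model d Zs) [t : TopologicalSpace Zs] [hp : PolishSpace Zs]
    [hb : BorelSpace Zs] {C : Set (Set Zs)} (hC : C.Countable) (hCm : ∀ B ∈ C, MeasurableSet B) :
    ∃ t' : TopologicalSpace Zs, @PolishSpace Zs t' ∧ @BorelSpace Zs t' _ ∧
      (∀ i j, @Continuous _ _ t' _ fun z => M.A z i j) ∧ @Continuous _ _ t' _ M.b ∧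
      ∀ B ∈ C, (@Continuous _ _ t' _ (B.indicator fun _ => (1 : ℝ))) ∧
        @Continuous _ _ t' _ fun z => (M.Q z).real B := by
  have := hC.to_subtype
  -- All the functions to be made continuous are collected in one measurable map into a countable
  -- product.
  let F : Zs → (Fin d → Fin d → ℝ) × Vec d × (C → ℝ) × (C → ℝ) := fun z =>
    (fun i j => M.A z i j, M.b z, fun B => (B : Set Zs).indicator (fun _ => (1 : ℝ)) z,
      fun B => (M.Q z).real (B : Set Zs))
  have hF : Measurable F := by
    refine Measurable.prodMk (measurable_pi_lambda _ fun i => measurable_pi_lambda _ fun j =>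
      M.measurable_A i j) (M.measurable_b.prodMk (Measurable.prodMk ?_ ?_))
    · exact measurable_pi_lambda _ fun B => measurable_const.indicator (hCm B B.2)
    · exact measurable_pi_lambda _ fun B => (M.Q.measurable_coe (hCm B B.2)).ennreal_toReal
  obtain ⟨t', ht', hc, hP⟩ := hF.exists_continuous
  refine ⟨t', hP, ⟨?_⟩, fun i j => ?_, ?_, fun B hB => ⟨?_, ?_⟩⟩
  -- Two comparable Polish topologies have the same Borel sets.
  · exact hb.measurable_eq.trans (borel_eq_borel_of_le hP hp ht').symm
  · exact (continuous_apply j).comp ((continuous_apply i).comp (continuous_fst.comp hc))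
  · exact continuous_fst.comp (continuous_snd.comp hc)
  · exact (continuous_apply (⟨B, hB⟩ : C)).comp
      (continuous_fst.comp (continuous_snd.comp (continuous_snd.comp hc)))
  · exact (continuous_apply (⟨B, hB⟩ : C)).comp
      (continuous_snd.comp (continuous_snd.comp (continuous_snd.comp hc)))

variable {α : ℝ} {N : Seminorm ℝ (Vec d)} {ρ g ε w B s γ : ℝ} {t : ℕ}

theorem BlockConstants.forgetsInitialLaw [StandardBorelSpace Zs]
    (h : M.BlockConstants α N ρ g ε t w B s γ) (hQ : UniformlyErgodic M.Q t)
    (hN : ∀ x, ‖x‖ ≤ N x) (hw : 1 ≤ w) (hs : 1 ≤ s) (hγ : γ < 1) :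
    ForgetsInitialLaw (M.kernelY α ^ t) := by
  intro S hS f L hf h0 h1 μ ν _ _
  have := isMarkovKernel_pow (M.kernelY α) t
  exact tendsto_integral_bind_pow_sub (measurable_prodTest hS hf.continuous)
    (abs_prodTest_le S h0 h1) (h.tendsto_integral_prodTest hQ hN hw hs hγ hS hf h0 h1) μ ν

/-- The two bounds are the fixed points of the scalar recursions u ↦ ρu + ε and v ↦ ρv + gu, so the
region is preserved by the chain and contains the origin. -/
theorem StepBounds.ae_kernelY_pow_le_of_lt_one (h : M.StepBounds α N ρ g ε) (hρ : ρ < 1) (n : ℕ)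
    (z : Zs) : ∀ᵐ y ∂(M.kernelY α ^ n) (z, 0, 0),
      N y.2.1 ≤ ε / (1 - ρ) ∧ N y.2.2 ≤ g * (ε / (1 - ρ)) / (1 - ρ) := by
  have hρ' : 0 < 1 - ρ := by linarith
  have hg := h.g_nonneg
  have he := h.eps_nonneg
  have hr := h.rho_nonneg
  refine ae_pow_of_ae_step (K := M.kernelY α)
    (P := fun _ y => N y.2.1 ≤ ε / (1 - ρ) ∧ N y.2.2 ≤ g * (ε / (1 - ρ)) / (1 - ρ))
    (fun n => measurableSet_seminorm_le h.continuous _ _) (fun n x hx => ?_) n ?_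
  · refine M.ae_kernelY α x (measurableSet_seminorm_le h.continuous _ _) fun z => ?_
    constructor
    · calc N (M.step0 α x.1 x.2.1) ≤ ρ * N x.2.1 + ε := h.step0_le _ _
        _ ≤ ρ * (ε / (1 - ρ)) + ε := by gcongr; exact hx.1
        _ = ε / (1 - ρ) := by field_simp; ring
    · calc N (M.step1 α x.1 x.2.1 x.2.2) ≤ ρ * N x.2.2 + g * N x.2.1 := h.step1_le _ _ _
        _ ≤ ρ * (g * (ε / (1 - ρ)) / (1 - ρ)) + g * (ε / (1 - ρ)) := by
          gcongr
          · exact hx.2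
          · exact hx.1
        _ = g * (ε / (1 - ρ)) / (1 - ρ) := by field_simp; ring
  · simp only [map_zero]
    constructor <;> positivity

/-- Tightness is checked on marginals: the first is always π, and the second is carried by a fixed
compact set. -/
theorem isTightMeasureSet_kernelY_pow [TopologicalSpace Zs] [PolishSpace Zs] [BorelSpace Zs]
    (h : M.StepBounds α N ρ g ε) (hρ : ρ < 1) (hN : ∀ x, ‖x‖ ≤ N x)
    (hπ : IsStationaryDistribution M.Q M.π) (k : ℕ → ℕ) :
    IsTightMeasureSet (Set.range fun n =>
      (M.π.map fun z => ((z, 0, 0) : StateY d Zs)).bind (M.kernelY α ^ k n)) := by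
  have := hπ.1
  refine IsTightMeasureSet.prodMk ?_ ?_
  · refine (isTightMeasureSet_singleton (μ := M.π)).subset ?_
    rintro _ ⟨_, ⟨n, rfl⟩, rfl⟩
    simp only [Set.mem_singleton_iff]
    rw [Measure.fst, map_bind_of_semiconj measurable_fst
      (map_pow_apply_of_semiconj measurable_fst (M.kernelY_map_fst α) (k n)),
      Measure.map_map measurable_fst (by fun_prop)]
    have e : (Prod.fst ∘ fun z => ((z, 0, 0) : StateY d Zs)) = id := rfl
    rw [e, Measure.map_id]
    exact invariant_pow hπ.2 _
  · rw [isTightMeasureSet_iff_exists_isCompact_measure_compl_le]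
    intro e he
    refine ⟨{j | N j.1 ≤ ε / (1 - ρ) ∧ N j.2 ≤ g * (ε / (1 - ρ)) / (1 - ρ)}, ?_, ?_⟩
    · have hNc := h.continuous
      refine (isCompact_closedBall (0 : Vec d × Vec d)
        (max (ε / (1 - ρ)) (g * (ε / (1 - ρ)) / (1 - ρ)))).of_isClosed_subset ?_ ?_
      · exact (isClosed_le (hNc.comp continuous_fst) continuous_const).inter
          (isClosed_le (hNc.comp continuous_snd) continuous_const)
      · intro j hj
        rw [mem_closedBall_zero_iff, Prod.norm_def]
        exact max_le_max ((hN _).trans hj.1) ((hN _).trans hj.2)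
    · rintro _ ⟨_, ⟨n, rfl⟩, rfl⟩
      refine le_of_eq_of_le ?_ zero_le
      have hm : MeasurableSet {y : StateY d Zs | N y.2.1 ≤ ε / (1 - ρ) ∧
          N y.2.2 ≤ g * (ε / (1 - ρ)) / (1 - ρ)} := measurableSet_seminorm_le h.continuous _ _
      have hae : ∀ᵐ y ∂((M.π.map fun z => ((z, 0, 0) : StateY d Zs)).bind (M.kernelY α ^ k n)),
          N y.2.1 ≤ ε / (1 - ρ) ∧ N y.2.2 ≤ g * (ε / (1 - ρ)) / (1 - ρ) := by
        have hmk : Measurable fun z : Zs => ((z, 0, 0) : StateY d Zs) := by fun_prop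
        refine Measure.ae_comp_of_ae_ae hm ?_
        rw [ae_map_iff hmk.aemeasurable]
        · exact Eventually.of_forall fun z => h.ae_kernelY_pow_le_of_lt_one hρ (k n) z
        · exact measurableSet_eq_fun ((M.kernelY α ^ k n).measurable_coe hm.compl) measurable_const
      have hm' : MeasurableSet {j : Vec d × Vec d | N j.1 ≤ ε / (1 - ρ) ∧
          N j.2 ≤ g * (ε / (1 - ρ)) / (1 - ρ)} := by
        have hNm := h.continuous.measurable
        exact (measurableSet_le (hNm.comp measurable_fst) measurable_const).inter
          (measurableSet_le (hNm.comp measurable_snd) measurable_const)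
      rw [Measure.snd, Measure.map_apply measurable_snd hm'.compl]
      exact hae

theorem BlockConstants.exists_stationary_kernelY [TopologicalSpace Zs] [PolishSpace Zs]
    [BorelSpace Zs] (h : M.BlockConstants α N ρ g ε t w B s γ) (hM : M.AssumptionMixing t)
    (hN : ∀ x, ‖x‖ ≤ N x) (hw : 1 ≤ w) (hs : 1 ≤ s) (hγ : γ < 1) :
    ∃ ν, IsStationaryDistribution (M.kernelY α) ν := by
  obtain ⟨C, hCc, hC, hgen, huniv⟩ := exists_countable_piSystem Zs
  have hCm : ∀ S ∈ C, MeasurableSet S := fun S hS => by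
    rw [← hgen]; exact MeasurableSpace.measurableSet_generateFrom hS
  have hforget := h.forgetsInitialLaw hM.2 hN hw hs hγ
  obtain ⟨t', hP, hB, hA, hb, hcont⟩ := M.exists_polish_refinement hCc hCm
  have := hM.1.1
  have hk : ∀ n : ℕ, IsMarkovKernel (M.kernelY α ^ n) := fun n => isMarkovKernel_pow _ n
  have hmk : Measurable fun z : Zs => ((z, 0, 0) : StateY d Zs) := by fun_prop
  let μ₀ : Measure (StateY d Zs) := M.π.map fun z => ((z, 0, 0) : StateY d Zs)
  have hμ₀ : IsProbabilityMeasure μ₀ := Measure.isProbabilityMeasure_map hmk.aemeasurable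
  let μ : ℕ → Measure (StateY d Zs) := fun n =>
    μ₀.bind ⇑(M.kernelY α ^ (t * n) : Kernel (StateY d Zs) (StateY d Zs))
  have hμ : ∀ n, IsProbabilityMeasure (μ n) := fun n => inferInstance
  refine @exists_invariant_of_tight Zs (Vec d × Vec d) _ _ _ _ t' hP hB _ _ (M.kernelY α) _ C hC hgen
    huniv (fun S hS f L hf => ⟨?_, ?_⟩) μ
    hμ ?_ (fun S hS f L hf h0 h1 => ?_)
  · exact ((hcont S hS).1.comp continuous_fst).mul (hf.continuous.comp continuous_snd)
  · simp_rw [integral_prodTest_kernelY (hCm S hS) hf.continuous]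
    exact ((hcont S hS).2.comp continuous_fst).mul
      (hf.continuous.comp (continuous_steps hA hb α))
  -- Tightness is needed in the refined topology, which has fewer compact sets; π is still tight
  -- there because that topology is Polish.
  · exact @isTightMeasureSet_kernelY_pow d Zs _ M α N ρ g ε t' hP hB h.toStepBounds
      (h.rho_le.trans_lt hγ) hN hM.1 fun n => t * n
  -- Comparing the initial laws μ₀ and μ₀K, and commuting K with its powers, gives the asymptotic
  -- invariance of the sequence.
  · have l := hforget S (hCm S hS) f L hf h0 h1 μ₀ (μ₀.bind (M.kernelY α))
    simp_rw [← pow_mul, bind_pow_succ] at l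
    exact l

/-- A section of the projection of the chain `Y` onto the chain `V`. -/
def liftV (v : Vec d × Zs) : StateY d Zs := (v.2, v.1, 0)

theorem measurable_liftV : Measurable (liftV : Vec d × Zs → StateY d Zs) := by
  unfold liftV; fun_prop

theorem isStationary_map_projV {ν : Measure (StateY d Zs)}
    (hν : IsStationaryDistribution (M.kernelY α) ν) :
    IsStationaryDistribution (M.kernelV α) (ν.map projV) := by
  have := hν.1
  refine ⟨Measure.isProbabilityMeasure_map measurable_projV.aemeasurable, ?_⟩
  exact (map_bind_of_semiconj measurable_projV (M.kernelY_map_projV α) ν).symm.trans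
    (congrArg (Measure.map projV) hν.2)

/-- A stationary law of V, lifted with j₁ = 0, need not be stationary for Y, but its evolution under
Y always projects back to it. Forgetting for Y, tested on functions of j₀ alone, then identifies two
such laws. -/
theorem kernelV_stationary_unique (hforget : ForgetsInitialLaw (M.kernelY α ^ t))
    {μ ν : Measure (Vec d × Zs)} (hμ : IsStationaryDistribution (M.kernelV α) μ)
    (hν : IsStationaryDistribution (M.kernelV α) ν) : μ = ν := by
  have := hμ.1
  have := hν.1
  have hk : ∀ n : ℕ, IsMarkovKernel (M.kernelY α ^ n) := fun n => isMarkovKernel_pow _ n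
  have key : ∀ ρ : Measure (Vec d × Zs), IsStationaryDistribution (M.kernelV α) ρ →
      ∀ (S : Set Zs) (_ : MeasurableSet S) (f : Vec d → ℝ) (_ : Continuous f) (n : ℕ),
        ∫ y, prodTest S (fun j : Vec d × Vec d => f j.1) y
          ∂((ρ.map liftV).bind ((M.kernelY α ^ t) ^ n)) =
        ∫ x, prodTest S f x ∂ρ.map Prod.swap := by
    intro ρ hρ S hS f hf n
    have e : ((ρ.map liftV).bind ((M.kernelY α ^ t) ^ n)).map projV = ρ := by
      rw [← pow_mul, map_bind_of_semiconj measurable_projV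
        (map_pow_apply_of_semiconj measurable_projV (M.kernelY_map_projV α) _),
        Measure.map_map measurable_projV measurable_liftV]
      have e : projV ∘ liftV = (id : Vec d × Zs → Vec d × Zs) := rfl
      rw [e, Measure.map_id]
      exact invariant_pow hρ.2 _
    have hm := measurable_prodTest hS hf
    rw [integral_map measurable_swap.aemeasurable hm.aestronglyMeasurable]
    conv_rhs => rw [← e]
    exact (integral_map (μ := (ρ.map liftV).bind ((M.kernelY α ^ t) ^ n))
      measurable_projV.aemeasurable (hm.comp measurable_swap).aestronglyMeasurable).symm
  have hswap : μ.map Prod.swap = ν.map Prod.swap := by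
    have := Measure.isProbabilityMeasure_map (μ := μ) measurable_swap.aemeasurable (f := Prod.swap)
    have := Measure.isProbabilityMeasure_map (μ := ν) measurable_swap.aemeasurable (f := Prod.swap)
    have := Measure.isProbabilityMeasure_map (μ := μ)
      (measurable_liftV (d := d) (Zs := Zs)).aemeasurable
    have := Measure.isProbabilityMeasure_map (μ := ν)
      (measurable_liftV (d := d) (Zs := Zs)).aemeasurable
    refine ext_of_integral_prodTest (MeasurableSpace.isPiSystem_measurableSet)
      MeasurableSpace.generateFrom_measurableSet MeasurableSet.univ fun S hS f L hf h0 h1 => ?_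
    have l := hforget S hS (fun j => f j.1) (L * 1) (hf.comp LipschitzWith.prod_fst)
      (fun j => h0 _) (fun j => h1 _) (μ.map liftV) (ν.map liftV)
    simp_rw [key μ hμ S hS f hf.continuous, key ν hν S hS f hf.continuous] at l
    exact sub_eq_zero.1 (tendsto_nhds_unique tendsto_const_nhds l)
  have := congrArg (Measure.map Prod.swap) hswap
  rwa [Measure.map_map measurable_swap measurable_swap,
    Measure.map_map measurable_swap measurable_swap, Prod.swap_swap_eq, Measure.map_id,
    Measure.map_id] at this

/-- Existence and uniqueness of the stationary distributions of the two chains. -/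
theorem existsUnique_stationary [NeZero d] [TopologicalSpace Zs] [PolishSpace Zs]
    [BorelSpace Zs] (hA : M.AssumptionA) (hN : M.AssumptionNoise) (hM : M.AssumptionMixing t)
    (h0 : 0 < α) (hα : α < M.alphaB t) :
    (∃! ν, IsStationaryDistribution (M.kernelY α) ν) ∧
      ∃! ν, IsStationaryDistribution (M.kernelV α) ν := by
  obtain ⟨N, hN1, -, hbc⟩ := M.exists_blockConstants hA hN hM.2.1 h0 hα
  have ha := M.a_pos hA
  -- The maximum with 1 keeps the penalty for z ≠ z' away from zero even when the noise vanishes.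
  have h := hbc _ (le_max_left _ 1)
  have hs := le_max_right (4 * costWeightNe M.kappa M.a M.CA *
    (t * (α * (Real.sqrt M.kappa * M.noiseSup)))) 1
  have hw : 1 ≤ costWeight M.kappa M.a M.CA := one_le_costWeight ha M.CA_nonneg
  have hγ : Real.exp (-(α * M.a) / 12) < 1 := Real.exp_lt_one_iff.2 (by
    have : 0 < α * M.a := by positivity
    linarith)
  obtain ⟨ν, hν⟩ := h.exists_stationary_kernelY hM hN1 hw hs hγ
  have hf := h.forgetsInitialLaw hM.2 hN1 hw hs hγ
  exact ⟨⟨ν, hν, fun μ hμ => hf.unique hμ hν⟩, ⟨_, isStationary_map_projV hν,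
    fun μ hμ => kernelV_stationary_unique hf hμ (isStationary_map_projV hν)⟩⟩

end Model

end MarkovLSA

end

theorem mainTheorem8 :
    ∃ C : ℝ → ℝ → ℝ → ℝ,
      ∀ (d : ℕ) (_ : 1 ≤ d) (Zs : Type*) [TopologicalSpace Zs] [PolishSpace Zs] [MeasurableSpace Zs]
        [BorelSpace Zs] (M : MarkovLSA.Model d Zs) (tmix : ℕ),
        M.AssumptionA → M.AssumptionNoise → M.AssumptionMixing tmix →
        ∀ α : ℝ, 0 < α → α < M.alphaB tmix →
          -- `Y` and `V` are Markov chains, for every initial law of `Z` and every initial point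
          (∀ (Ω : Type*) [MeasurableSpace Ω] (P : MeasureTheory.Measure Ω)
              [MeasureTheory.IsProbabilityMeasure P] (Z : ℕ → Ω → Zs),
              MarkovLSA.IsMarkovChain P M.Q Z → ∀ j₀ j₁ : MarkovLSA.Vec d,
                MarkovLSA.IsMarkovChain P (M.kernelY α) (M.Y α Z j₀ j₁) ∧
                MarkovLSA.IsMarkovChain P (M.kernelV α) (M.V α Z j₀)) ∧
          -- unique stationary distributions
          (∃! ν : MeasureTheory.Measure (Zs × MarkovLSA.Vec d × MarkovLSA.Vec d),
              MarkovLSA.IsStationaryDistribution (M.kernelY α) ν) ∧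
          (∃! ν : MeasureTheory.Measure (MarkovLSA.Vec d × Zs),
              MarkovLSA.IsStationaryDistribution (M.kernelV α) ν) ∧
          -- Wasserstein contraction
          (∀ (n : ℕ), 1 ≤ n → ∀ y y' : Zs × MarkovLSA.Vec d × MarkovLSA.Vec d,
              MarkovLSA.wasserstein (M.costY α) ((M.kernelY α ^ n) y) ((M.kernelY α ^ n) y') ≤
                ENNReal.ofReal (C M.kappa M.a M.CA * M.rate tmix α n * M.costY α y y')) ∧
          (∀ (n : ℕ), 1 ≤ n → ∀ v v' : MarkovLSA.Vec d × Zs,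
              MarkovLSA.wasserstein (M.costV α) ((M.kernelV α ^ n) v) ((M.kernelV α ^ n) v') ≤
                ENNReal.ofReal (C M.kappa M.a M.CA * M.rate tmix α n * M.costV α v v')) := by
  -- The 8 is the constant 4 of `exists_coupling_pow` times 2, from bounding the square root of the
  -- logarithm below by 1/2.
  refine ⟨fun κ a c => 8 * MarkovLSA.costRatio κ a c, ?_⟩
  intro d hd Zs _ _ _ _ M tmix hA hN hM α h0 hα
  have : NeZero d := ⟨Nat.one_le_iff_ne_zero.1 hd⟩
  obtain ⟨hY, hV⟩ := MarkovLSA.Model.existsUnique_stationary hA hN hM h0 hα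
  refine ⟨fun Ω _ P _ Z hZ j₀ j₁ => ⟨M.isMarkovChain_Y hZ α j₀ j₁, M.isMarkovChain_V hZ α j₀⟩,
    hY, hV, fun n _ y y' => ?_, fun n _ v v' => ?_⟩
  · exact M.wasserstein_kernelY_le hA hN hM.2 h0 hα n y y'
  · exact M.wasserstein_kernelV_le hA hN hM.2 h0 hα n v v'
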